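/- Let $d\ge 3$ be an integer, $\lambda_c(d)=\frac{(d-1)^{d-1}}{(d-2)^d}$ and $\lambda>\lambda_c(d)$. The hardcore model with fugacity $\lambda$ gives an independent set $\sigma$ of a finite graph weight $\lambda^{|\sigma|}$. Let $p^+$ (resp. $p^-$) be the limit, as $\ell\to\infty$, of the probability that the root of the infinite $d$-regular tree is occupied, conditionally on level $2\ell$ (resp. $2\ell+1$) being completely occupied. **Technical condition.** Put $H_1(x,y)=-x(\log x-\log y)+(x-y)(\log(y-x)-\log y)$ for $0\le x\le y$ (with $0\log 0=0$), $H(x)=H_1(x,1)$, and $$\begin{aligned}f(\alpha,\beta,\gamma,\delta,\epsilon)={}&2(\alpha+\beta)\log\lambda+H(\alpha)+H_1(\gamma,\alpha)+H_1(\alpha-\gamma,1-\alpha)+H(\beta)+H_1(\delta,\beta)+H_1(\beta-\delta,1-\beta)\\&+d\big[H_1(\gamma,1-2\beta+\delta)-H(\gamma)+H_1(\epsilon,1-2\beta+\delta-\gamma)+H_1(\alpha-\gamma-\epsilon,\beta-\delta)\\&\qquad-H_1(\alpha-\gamma,1-\gamma)+H_1(\alpha-\gamma,1-\beta-\gamma-\epsilon)-H_1(\alpha-\gamma,1-\alpha)\big].\end{aligned}$$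 The condition is that there is $\chi_0>0$ such that whenever $|\alpha-p^-|<\chi_0$ and $|\beta-p^+|<\chi_0$, the function $(\gamma,\delta,\epsilon)\mapsto f(\alpha,\beta,\gamma,\delta,\epsilon)$ on the set $$\gamma,\delta,\epsilon\ge0,\quad \alpha-\gamma-\epsilon\ge0,\quad \beta-\delta\ge0,\quad 1-2\beta+\delta-\gamma-\epsilon\ge0,\quad \beta-\delta\ge\alpha-\gamma-\epsilon,\quad 1-\alpha-\beta-\epsilon\ge0$$ (the part of the domain of $f$ cut out by $\alpha-\gamma-\epsilon\ge0$, $\beta-\delta\ge0$, $1-2\beta+\delta-\gamma-\epsilon\ge0$) attains its maximum at $(\alpha^2,\beta^2,\alpha(1-\alpha-\beta))$ and nowhere else. **Random graphs.** For $0<\theta,\psi<\frac18$ let $m'=(d-1)^{\lfloor\theta\log_{d-1}n\rfloor+2\lfloor\frac{\psi}{2}\log_{d-1}n\rfloor}$. The random bipartite graph $\tilde G$ has two sides $W^+\cup U^+$ and $W^-\cup U^-$ with $|W^\pm|=n$, $|U^\pm|=m'$; its edges are those of $d-1$ uniform random perfect matchings of $W^+\cup U^+$ with $W^-\cup U^-$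 and of one uniform random perfect matching of $W^+$ with $W^-$, all independent (multiple edges are merged). With $U=U^+\cup U^-$ and $\eta\in\{0,1\}^U$, let $\eta^\pm=\sum_{u\in U^\pm}\eta_u$, and let $Z^{\alpha,\beta}_{\tilde G}(\eta)$ be the sum of $\lambda^{|\sigma|}$ over the independent sets $\sigma$ of $\tilde G$ with $\sigma_U=\eta$, $|\sigma\cap W^+|=\alpha n$ and $|\sigma\cap W^-|=\beta n$. Let $Z^{\alpha,\beta}_{\mathrm{MWW}}$ be the sum of $\lambda^{|\sigma|}$ over the independent sets with $\alpha n$ vertices on the plus side and $\beta n$ on the minus side of the random bipartite graph formed by $d$ independent uniform perfect matchings between two sides of $n$ vertices. Here $\alpha n$ and $\beta n$ are integers. Put $$C^*=\left(\frac{(1-\alpha)(1-\beta)}{1-\alpha-\beta}\right)^{(d-1)m'},$$ $$\tau^{\alpha,\beta}=\frac{(1-\alpha-\beta+\alpha\beta)^d}{[(1-\alpha-\beta+2\alpha\beta)(1-\alpha-\beta)]^{\frac{d-1}{2}}[(1-\alpha-\beta+d\alpha\beta)(1-\alpha-\beta-(d-2)\alpha\beta)]^{\frac12}}.$$ **Lemma.**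 Suppose that the technical condition holds. Then there is $\chi>0$, depending only on $d$ and $\lambda$, such that for all $0<\theta,\psi<\frac18$, as $n\to\infty$, $$\frac{\mathbb E\big(Z^{\alpha,\beta}_{\tilde G}(\eta)\big)^2}{\mathbb E\big(Z^{\alpha,\beta}_{\mathrm{MWW}}\big)^2}=(1+o(1))\,(C^*)^2\left(\lambda\Big(\frac{1-\alpha-\beta}{1-\beta}\Big)^{d-1}\right)^{2\eta^-}\left(\lambda\Big(\frac{1-\alpha-\beta}{1-\alpha}\Big)^{d-1}\right)^{2\eta^+}$$ and $$\frac{\mathbb E\big(Z^{\alpha,\beta}_{\tilde G}(\eta)\big)^2}{\big(\mathbb E Z^{\alpha,\beta}_{\tilde G}(\eta)\big)^2}=\tau^{\alpha,\beta}+o(1),$$ uniformly over all $(\alpha,\beta)$ with $|\alpha-p^-|,|\beta-p^+|<\chi$ and $\alpha n,\beta n$ integers, and over all $\eta\in\{0,1\}^U$. -/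

import Mathlib

open scoped BigOperators

/-! ## The hardcore model on a finite graph -/

open Classical in
/-- `hardcoreSum G lam P = ∑ lam ^ |σ|`, over the independent sets `σ` of `G` that satisfy `P`
(a configuration in `{0,1}^V` is identified with the set of its occupied vertices). -/
noncomputable def hardcoreSum {V : Type*} [Fintype V] (G : SimpleGraph V) (lam : ℝ)
    (P : Finset V → Prop) : ℝ :=
  ∑ σ ∈ (Finset.univ : Finset (Finset V)).filter
      (fun σ : Finset V => G.IsIndepSet (↑σ : Set V) ∧ P σ),
    lam ^ σ.card

/-- The probability of the event `P` given the event `Q` in the hardcore model on `G`. -/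
noncomputable def hardcoreCondProb {V : Type*} [Fintype V] (G : SimpleGraph V) (lam : ℝ)
    (P Q : Finset V → Prop) : ℝ :=
  hardcoreSum G lam (fun σ => P σ ∧ Q σ) / hardcoreSum G lam Q

/-! ## The `d`-regular tree and the extremal occupation densities -/

/-- Vertices of the infinite `d`-regular tree: words over `d` letters in which neighbouring letters
differ.  The empty word is the root and the length of a word is its level. -/
abbrev RegTreeVertex (d : ℕ) : Type :=
  {w : List (Fin d) // List.IsChain (fun a b => a ≠ b) w}

/-- The infinite `d`-regular tree: a word is adjacent to the words obtained from it by prepending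
one letter. -/
def regTree (d : ℕ) : SimpleGraph (RegTreeVertex d) :=
  SimpleGraph.fromRel fun u v => ∃ a : Fin d, v.1 = a :: u.1

/-- The vertices at distance at most `k` from the root. -/
abbrev TreeBall (d k : ℕ) : Type := {v : RegTreeVertex d // v.1.length ≤ k}

theorem treeBall_finite (d k : ℕ) : Finite (TreeBall d k) := by
  have h : {l : List (Fin d) | l.length ≤ k}.Finite := List.finite_length_le (Fin d) k
  have : Finite {l : List (Fin d) | l.length ≤ k} := h
  refine Finite.of_injective
    (fun v : TreeBall d k => (⟨v.1.1, v.2⟩ : {l : List (Fin d) | l.length ≤ k})) ?_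
  intro u v huv
  exact Subtype.ext (Subtype.ext (Subtype.mk.inj huv))

noncomputable instance treeBallFintype (d k : ℕ) : Fintype (TreeBall d k) :=
  haveI := treeBall_finite d k
  Fintype.ofFinite _

/-- The probability that the root of the `d`-regular tree is occupied in the hardcore model with
fugacity `lam`, conditioned on level `k` being completely occupied.  (Given level `k`, the
configuration above it follows the hardcore model on the ball of radius `k`, by the DLR
condition.) -/
noncomputable def rootOccupation (d : ℕ) (lam : ℝ) (k : ℕ) : ℝ :=
  hardcoreCondProb ((regTree d).comap (Subtype.val : TreeBall d k → RegTreeVertex d)) lam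
    (fun σ => ∃ v ∈ σ, v.1.1 = [])
    (fun σ => ∀ v : TreeBall d k, v.1.1.length = k → v ∈ σ)

/-- The root density `p⁺` of the limit measure with the even levels occupied. -/
noncomputable def pPlus (d : ℕ) (lam : ℝ) : ℝ :=
  Filter.limUnder Filter.atTop fun l : ℕ => rootOccupation d lam (2 * l)

/-- The root density `p⁻` of the limit measure with the odd levels occupied. -/
noncomputable def pMinus (d : ℕ) (lam : ℝ) : ℝ :=
  Filter.limUnder Filter.atTop fun l : ℕ => rootOccupation d lam (2 * l + 1)

/-- The uniqueness threshold `λ_c(d) = (d-1)^(d-1) / (d-2)^d` of the `d`-regular tree. -/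
noncomputable def criticalFugacity (d : ℕ) : ℝ :=
  ((d : ℝ) - 1) ^ (d - 1) / ((d : ℝ) - 2) ^ d

/-! ## The technical condition -/

/-- `H₁(x,y) = -x (log x - log y) + (x-y) (log (y-x) - log y)`, used for `0 ≤ x ≤ y`
(with `0 log 0 = 0`). -/
noncomputable def entH1 (x y : ℝ) : ℝ :=
  -x * (Real.log x - Real.log y) + (x - y) * (Real.log (y - x) - Real.log y)

/-- `H(x) = H₁(x,1)`. -/
noncomputable def entH (x : ℝ) : ℝ := entH1 x 1

/-- The exponential rate `f(α,β,γ,δ,ε)` of the terms of the second moment. -/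
noncomputable def rateF (d : ℕ) (lam α β γ δ ε : ℝ) : ℝ :=
  2 * (α + β) * Real.log lam
    + entH α + entH1 γ α + entH1 (α - γ) (1 - α)
    + entH β + entH1 δ β + entH1 (β - δ) (1 - β)
    + d * (entH1 γ (1 - 2 * β + δ) - entH γ
        + entH1 ε (1 - 2 * β + δ - γ)
        + entH1 (α - γ - ε) (β - δ) - entH1 (α - γ) (1 - γ)
        + entH1 (α - γ) (1 - β - γ - ε) - entH1 (α - γ) (1 - α))

/-- The admissible `(γ,δ,ε)`: the inequalities `α-γ-ε ≥ 0`, `β-δ ≥ 0`, `1-2β+δ-γ-ε ≥ 0`, on the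
domain of `f`, that is, where each `H₁(x,y)` occurring in `f` has `0 ≤ x ≤ y`. -/
def SecondMomentRegion (α β γ δ ε : ℝ) : Prop :=
  0 ≤ α - γ - ε ∧ 0 ≤ β - δ ∧ 0 ≤ 1 - 2 * β + δ - γ - ε ∧
    0 ≤ γ ∧ 0 ≤ δ ∧ 0 ≤ ε ∧ α - γ - ε ≤ β - δ ∧ α - γ ≤ 1 - β - γ - ε

/-- The technical condition: for all `(α,β)` in some neighbourhood of `(p⁻,p⁺)`, the function
`(γ,δ,ε) ↦ f(α,β,γ,δ,ε)` attains its maximum over the admissible set at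
`(α², β², α(1-α-β))` and nowhere else. -/
def TechnicalCondition (d : ℕ) (lam : ℝ) : Prop :=
  ∃ χ : ℝ, 0 < χ ∧ ∀ α β : ℝ, |pMinus d lam - α| < χ → |pPlus d lam - β| < χ →
    SecondMomentRegion α β (α ^ 2) (β ^ 2) (α * (1 - α - β)) ∧
    ∀ γ δ ε : ℝ, SecondMomentRegion α β γ δ ε →
      (γ, δ, ε) ≠ (α ^ 2, β ^ 2, α * (1 - α - β)) →
      rateF d lam α β γ δ ε < rateF d lam α β (α ^ 2) (β ^ 2) (α * (1 - α - β))

/-! ## The random bipartite graphs and their partition functions -/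

/-- `m' = (d-1)^(⌊θ log_{d-1} n⌋ + 2 ⌊(ψ/2) log_{d-1} n⌋)`. -/
noncomputable def boundarySize (d : ℕ) (θ ψ : ℝ) (n : ℕ) : ℕ :=
  (d - 1) ^ (⌊θ * Real.logb ((d : ℝ) - 1) n⌋₊ + 2 * ⌊ψ / 2 * Real.logb ((d : ℝ) - 1) n⌋₊)

/-- One side `W ∪ U` of the graph: `W = Fin n`, `U = Fin m`. -/
abbrev Side (n m : ℕ) : Type := Fin n ⊕ Fin m

/-- The sample space of the random graph `G̃`, on which it is uniform: `d-1` perfect matchings of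
`W⁺ ∪ U⁺` with `W⁻ ∪ U⁻`, and one perfect matching of `W⁺` with `W⁻`. -/
abbrev GadgetSample (d n m : ℕ) : Type :=
  (Fin (d - 1) → Equiv.Perm (Side n m)) × Equiv.Perm (Fin n)

/-- The graph `G̃` (parallel edges merged).  The left summand is the plus side, the right one the
minus side. -/
def gadgetGraph {d n m : ℕ} (ω : GadgetSample d n m) : SimpleGraph (Side n m ⊕ Side n m) :=
  SimpleGraph.fromRel fun u v =>
    (∃ (i : Fin (d - 1)) (x : Side n m), u = Sum.inl x ∧ v = Sum.inr (ω.1 i x)) ∨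
    (∃ w : Fin n, u = Sum.inl (Sum.inl w) ∧ v = Sum.inr (Sum.inl (ω.2 w)))

/-- `Z^{α,β}_{G̃}(η)`: the sum of `lam ^ |σ|` over the independent sets `σ` with `α n` elements in
`W⁺`, `β n` elements in `W⁻`, and `σ ∩ U = η`, where `η = (ηp, ηm)` gives the occupied vertices of
`U⁺` and of `U⁻`. -/
noncomputable def gadgetZ {d n m : ℕ} (lam α β : ℝ) (ηp ηm : Finset (Fin m))
    (ω : GadgetSample d n m) : ℝ :=
  hardcoreSum (gadgetGraph ω) lam fun σ =>
    (∀ u : Fin m, Sum.inl (Sum.inr u) ∈ σ ↔ u ∈ ηp) ∧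
    (∀ u : Fin m, Sum.inr (Sum.inr u) ∈ σ ↔ u ∈ ηm) ∧
    ((Finset.univ.filter fun w : Fin n => Sum.inl (Sum.inl w) ∈ σ).card : ℝ) = α * n ∧
    ((Finset.univ.filter fun w : Fin n => Sum.inr (Sum.inl w) ∈ σ).card : ℝ) = β * n

/-- The bipartite (multi)graph formed by `d` perfect matchings between two sides of `n` vertices
(parallel edges merged). -/
def matchingGraph {d n : ℕ} (π : Fin d → Equiv.Perm (Fin n)) : SimpleGraph (Fin n ⊕ Fin n) :=
  SimpleGraph.fromRel fun u v =>
    ∃ (i : Fin d) (x : Fin n), u = Sum.inl x ∧ v = Sum.inr (π i x)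

/-- `Z^{α,β}_{MWW}`: the sum of `lam ^ |σ|` over the independent sets `σ` with `α n` elements on the
plus side and `β n` elements on the minus side. -/
noncomputable def mwwZ {d n : ℕ} (lam α β : ℝ) (π : Fin d → Equiv.Perm (Fin n)) : ℝ :=
  hardcoreSum (matchingGraph π) lam fun σ =>
    ((Finset.univ.filter fun w : Fin n => Sum.inl w ∈ σ).card : ℝ) = α * n ∧
    ((Finset.univ.filter fun w : Fin n => Sum.inr w ∈ σ).card : ℝ) = β * n

/-- `E Z^{α,β}_{G̃}(η)`. -/
noncomputable def gadgetMoment1 (d n m : ℕ) (lam α β : ℝ) (ηp ηm : Finset (Fin m)) : ℝ :=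
  𝔼 ω : GadgetSample d n m, gadgetZ lam α β ηp ηm ω

/-- `E (Z^{α,β}_{G̃}(η))²`. -/
noncomputable def gadgetMoment2 (d n m : ℕ) (lam α β : ℝ) (ηp ηm : Finset (Fin m)) : ℝ :=
  𝔼 ω : GadgetSample d n m, gadgetZ lam α β ηp ηm ω ^ 2

/-- `E (Z^{α,β}_{MWW})²`, the `d` perfect matchings being independent and uniform. -/
noncomputable def mwwMoment2 (d n : ℕ) (lam α β : ℝ) : ℝ :=
  𝔼 π : Fin d → Equiv.Perm (Fin n), mwwZ lam α β π ^ 2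

/-! ## The constants -/

/-- `C* = ((1-α)(1-β)/(1-α-β))^((d-1) m')`. -/
noncomputable def cStar (d m : ℕ) (α β : ℝ) : ℝ :=
  ((1 - α) * (1 - β) / (1 - α - β)) ^ ((d - 1) * m)

/-- The predicted ratio of second moments,
`(C*)² (λ((1-α-β)/(1-β))^(d-1))^(2η⁻) (λ((1-α-β)/(1-α))^(d-1))^(2η⁺)`. -/
noncomputable def secondMomentRatio (d m : ℕ) (lam α β : ℝ) (ηp ηm : Finset (Fin m)) : ℝ :=
  cStar d m α β ^ 2
    * (lam * ((1 - α - β) / (1 - β)) ^ (d - 1)) ^ (2 * ηm.card)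
    * (lam * ((1 - α - β) / (1 - α)) ^ (d - 1)) ^ (2 * ηp.card)

/-- The limit constant `τ^{α,β}`. -/
noncomputable def tauConst (d : ℕ) (α β : ℝ) : ℝ :=
  (1 - α - β + α * β) ^ d /
    (((1 - α - β + 2 * α * β) * (1 - α - β)) ^ (((d : ℝ) - 1) / 2)
      * ((1 - α - β + d * α * β) * (1 - α - β - ((d : ℝ) - 2) * α * β)) ^ ((1 : ℝ) / 2))

/-! ## Expectations over independent permutations -/

/-! Squaring the partition function turns its second moment into a sum over pairs of configurations.
The matchings are independent, so a pair contributes a product of probabilities that one uniform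
permutation avoids two prescribed pairs of sets. By symmetry such a probability depends only on the
sizes of the sets and on their overlaps. Hence E Z² = (E Z)² · `overlapSum` exactly
(`gadgetMoment2_eq`, `mwwMoment2_eq`). Here `overlapSum` averages, over the overlaps g and h of
independent uniform sets on the two sides, a product of d factors `overlapRatio`: d-1 of them for
n+m' points and one for n points. Each factor is a sum over s, the number of points of the first
minus set hit by the second plus set.

A term with overlaps (γn, δn, sn) has exponential rate `totalEnt`, which is the function f minus
twice the rate of the first moment, with s = α-γ-ε (`rateF_eq`). The technical condition places its
unique maximum, with value 0, at (α², β², αβ). This gives only strict inequalities at each (α,β),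
whereas the asymptotics need a uniform quadratic bound
(`TechnicalCondition.exists_quadratic_bound`). Since the condition holds on an open set of
densities, the Hessian is semidefinite there. Its critical factor 1-α-β-(d-2)αβ decreases in α and
β, so it is strictly positive at smaller densities. Compactness handles the points away from the
maximum.

Crude Stirling bounds then show that overlaps far from their typical values are negligible
(`overlapSum_sub_centralSum`). The precise Stirling formula makes the typical terms Gaussian, and
summing out s, then h, then g gives `tauConst` (`centralSum_near`). The boundary has at most n^(1/4)
vertices; its effect on Stirling's formula is of first order and cancels in `overlapRatio`
(`term_stirling`). So `overlapSum` has the same limit with and without the boundary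
(`overlapSum_near`). This is the second claim. It also reduces the first claim to comparing first
moments, where the boundary contributes explicit factors to `avoidRate` (`avoidRate_near`,
`gadgetMoment1_near`). -/

theorem expect_pi_prod_mul {P Q : Type*} [Fintype P] [Fintype Q] (k : ℕ) (f : P → ℝ) (g : Q → ℝ) :
    (𝔼 ω : (Fin k → P) × Q, (∏ i, f (ω.1 i)) * g ω.2) = (𝔼 x, f x) ^ k * 𝔼 y, g y := by
  rw [Fintype.expect_eq_sum_div_card, Fintype.expect_eq_sum_div_card,
    Fintype.expect_eq_sum_div_card, Fintype.sum_prod_type, Fintype.card_prod, div_pow,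
    Fintype.sum_pow, Fintype.card_fun, Fintype.card_fin]
  simp_rw [← Finset.mul_sum, ← Finset.sum_mul]
  push_cast
  rw [mul_div_mul_comm]

theorem expect_pi_prod {P : Type*} [Fintype P] (k : ℕ) (f : P → ℝ) :
    (𝔼 ω : Fin k → P, ∏ i, f (ω i)) = (𝔼 x, f x) ^ k := by
  rw [Fintype.expect_eq_sum_div_card, Fintype.expect_eq_sum_div_card, div_pow,
    Fintype.sum_pow, Fintype.card_fun, Fintype.card_fin]
  push_cast
  rfl

open Classical in
/-- The indicator that the permutation `π` maps no element of `A` into `B`. -/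
noncomputable def avoidInd {V : Type*} (π : Equiv.Perm V) (A B : Finset V) : ℝ :=
  if ∀ x ∈ A, π x ∉ B then 1 else 0

/-- The probability that a uniform permutation maps `A₁` off `B₁` and `A₂` off `B₂`. -/
noncomputable def avoidProb {V : Type*} [Fintype V] [DecidableEq V] (A₁ A₂ B₁ B₂ : Finset V) : ℝ :=
  𝔼 π : Equiv.Perm V, avoidInd π A₁ B₁ * avoidInd π A₂ B₂

theorem avoidInd_mul_self {V : Type*} (π : Equiv.Perm V) (A B : Finset V) :
    avoidInd π A B * avoidInd π A B = avoidInd π A B := by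
  unfold avoidInd; split_ifs <;> simp

theorem avoidInd_of_forall {V : Type*} {π : Equiv.Perm V} {A B : Finset V}
    (h : ∀ x ∈ A, π x ∉ B) : avoidInd π A B = 1 := if_pos h

theorem avoidInd_of_not {V : Type*} {π : Equiv.Perm V} {A B : Finset V}
    (h : ¬ ∀ x ∈ A, π x ∉ B) : avoidInd π A B = 0 := if_neg h

open Classical in
theorem prod_avoidInd {V ι : Type*} [Fintype ι] (π : ι → Equiv.Perm V) (A B : Finset V) :
    ∏ i, avoidInd (π i) A B = if (∀ i, ∀ x ∈ A, π i x ∉ B) then 1 else 0 := by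
  split_ifs with h
  · exact Finset.prod_eq_one fun i _ => avoidInd_of_forall (h i)
  · rw [not_forall] at h
    obtain ⟨i, hi⟩ := h
    exact Finset.prod_eq_zero (Finset.mem_univ i) (avoidInd_of_not hi)

/-! ## The partition functions as sums over pairs of sets -/

/-- Once the trace on U is fixed, an independent set is a pair of subsets of the two copies of W.
Independence splits into one condition per matching, and merging parallel edges does not affect it.
-/
theorem gadgetZ_eq_sum {d n m a b : ℕ} (lam α β : ℝ) (ha : α * n = a) (hb : β * n = b)
    (ηp ηm : Finset (Fin m)) (ω : GadgetSample d n m) :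
    gadgetZ lam α β ηp ηm ω =
      ∑ X ∈ Finset.powersetCard a (Finset.univ : Finset (Fin n)) ×ˢ
          Finset.powersetCard b (Finset.univ : Finset (Fin n)),
        lam ^ (a + ηp.card + (b + ηm.card)) *
          ((∏ i, avoidInd (ω.1 i) (X.1.disjSum ηp) (X.2.disjSum ηm)) * avoidInd ω.2 X.1 X.2) := by
  classical
  have key : ∀ X : Finset (Fin n) × Finset (Fin n),
      (∏ i, avoidInd (ω.1 i) (X.1.disjSum ηp) (X.2.disjSum ηm)) * avoidInd ω.2 X.1 X.2 =
        if (∀ i, ∀ x ∈ X.1.disjSum ηp, ω.1 i x ∉ X.2.disjSum ηm) ∧ ∀ x ∈ X.1, ω.2 x ∉ X.2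
        then 1 else 0 := by
    intro X
    rw [prod_avoidInd, avoidInd]
    split_ifs <;> simp_all
  simp_rw [key, mul_ite, mul_one, mul_zero]
  rw [← Finset.sum_filter]
  unfold gadgetZ hardcoreSum
  refine Finset.sum_bij' (fun σ _ => (σ.toLeft.toLeft, σ.toRight.toLeft))
    (fun X _ => (X.1.disjSum ηp).disjSum (X.2.disjSum ηm)) ?_ ?_ ?_ ?_ ?_
  · intro σ hσ
    simp only [Finset.mem_filter, Finset.mem_univ, true_and] at hσ
    obtain ⟨hI, hp, hm, h1, h2⟩ := hσ
    have e1 : σ.toLeft.toLeft = Finset.univ.filter fun w : Fin n => Sum.inl (Sum.inl w) ∈ σ := by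
      ext w; simp
    have e2 : σ.toRight.toLeft = Finset.univ.filter fun w : Fin n => Sum.inr (Sum.inl w) ∈ σ := by
      ext w; simp
    have hL : ∀ x, x ∈ σ.toLeft.toLeft.disjSum ηp ↔ Sum.inl x ∈ σ := by
      rintro (x | x) <;> simp [hp]
    have hR : ∀ x, x ∈ σ.toRight.toLeft.disjSum ηm ↔ Sum.inr x ∈ σ := by
      rintro (x | x) <;> simp [hm]
    simp only [Finset.mem_filter, Finset.mem_product, Finset.mem_powersetCard, Finset.subset_univ,
      true_and]
    refine ⟨⟨?_, ?_⟩, ?_, ?_⟩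
    · rw [e1]; exact_mod_cast h1.trans ha
    · rw [e2]; exact_mod_cast h2.trans hb
    · intro i x hx hy
      rw [hL] at hx
      rw [hR] at hy
      refine hI hx hy (by simp) ?_
      rw [gadgetGraph, SimpleGraph.fromRel_adj]
      exact ⟨by simp, Or.inl (Or.inl ⟨i, x, rfl, rfl⟩)⟩
    · intro w hx hy
      simp only [Finset.mem_toLeft, Finset.mem_toRight] at hx hy
      refine hI hx hy (by simp) ?_
      rw [gadgetGraph, SimpleGraph.fromRel_adj]
      exact ⟨by simp, Or.inl (Or.inr ⟨w, rfl, rfl⟩)⟩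
  · rintro ⟨A, B⟩ hX
    simp only [Finset.mem_filter, Finset.mem_product, Finset.mem_powersetCard, Finset.subset_univ,
      true_and] at hX
    obtain ⟨⟨hA, hB⟩, h1, h2⟩ := hX
    simp only [Finset.mem_filter, Finset.mem_univ, true_and]
    refine ⟨?_, by simp, by simp, ?_, ?_⟩
    · have hadj : ∀ u v, u ∈ (A.disjSum ηp).disjSum (B.disjSum ηm) →
          v ∈ (A.disjSum ηp).disjSum (B.disjSum ηm) →
          ¬ ((∃ (i : Fin (d - 1)) (x : Side n m), u = Sum.inl x ∧ v = Sum.inr (ω.1 i x)) ∨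
          (∃ w : Fin n, u = Sum.inl (Sum.inl w) ∧ v = Sum.inr (Sum.inl (ω.2 w)))) := by
        rintro u v hu hv (⟨i, x, rfl, rfl⟩ | ⟨w, rfl, rfl⟩)
        · simp only [Finset.inl_mem_disjSum, Finset.inr_mem_disjSum] at hu hv
          exact h1 i x hu hv
        · simp only [Finset.inl_mem_disjSum, Finset.inr_mem_disjSum] at hu hv
          exact h2 w hu hv
      intro u hu v hv _
      rw [gadgetGraph, SimpleGraph.fromRel_adj]
      rintro ⟨_, h | h⟩
      · exact hadj u v hu hv h
      · exact hadj v u hv hu h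
    · rw [ha, ← hA]; simp
    · rw [hb, ← hB]; simp
  · intro σ hσ
    simp only [Finset.mem_filter, Finset.mem_univ, true_and] at hσ
    obtain ⟨hI, hp, hm, h1, h2⟩ := hσ
    ext (( x | x) | (x | x)) <;> simp [hp, hm]
  · rintro ⟨A, B⟩ hX
    simp
  · intro σ hσ
    simp only [Finset.mem_filter, Finset.mem_univ, true_and] at hσ
    obtain ⟨hI, hp, hm, h1, h2⟩ := hσ
    have e1 : σ.toLeft.toLeft = Finset.univ.filter fun w : Fin n => Sum.inl (Sum.inl w) ∈ σ := by
      ext w; simp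
    have e2 : σ.toRight.toLeft = Finset.univ.filter fun w : Fin n => Sum.inr (Sum.inl w) ∈ σ := by
      ext w; simp
    have e3 : σ = (σ.toLeft.toLeft.disjSum ηp).disjSum (σ.toRight.toLeft.disjSum ηm) := by
      ext (( x | x) | (x | x)) <;> simp [hp, hm]
    have c1 : σ.toLeft.toLeft.card = a := by rw [e1]; exact_mod_cast h1.trans ha
    have c2 : σ.toRight.toLeft.card = b := by rw [e2]; exact_mod_cast h2.trans hb
    congr 1
    rw [← c1, ← c2, ← Finset.card_disjSum, ← Finset.card_disjSum, ← Finset.card_disjSum, ← e3]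

theorem mwwZ_eq_sum {d n a b : ℕ} (lam α β : ℝ) (ha : α * n = a) (hb : β * n = b)
    (π : Fin d → Equiv.Perm (Fin n)) :
    mwwZ lam α β π =
      ∑ X ∈ Finset.powersetCard a (Finset.univ : Finset (Fin n)) ×ˢ
          Finset.powersetCard b (Finset.univ : Finset (Fin n)),
        lam ^ (a + b) * ∏ i, avoidInd (π i) X.1 X.2 := by
  classical
  simp_rw [prod_avoidInd, mul_ite, mul_one, mul_zero]
  rw [← Finset.sum_filter]
  unfold mwwZ hardcoreSum
  refine Finset.sum_bij' (fun σ _ => (σ.toLeft, σ.toRight))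
    (fun X _ => X.1.disjSum X.2) ?_ ?_ ?_ ?_ ?_
  · intro σ hσ
    simp only [Finset.mem_filter, Finset.mem_univ, true_and] at hσ
    obtain ⟨hI, h1, h2⟩ := hσ
    have e1 : σ.toLeft = Finset.univ.filter fun w : Fin n => Sum.inl w ∈ σ := by
      ext w; simp
    have e2 : σ.toRight = Finset.univ.filter fun w : Fin n => Sum.inr w ∈ σ := by
      ext w; simp
    simp only [Finset.mem_filter, Finset.mem_product, Finset.mem_powersetCard, Finset.subset_univ,
      true_and]
    refine ⟨⟨?_, ?_⟩, ?_⟩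
    · rw [e1]; exact_mod_cast h1.trans ha
    · rw [e2]; exact_mod_cast h2.trans hb
    · intro i x hx hy
      simp only [Finset.mem_toLeft, Finset.mem_toRight] at hx hy
      refine hI hx hy (by simp) ?_
      rw [matchingGraph, SimpleGraph.fromRel_adj]
      exact ⟨by simp, Or.inl ⟨i, x, rfl, rfl⟩⟩
  · rintro ⟨A, B⟩ hX
    simp only [Finset.mem_filter, Finset.mem_product, Finset.mem_powersetCard, Finset.subset_univ,
      true_and] at hX
    obtain ⟨⟨hA, hB⟩, h1⟩ := hX
    simp only [Finset.mem_filter, Finset.mem_univ, true_and]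
    refine ⟨?_, ?_, ?_⟩
    · have hadj : ∀ u v, u ∈ A.disjSum B → v ∈ A.disjSum B →
          ¬ (∃ (i : Fin d) (x : Fin n), u = Sum.inl x ∧ v = Sum.inr (π i x)) := by
        rintro u v hu hv ⟨i, x, rfl, rfl⟩
        simp only [Finset.inl_mem_disjSum, Finset.inr_mem_disjSum] at hu hv
        exact h1 i x hu hv
      intro u hu v hv _
      rw [matchingGraph, SimpleGraph.fromRel_adj]
      rintro ⟨_, h | h⟩
      · exact hadj u v hu hv h
      · exact hadj v u hv hu h
    · rw [ha, ← hA]; simp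
    · rw [hb, ← hB]; simp
  · intro σ hσ
    ext (x | x) <;> simp
  · rintro ⟨A, B⟩ hX
    simp
  · intro σ hσ
    simp only [Finset.mem_filter, Finset.mem_univ, true_and] at hσ
    obtain ⟨hI, h1, h2⟩ := hσ
    have e1 : σ.toLeft = Finset.univ.filter fun w : Fin n => Sum.inl w ∈ σ := by
      ext w; simp
    have e2 : σ.toRight = Finset.univ.filter fun w : Fin n => Sum.inr w ∈ σ := by
      ext w; simp
    have c1 : σ.toLeft.card = a := by rw [e1]; exact_mod_cast h1.trans ha
    have c2 : σ.toRight.card = b := by rw [e2]; exact_mod_cast h2.trans hb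
    congr 1
    rw [← c1, ← c2, Finset.card_toLeft_add_card_toRight]

/-- Indicators are idempotent, so `avoidProb` with repeated arguments is the avoidance probability
of a single configuration. The first moment is thereby expressed by the same function as the second.
-/
theorem gadgetMoment1_eq_sum {d n m a b : ℕ} (lam α β : ℝ) (ha : α * n = a) (hb : β * n = b)
    (ηp ηm : Finset (Fin m)) :
    gadgetMoment1 d n m lam α β ηp ηm =
      lam ^ (a + ηp.card + (b + ηm.card)) *
      ∑ X ∈ Finset.powersetCard a (Finset.univ : Finset (Fin n)) ×ˢ
          Finset.powersetCard b (Finset.univ : Finset (Fin n)),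
        avoidProb (X.1.disjSum ηp) (X.1.disjSum ηp) (X.2.disjSum ηm) (X.2.disjSum ηm) ^ (d - 1) *
          avoidProb X.1 X.1 X.2 X.2 := by
  unfold gadgetMoment1
  simp_rw [gadgetZ_eq_sum lam α β ha hb]
  rw [Finset.expect_sum_comm, Finset.mul_sum]
  refine Finset.sum_congr rfl fun X _ => ?_
  rw [← Finset.mul_expect]
  congr 1
  unfold avoidProb
  simp_rw [avoidInd_mul_self]
  exact expect_pi_prod_mul (d - 1)
    (fun π : Equiv.Perm (Side n m) => avoidInd π (X.1.disjSum ηp) (X.2.disjSum ηm))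
    (fun π : Equiv.Perm (Fin n) => avoidInd π X.1 X.2)

theorem gadgetMoment2_eq_sum {d n m a b : ℕ} (lam α β : ℝ) (ha : α * n = a) (hb : β * n = b)
    (ηp ηm : Finset (Fin m)) :
    gadgetMoment2 d n m lam α β ηp ηm =
      (lam ^ (a + ηp.card + (b + ηm.card))) ^ 2 *
      ∑ X ∈ Finset.powersetCard a (Finset.univ : Finset (Fin n)) ×ˢ
          Finset.powersetCard b (Finset.univ : Finset (Fin n)),
      ∑ Y ∈ Finset.powersetCard a (Finset.univ : Finset (Fin n)) ×ˢ
          Finset.powersetCard b (Finset.univ : Finset (Fin n)),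
        avoidProb (X.1.disjSum ηp) (Y.1.disjSum ηp) (X.2.disjSum ηm) (Y.2.disjSum ηm) ^ (d - 1) *
          avoidProb X.1 Y.1 X.2 Y.2 := by
  unfold gadgetMoment2
  simp_rw [gadgetZ_eq_sum lam α β ha hb, ← Finset.mul_sum, mul_pow]
  rw [← Finset.mul_expect]
  congr 1
  simp_rw [sq, Finset.sum_mul_sum]
  rw [Finset.expect_sum_comm]
  refine Finset.sum_congr rfl fun X _ => ?_
  rw [Finset.expect_sum_comm]
  refine Finset.sum_congr rfl fun Y _ => ?_
  unfold avoidProb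
  rw [← expect_pi_prod_mul (d - 1)]
  refine Finset.expect_congr rfl fun ω _ => ?_
  rw [Finset.prod_mul_distrib]
  ring

theorem mwwMoment2_eq_sum {d n a b : ℕ} (lam α β : ℝ) (ha : α * n = a) (hb : β * n = b) :
    mwwMoment2 d n lam α β =
      (lam ^ (a + b)) ^ 2 *
      ∑ X ∈ Finset.powersetCard a (Finset.univ : Finset (Fin n)) ×ˢ
          Finset.powersetCard b (Finset.univ : Finset (Fin n)),
      ∑ Y ∈ Finset.powersetCard a (Finset.univ : Finset (Fin n)) ×ˢ
          Finset.powersetCard b (Finset.univ : Finset (Fin n)),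
        avoidProb X.1 Y.1 X.2 Y.2 ^ d := by
  unfold mwwMoment2
  simp_rw [mwwZ_eq_sum lam α β ha hb, ← Finset.mul_sum, mul_pow]
  rw [← Finset.mul_expect]
  congr 1
  simp_rw [sq, Finset.sum_mul_sum]
  rw [Finset.expect_sum_comm]
  refine Finset.sum_congr rfl fun X _ => ?_
  rw [Finset.expect_sum_comm]
  refine Finset.sum_congr rfl fun Y _ => ?_
  unfold avoidProb
  rw [← expect_pi_prod d]
  refine Finset.expect_congr rfl fun ω _ => ?_
  rw [Finset.prod_mul_distrib]

/-! ## Counting sets with prescribed intersections -/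

section Counting

variable {V : Type*} [Fintype V] [DecidableEq V]

/-- Used twice in `sum_avoid_pairs`: with the parts A and B to count the second plus set, and with B
\ C and C to count the second minus set. -/
theorem card_filter_three_parts (A B : Finset V) (hAB : Disjoint A B) (i j k : ℕ) :
    (Finset.univ.filter fun S : Finset V =>
      (S ∩ A).card = i ∧ (S ∩ B).card = j ∧ (S \ (A ∪ B)).card = k).card =
      A.card.choose i * B.card.choose j * (Fintype.card V - A.card - B.card).choose k := by
  have hc : (A ∪ B)ᶜ.card = Fintype.card V - A.card - B.card := by
    rw [Finset.card_compl, Finset.card_union_of_disjoint hAB, Nat.sub_sub]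
  rw [← hc, ← Finset.card_powersetCard, ← Finset.card_powersetCard, ← Finset.card_powersetCard,
    ← Finset.card_product, ← Finset.card_product]
  have hd : ∀ x, x ∈ A → x ∉ B := fun x hx hy => (Finset.disjoint_left.mp hAB) hx hy
  refine Finset.card_nbij' (fun S => ((S ∩ A, S ∩ B), S \ (A ∪ B)))
    (fun X => X.1.1 ∪ X.1.2 ∪ X.2) ?_ ?_ ?_ ?_
  · intro S hS
    simp only [Finset.coe_filter, Finset.mem_univ, true_and, Set.mem_ofPred_eq] at hS
    simp only [Finset.coe_product, Set.mem_prod, Finset.mem_coe, Finset.mem_powersetCard]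
    refine ⟨⟨⟨Finset.inter_subset_right, hS.1⟩, Finset.inter_subset_right, hS.2.1⟩, ?_, hS.2.2⟩
    intro x hx
    simp only [Finset.mem_sdiff] at hx
    simpa using hx.2
  · rintro ⟨⟨X, Y⟩, Z⟩ hX
    simp only [Finset.coe_product, Set.mem_prod, Finset.mem_coe, Finset.mem_powersetCard] at hX
    obtain ⟨⟨⟨h1, h2⟩, h3, h4⟩, h5, h6⟩ := hX
    have h5' : ∀ x ∈ Z, x ∉ A ∧ x ∉ B := by
      intro x hx
      have := h5 hx
      simpa using this
    simp only [Finset.coe_filter, Finset.mem_univ, true_and, Set.mem_ofPred_eq]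
    rw [← h2, ← h4, ← h6]
    refine ⟨congrArg _ ?_, congrArg _ ?_, congrArg _ ?_⟩ <;> ext x <;>
      have a1 := @h1 x <;> have a2 := @h3 x <;> have a3 := h5' x <;> have a4 := hd x <;>
      simp only [Finset.mem_inter, Finset.mem_union, Finset.mem_sdiff] <;> tauto
  · intro S hS
    ext x
    simp only [Finset.mem_inter, Finset.mem_union, Finset.mem_sdiff]
    tauto
  · rintro ⟨⟨X, Y⟩, Z⟩ hX
    simp only [Finset.coe_product, Set.mem_prod, Finset.mem_coe, Finset.mem_powersetCard] at hX
    obtain ⟨⟨⟨h1, h2⟩, h3, h4⟩, h5, h6⟩ := hX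
    have h5' : ∀ x ∈ Z, x ∉ A ∧ x ∉ B := by
      intro x hx
      have := h5 hx
      simpa using this
    simp only [Prod.mk.injEq]
    refine ⟨⟨?_, ?_⟩, ?_⟩ <;> ext x <;>
      have a1 := @h1 x <;> have a2 := @h3 x <;> have a3 := h5' x <;> have a4 := hd x <;>
      simp only [Finset.mem_inter, Finset.mem_union, Finset.mem_sdiff] <;> tauto

theorem card_filter_inter (A : Finset V) (a g : ℕ) (hg : g ≤ a) :
    (Finset.univ.filter fun S : Finset V => S.card = a ∧ (A ∩ S).card = g).card =
      A.card.choose g * (Fintype.card V - A.card).choose (a - g) := by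
  have h := card_filter_three_parts A (∅ : Finset V) (by simp) g 0 (a - g)
  simp only [Finset.card_empty, Nat.choose_zero_right, mul_one, Nat.sub_zero, Finset.inter_empty,
    Finset.union_empty, true_and] at h
  rw [← h]
  congr 1
  ext S
  simp only [Finset.mem_filter, Finset.mem_univ, true_and]
  have := Finset.card_sdiff_add_card_inter S A
  rw [Finset.inter_comm A S]
  omega

/-! ## Symmetry of the avoidance probability -/

/-- The three cardinalities determine the sizes of all four cells of the Venn diagram. The cells can
therefore be matched bijectively, and the bijections are glued along the membership pattern. -/
theorem exists_perm_of_card_eq (A₁ A₂ A₁' A₂' : Finset V) (h1 : A₁.card = A₁'.card)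
    (h2 : A₂.card = A₂'.card) (h3 : (A₁ ∩ A₂).card = (A₁' ∩ A₂').card) :
    ∃ τ : Equiv.Perm V, (∀ x, τ x ∈ A₁' ↔ x ∈ A₁) ∧ ∀ x, τ x ∈ A₂' ↔ x ∈ A₂ := by
  have hcard : ∀ c : Bool × Bool,
      Fintype.card {x : V // (decide (x ∈ A₁), decide (x ∈ A₂)) = c} =
        Fintype.card {x : V // (decide (x ∈ A₁'), decide (x ∈ A₂')) = c} := by
    have key : ∀ P Q P' Q' : Finset V, P.card = P'.card → Q.card = Q'.card →
        (P ∩ Q).card = (P' ∩ Q').card → (P \ Q).card = (P' \ Q').card ∧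
          (Q \ P).card = (Q' \ P').card ∧ (P ∪ Q)ᶜ.card = (P' ∪ Q')ᶜ.card := by
      intro P Q P' Q' e1 e2 e3
      have f1 := Finset.card_sdiff_add_card_inter P Q
      have f2 := Finset.card_sdiff_add_card_inter P' Q'
      have f3 := Finset.card_sdiff_add_card_inter Q P
      have f4 := Finset.card_sdiff_add_card_inter Q' P'
      rw [Finset.inter_comm] at f3 f4
      have f5 := Finset.card_union_add_card_inter P Q
      have f6 := Finset.card_union_add_card_inter P' Q'
      refine ⟨by omega, by omega, ?_⟩
      rw [Finset.card_compl, Finset.card_compl]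
      omega
    obtain ⟨k1, k2, k3⟩ := key A₁ A₂ A₁' A₂' h1 h2 h3
    rintro ⟨c1, c2⟩
    rw [Fintype.card_subtype, Fintype.card_subtype]
    rcases c1 with _ | _ <;> rcases c2 with _ | _
    · convert k3 using 2 <;> ext x <;> simp
    · convert k2 using 2 <;> ext x <;> simp [and_comm]
    · convert k1 using 2 <;> ext x <;> simp
    · convert h3 using 2 <;> ext x <;> simp
  let e := fun c => (Fintype.card_eq.mp (hcard c)).some
  let τ : Equiv.Perm V := Equiv.ofFiberEquiv (fun c => e c)
  have hτ : ∀ x, (decide (τ x ∈ A₁'), decide (τ x ∈ A₂')) = (decide (x ∈ A₁), decide (x ∈ A₂)) :=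
    fun x => Equiv.ofFiberEquiv_map (fun c => e c) x
  refine ⟨τ, fun x => ?_, fun x => ?_⟩
  · have := congrArg Prod.fst (hτ x)
    simpa using this
  · have := congrArg Prod.snd (hτ x)
    simpa using this

/-- The uniform law on permutations is invariant under π ↦ ρ π τ⁻¹, where τ and ρ carry one
configuration of sets to the other. -/
theorem avoidProb_congr (A₁ A₂ B₁ B₂ A₁' A₂' B₁' B₂' : Finset V) (h1 : A₁.card = A₁'.card)
    (h2 : A₂.card = A₂'.card) (h3 : (A₁ ∩ A₂).card = (A₁' ∩ A₂').card)
    (k1 : B₁.card = B₁'.card) (k2 : B₂.card = B₂'.card)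
    (k3 : (B₁ ∩ B₂).card = (B₁' ∩ B₂').card) :
    avoidProb A₁ A₂ B₁ B₂ = avoidProb A₁' A₂' B₁' B₂' := by
  obtain ⟨τ, ht1, ht2⟩ := exists_perm_of_card_eq A₁ A₂ A₁' A₂' h1 h2 h3
  obtain ⟨ρ, hr1, hr2⟩ := exists_perm_of_card_eq B₁ B₂ B₁' B₂' k1 k2 k3
  unfold avoidProb
  refine Fintype.expect_equiv ((Equiv.mulLeft ρ).trans (Equiv.mulRight τ⁻¹)) _ _ fun π => ?_
  have key : ∀ A B A' B' : Finset V, (∀ x, τ x ∈ A' ↔ x ∈ A) → (∀ x, ρ x ∈ B' ↔ x ∈ B) →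
      avoidInd π A B = avoidInd (ρ * π * τ⁻¹) A' B' := by
    intro A B A' B' hA hB
    have : (∀ x ∈ A, π x ∉ B) ↔ ∀ x ∈ A', (ρ * π * τ⁻¹) x ∉ B' := by
      constructor
      · intro h x hx
        have hx' : τ⁻¹ x ∈ A := by rw [← hA]; simpa using hx
        have := h _ hx'
        rw [← hB] at this
        simpa using this
      · intro h x hx
        have := h (τ x) ((hA x).mpr hx)
        rw [← hB]
        simpa using this
    by_cases h : ∀ x ∈ A, π x ∉ B
    · rw [avoidInd_of_forall h, avoidInd_of_forall (this.mp h)]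
    · rw [avoidInd_of_not h, avoidInd_of_not (this.not.mp h)]
  simp only [Equiv.trans_apply, Equiv.coe_mulLeft, Equiv.coe_mulRight]
  rw [← key A₁ B₁ A₁' B₁' ht1 hr1, ← key A₂ B₂ A₂' B₂' ht2 hr2]

/-- The probability that a uniform permutation of `N` points maps a given `a`-set off a given
`b`-set. -/
noncomputable def avoidRate (N a b : ℕ) : ℝ := ((N - b).choose a : ℝ) / (N.choose a : ℝ)

theorem sum_avoidInd {ι : Type*} (π : Equiv.Perm V) (s : Finset ι) (f g : ι → Finset V) :
    ∑ i ∈ s, avoidInd π (f i) (g i) = ((s.filter fun i => ∀ x ∈ f i, π x ∉ g i).card : ℝ) := by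
  rw [Finset.natCast_card_filter]
  refine Finset.sum_congr rfl fun i _ => ?_
  split_ifs with h
  · exact avoidInd_of_forall h
  · exact avoidInd_of_not h

/-- By symmetry one may average over all sets of the same size as A. For a fixed π, those mapped off
B are the subsets of the complement of π⁻¹(B), and their number does not depend on π. -/
theorem avoidProb_self (A B : Finset V) :
    avoidProb A A B B = avoidRate (Fintype.card V) A.card B.card := by
  have hpos : (0 : ℝ) < ((Fintype.card V).choose A.card : ℝ) := by
    exact_mod_cast Nat.choose_pos (Finset.card_le_univ A)
  rw [avoidRate, eq_div_iff hpos.ne']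
  have h1 : avoidProb A A B B * ((Fintype.card V).choose A.card : ℝ) =
      ∑ A' ∈ Finset.powersetCard A.card (Finset.univ : Finset V), avoidProb A' A' B B := by
    rw [Finset.sum_congr rfl (g := fun _ => avoidProb A A B B)]
    · rw [Finset.sum_const, Finset.card_powersetCard, Finset.card_univ, nsmul_eq_mul, mul_comm]
    · intro A' hA'
      rw [Finset.mem_powersetCard] at hA'
      apply avoidProb_congr <;> simp [hA'.2]
  rw [h1]
  unfold avoidProb
  rw [← Finset.expect_sum_comm]
  have h2 : ∀ π : Equiv.Perm V, ∑ A' ∈ Finset.powersetCard A.card (Finset.univ : Finset V),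
      avoidInd π A' B * avoidInd π A' B = ((Fintype.card V - B.card).choose A.card : ℝ) := by
    intro π
    simp_rw [avoidInd_mul_self]
    rw [sum_avoidInd π _ (fun S => S) fun _ => B]
    have : (Finset.powersetCard A.card (Finset.univ : Finset V)).filter
        (fun A' => ∀ x ∈ A', π x ∉ B) =
        Finset.powersetCard A.card (B.map π.symm.toEmbedding)ᶜ := by
      ext S
      simp only [Finset.mem_filter, Finset.mem_powersetCard, Finset.mem_univ, implies_true, true_and,
        Finset.subset_iff, Finset.mem_compl, Finset.mem_map_equiv, Equiv.symm_symm]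
      tauto
    rw [this, Finset.card_powersetCard, Finset.card_compl,
      Finset.card_map]
  rw [Finset.expect_congr rfl (fun π _ => h2 π)]
  simp

/-- The number of pairs of disjoint sets of sizes `a`, `b` that meet two given disjoint sets of
sizes `a`, `b` in `g` and `h` points respectively. -/
def overlapCount (N a b g h : ℕ) : ℕ :=
  ∑ s ∈ Finset.range (a - g + 1),
    (a.choose g * b.choose s * (N - a - b).choose (a - g - s)) *
      ((b - s).choose h * (N - a - b + s).choose (b - h))

/-- Classify C by s = |C ∩ B|. Then C is a choice of g, s and a-g-s points inside A, inside B and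
outside both. A set T disjoint from C takes h points of B \ C, which has b-s points, and b-h points
outside B ∪ C, where N-a-b+s points are left. -/
theorem sum_avoid_pairs (A B : Finset V) (hAB : Disjoint A B) (g h : ℕ) (hg : g ≤ A.card)
    (hh : h ≤ B.card) :
    ∑ C ∈ Finset.univ.filter (fun S : Finset V => S.card = A.card ∧ (A ∩ S).card = g),
      (Finset.univ.filter fun T : Finset V =>
        (T.card = B.card ∧ (B ∩ T).card = h) ∧ Disjoint C T).card =
      overlapCount (Fintype.card V) A.card B.card g h := by
  have hN : A.card + B.card ≤ Fintype.card V := by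
    rw [← Finset.card_union_of_disjoint hAB]; exact Finset.card_le_univ _
  have hF : ∀ C : Finset V, C.card = A.card →
      (Finset.univ.filter fun T : Finset V =>
        (T.card = B.card ∧ (B ∩ T).card = h) ∧ Disjoint C T).card =
      (B.card - (C ∩ B).card).choose h *
        (Fintype.card V - A.card - B.card + (C ∩ B).card).choose (B.card - h) := by
    intro C hC
    have hs : (C ∩ B).card ≤ B.card := Finset.card_le_card Finset.inter_subset_right
    have hBC : (B \ C).card = B.card - (C ∩ B).card := by
      rw [Finset.card_sdiff]
    have h3 := card_filter_three_parts (B \ C) C Finset.sdiff_disjoint h 0 (B.card - h)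
    rw [hBC, hC, Nat.choose_zero_right, mul_one,
      show Fintype.card V - (B.card - (C ∩ B).card) - A.card =
        Fintype.card V - A.card - B.card + (C ∩ B).card by omega] at h3
    rw [← h3]
    congr 1
    ext T
    simp only [Finset.mem_filter, Finset.mem_univ, true_and, Finset.card_eq_zero]
    have key : Disjoint C T → T ∩ (B \ C) = B ∩ T ∧ T \ (B \ C ∪ C) = T \ B := by
      intro hd
      have hd' : ∀ x, x ∈ C → x ∉ T := fun x hx hy => (Finset.disjoint_left.mp hd) hx hy
      constructor <;> ext x <;> have := hd' x <;>
        simp only [Finset.mem_inter, Finset.mem_union, Finset.mem_sdiff] <;> tauto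
    have e := Finset.card_sdiff_add_card_inter T B
    constructor
    · rintro ⟨⟨q1, q2⟩, q3⟩
      obtain ⟨k1, k2⟩ := key q3
      rw [k1, k2]
      rw [Finset.inter_comm] at e
      refine ⟨q2, ?_, by omega⟩
      rw [Finset.inter_comm]; exact Finset.disjoint_iff_inter_eq_empty.mp q3
    · rintro ⟨q1, q2, q3⟩
      have q4 : Disjoint C T := by
        rw [Finset.disjoint_iff_inter_eq_empty, Finset.inter_comm]; exact q2
      obtain ⟨k1, k2⟩ := key q4
      rw [k1] at q1
      rw [k2] at q3
      rw [Finset.inter_comm] at e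
      exact ⟨⟨by omega, q1⟩, q4⟩
  rw [Finset.sum_congr rfl fun C hC => hF C (Finset.mem_filter.mp hC).2.1]
  have hmaps : ∀ C ∈ Finset.univ.filter
      (fun S : Finset V => S.card = A.card ∧ (A ∩ S).card = g),
      (C ∩ B).card ∈ Finset.range (A.card - g + 1) := by
    intro C hC
    obtain ⟨-, h1, h2⟩ := Finset.mem_filter.mp hC
    have e := Finset.card_sdiff_add_card_inter C A
    have : (C ∩ B).card ≤ (C \ A).card := by
      apply Finset.card_le_card
      intro x hx
      rw [Finset.mem_inter] at hx
      rw [Finset.mem_sdiff]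
      exact ⟨hx.1, fun hy => (Finset.disjoint_left.mp hAB) hy hx.2⟩
    rw [Finset.inter_comm] at e
    rw [Finset.mem_range]
    omega
  rw [← Finset.sum_fiberwise_of_maps_to hmaps, overlapCount]
  refine Finset.sum_congr rfl fun s hs => ?_
  rw [Finset.sum_congr rfl (g := fun _ => (B.card - s).choose h *
    (Fintype.card V - A.card - B.card + s).choose (B.card - h))]
  · rw [Finset.sum_const, smul_eq_mul]
    congr 1
    rw [← card_filter_three_parts A B hAB g s (A.card - g - s), Finset.filter_filter]
    congr 1
    ext S
    simp only [Finset.mem_filter, Finset.mem_univ, true_and]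
    have e := Finset.card_sdiff_add_card_inter S (A ∪ B)
    have e2 : (S ∩ (A ∪ B)).card = (S ∩ A).card + (S ∩ B).card := by
      rw [Finset.inter_union_distrib_left, Finset.card_union_of_disjoint]
      exact Finset.disjoint_of_subset_left Finset.inter_subset_right
        (Finset.disjoint_of_subset_right Finset.inter_subset_right hAB)
    rw [Finset.inter_comm A S]
    rw [Finset.mem_range] at hs
    omega
  · intro C hC
    rw [(Finset.mem_filter.mp hC).2]

/-- Average over all second pairs with the given overlaps. On the event that π avoids the first
pair, the image of A₁ is disjoint from B₁, and the number of second pairs also avoided is given by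
`sum_avoid_pairs`, whatever π is. Off that event both sides vanish. -/
theorem avoidProb_mul_counts (A₁ A₂ B₁ B₂ : Finset V) (hA : A₂.card = A₁.card)
    (hB : B₂.card = B₁.card) :
    avoidProb A₁ A₂ B₁ B₂ *
      ((A₁.card.choose (A₁ ∩ A₂).card *
          (Fintype.card V - A₁.card).choose (A₁.card - (A₁ ∩ A₂).card) : ℕ) *
        (B₁.card.choose (B₁ ∩ B₂).card *
          (Fintype.card V - B₁.card).choose (B₁.card - (B₁ ∩ B₂).card) : ℕ)) =
      avoidRate (Fintype.card V) A₁.card B₁.card *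
        overlapCount (Fintype.card V) A₁.card B₁.card (A₁ ∩ A₂).card (B₁ ∩ B₂).card := by
  have hg : (A₁ ∩ A₂).card ≤ A₁.card := Finset.card_le_card Finset.inter_subset_left
  have hh : (B₁ ∩ B₂).card ≤ B₁.card := Finset.card_le_card Finset.inter_subset_left
  rw [← card_filter_inter A₁ A₁.card _ hg, ← card_filter_inter B₁ B₁.card _ hh]
  set SA := Finset.univ.filter
    (fun S : Finset V => S.card = A₁.card ∧ (A₁ ∩ S).card = (A₁ ∩ A₂).card)
  set SB := Finset.univ.filter
    (fun S : Finset V => S.card = B₁.card ∧ (B₁ ∩ S).card = (B₁ ∩ B₂).card) with hSB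
  have h1 : avoidProb A₁ A₂ B₁ B₂ * ((SA.card : ℝ) * (SB.card : ℝ)) =
      ∑ S ∈ SA, ∑ T ∈ SB, avoidProb A₁ S B₁ T := by
    rw [Finset.sum_congr rfl (g := fun _ => (SB.card : ℝ) * avoidProb A₁ A₂ B₁ B₂)]
    · rw [Finset.sum_const, nsmul_eq_mul]; ring
    · intro S hS
      obtain ⟨-, s1, s2⟩ := Finset.mem_filter.mp hS
      rw [Finset.sum_congr rfl (g := fun _ => avoidProb A₁ A₂ B₁ B₂)]
      · rw [Finset.sum_const, nsmul_eq_mul]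
      · intro T hT
        obtain ⟨-, t1, t2⟩ := Finset.mem_filter.mp hT
        exact avoidProb_congr _ _ _ _ _ _ _ _ rfl (s1.trans hA.symm) s2 rfl (t1.trans hB.symm) t2
  rw [h1, ← avoidProb_self]
  unfold avoidProb
  simp_rw [← Finset.expect_sum_comm]
  rw [Finset.expect_mul]
  refine Finset.expect_congr rfl fun π _ => ?_
  rw [avoidInd_mul_self]
  simp_rw [← Finset.mul_sum]
  by_cases hπ : ∀ x ∈ A₁, π x ∉ B₁
  swap
  · rw [avoidInd_of_not hπ, zero_mul, zero_mul]
  congr 1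
  have hdis : Disjoint (A₁.map π.toEmbedding) B₁ := by
    rw [Finset.disjoint_left]
    intro x hx
    rw [Finset.mem_map] at hx
    obtain ⟨y, hy, rfl⟩ := hx
    exact hπ y hy
  have hcount := sum_avoid_pairs (A₁.map π.toEmbedding) B₁ hdis (A₁ ∩ A₂).card (B₁ ∩ B₂).card
    (by rw [Finset.card_map]; exact hg) hh
  rw [Finset.card_map] at hcount
  rw [← hcount]
  push_cast
  have hind : ∀ S : Finset V, ∑ T ∈ SB, avoidInd π S T =
      ((Finset.univ.filter fun T : Finset V => (T.card = B₁.card ∧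
        (B₁ ∩ T).card = (B₁ ∩ B₂).card) ∧ Disjoint (S.map π.toEmbedding) T).card : ℝ) := by
    intro S
    rw [sum_avoidInd π _ (fun _ => S) fun T => T, hSB, Finset.filter_filter]
    congr 2
    ext T
    simp only [Finset.mem_filter, Finset.mem_univ, true_and, Finset.disjoint_left,
      Finset.mem_map, Equiv.coe_toEmbedding, forall_exists_index, and_imp,
      forall_apply_eq_imp_iff₂]
  simp_rw [hind]
  refine Finset.sum_bij' (fun S _ => S.map π.toEmbedding) (fun S _ => S.map π.symm.toEmbedding)
    ?_ ?_ ?_ ?_ ?_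
  · intro S hS
    obtain ⟨-, s1, s2⟩ := Finset.mem_filter.mp hS
    rw [Finset.mem_filter]
    refine ⟨Finset.mem_univ _, by rw [Finset.card_map, s1], ?_⟩
    rw [← Finset.map_inter, Finset.card_map, s2]
  · intro S hS
    obtain ⟨-, s1, s2⟩ := Finset.mem_filter.mp hS
    rw [Finset.mem_filter]
    refine ⟨Finset.mem_univ _, by rw [Finset.card_map, s1], ?_⟩
    rw [← s2, ← Finset.card_map π.toEmbedding, Finset.map_inter, Finset.map_map]
    simp
  · intro S _
    ext; simp
  · intro S _
    ext; simp
  · intro S _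
    rfl

end Counting

/-! ## The ratio of the second moment to the squared first moment -/

/-- The probability that two independent uniform `a`-subsets of an `n`-set meet in `g` points. -/
noncomputable def overlapWeight (n a g : ℕ) : ℝ :=
  (a.choose g * (n - a).choose (a - g) : ℝ) / (n.choose a : ℝ)

/-- The contribution of the intersection size `s` to `overlapRatio`. -/
noncomputable def overlapTerm (N a b g h s : ℕ) : ℝ :=
  (b.choose s * (N - a - b).choose (a - g - s) *
      ((b - s).choose h * (N - a - b + s).choose (b - h)) : ℝ) /
    ((N - a).choose (a - g) * (b.choose h * (N - b).choose (b - h))) / avoidRate N a b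

/-- The ratio of the joint avoidance probability of two pairs of sets with overlaps `g` and `h` to
the product of their avoidance probabilities. -/
noncomputable def overlapRatio (N a b g h : ℕ) : ℝ :=
  ∑ s ∈ Finset.range (a - g + 1), overlapTerm N a b g h s

/-- The second moment over the squared first moment, as a sum over the overlaps. -/
noncomputable def overlapSum (d n m a b p q : ℕ) : ℝ :=
  ∑ g ∈ Finset.range (a + 1), ∑ h ∈ Finset.range (b + 1),
    overlapWeight n a g * overlapWeight n b h *
      (overlapRatio (n + m) (a + p) (b + q) (g + p) (h + q) ^ (d - 1) * overlapRatio n a b g h)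

theorem avoidRate_pos {N a b : ℕ} (hab : a + b ≤ N) : 0 < avoidRate N a b := by
  unfold avoidRate
  have h1 : 0 < (N - b).choose a := Nat.choose_pos (by omega)
  have h2 : 0 < N.choose a := Nat.choose_pos (by omega)
  positivity

section

variable {V : Type*} [Fintype V] [DecidableEq V]

/-- Dividing `avoidProb_mul_counts` by the counts requires them to be nonzero, which holds because
A₂ and B₂ realise the overlaps. The bound on the sizes makes `avoidRate` nonzero, so that it can be
split off. -/
theorem avoidProb_eq (A₁ A₂ B₁ B₂ : Finset V) (hA : A₂.card = A₁.card)
    (hB : B₂.card = B₁.card) (hN : A₁.card + B₁.card ≤ Fintype.card V) :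
    avoidProb A₁ A₂ B₁ B₂ = avoidRate (Fintype.card V) A₁.card B₁.card ^ 2 *
      overlapRatio (Fintype.card V) A₁.card B₁.card (A₁ ∩ A₂).card (B₁ ∩ B₂).card := by
  have hg : (A₁ ∩ A₂).card ≤ A₁.card := Finset.card_le_card Finset.inter_subset_left
  have hh : (B₁ ∩ B₂).card ≤ B₁.card := Finset.card_le_card Finset.inter_subset_left
  have pos : ∀ S T : Finset V, T.card = S.card →
      0 < (Fintype.card V - S.card).choose (S.card - (S ∩ T).card) := by
    intro S T hST
    apply Nat.choose_pos
    have e1 := Finset.card_union_add_card_inter S T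
    have e2 := Finset.card_le_univ (S ∪ T)
    omega
  have h1 := avoidProb_mul_counts A₁ A₂ B₁ B₂ hA hB
  have p1 := pos A₁ A₂ hA
  have p2 := pos B₁ B₂ hB
  have p3 := Nat.choose_pos hg
  have p4 := Nat.choose_pos hh
  have p5 := avoidRate_pos hN
  generalize Fintype.card V = N at *
  generalize A₁.card = a at *
  generalize B₁.card = b at *
  generalize (A₁ ∩ A₂).card = g at *
  generalize (B₁ ∩ B₂).card = h at *
  have e : overlapRatio N a b g h * (avoidRate N a b *
      (((a.choose g * (N - a).choose (a - g) : ℕ) : ℝ) *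
        ((b.choose h * (N - b).choose (b - h) : ℕ) : ℝ))) = overlapCount N a b g h := by
    rw [overlapRatio, overlapCount, Finset.sum_mul]
    push_cast
    refine Finset.sum_congr rfl fun s _ => ?_
    unfold overlapTerm
    field_simp
  rw [← e] at h1
  have hne : ((a.choose g * (N - a).choose (a - g) : ℕ) : ℝ) *
        ((b.choose h * (N - b).choose (b - h) : ℕ) : ℝ) ≠ 0 := by
    positivity
  apply mul_right_cancel₀ hne
  rw [h1]; ring

theorem sum_powersetCard_inter (A : Finset V) (G : ℕ → ℝ) :
    ∑ S ∈ Finset.powersetCard A.card (Finset.univ : Finset V), G (A ∩ S).card =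
      ∑ g ∈ Finset.range (A.card + 1),
        (A.card.choose g * (Fintype.card V - A.card).choose (A.card - g) : ℝ) * G g := by
  have hmaps : ∀ S ∈ Finset.powersetCard A.card (Finset.univ : Finset V),
      (A ∩ S).card ∈ Finset.range (A.card + 1) := fun S _ =>
    Finset.mem_range.mpr (Nat.lt_succ_of_le (Finset.card_le_card Finset.inter_subset_left))
  rw [← Finset.sum_fiberwise_of_maps_to hmaps]
  refine Finset.sum_congr rfl fun g hg => ?_
  rw [Finset.mem_range] at hg
  rw [Finset.sum_congr rfl (g := fun _ => G g) fun S hS => by rw [(Finset.mem_filter.mp hS).2],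
    Finset.sum_const, nsmul_eq_mul]
  congr 1
  rw [← Nat.cast_mul, ← card_filter_inter A A.card g (by omega)]
  congr 2
  ext S
  simp [Finset.mem_powersetCard]

/-- Up to the number of pairs, a sum over all second pairs of a function of the overlaps is an
expectation under two independent hypergeometric laws. -/
theorem sum_pairs_inter (A B : Finset V) (G : ℕ → ℕ → ℝ) :
    ∑ Y ∈ Finset.powersetCard A.card (Finset.univ : Finset V) ×ˢ
        Finset.powersetCard B.card (Finset.univ : Finset V), G (A ∩ Y.1).card (B ∩ Y.2).card =
      ((Fintype.card V).choose A.card * (Fintype.card V).choose B.card : ℝ) *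
      ∑ g ∈ Finset.range (A.card + 1), ∑ h ∈ Finset.range (B.card + 1),
        overlapWeight (Fintype.card V) A.card g * overlapWeight (Fintype.card V) B.card h *
          G g h := by
  have pA : (0 : ℝ) < (Fintype.card V).choose A.card := by
    exact_mod_cast Nat.choose_pos (Finset.card_le_univ A)
  have pB : (0 : ℝ) < (Fintype.card V).choose B.card := by
    exact_mod_cast Nat.choose_pos (Finset.card_le_univ B)
  rw [Finset.sum_product]
  rw [Finset.sum_congr rfl fun S _ => sum_powersetCard_inter B fun h => G (A ∩ S).card h,
    sum_powersetCard_inter A fun g => ∑ h ∈ Finset.range (B.card + 1),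
      (B.card.choose h * (Fintype.card V - B.card).choose (B.card - h) : ℝ) * G g h]
  simp_rw [Finset.mul_sum]
  refine Finset.sum_congr rfl fun g _ => Finset.sum_congr rfl fun h _ => ?_
  unfold overlapWeight
  field_simp

end

theorem card_disjSum_inter {n m : ℕ} (A B : Finset (Fin n)) (η : Finset (Fin m)) :
    (A.disjSum η ∩ B.disjSum η).card = (A ∩ B).card + η.card := by
  rw [← Finset.card_disjSum]
  congr 1
  ext (x | x) <;> simp

theorem gadgetMoment1_eq {d n m a b : ℕ} (lam α β : ℝ) (ha : α * n = a) (hb : β * n = b)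
    (ηp ηm : Finset (Fin m)) :
    gadgetMoment1 d n m lam α β ηp ηm =
      lam ^ (a + ηp.card + (b + ηm.card)) * ((n.choose a * n.choose b : ℝ) *
        (avoidRate (n + m) (a + ηp.card) (b + ηm.card) ^ (d - 1) * avoidRate n a b)) := by
  rw [gadgetMoment1_eq_sum lam α β ha hb]
  congr 1
  rw [Finset.sum_congr rfl (g := fun _ =>
    avoidRate (n + m) (a + ηp.card) (b + ηm.card) ^ (d - 1) * avoidRate n a b)]
  · rw [Finset.sum_const, Finset.card_product, Finset.card_powersetCard,
      Finset.card_powersetCard, nsmul_eq_mul, Finset.card_univ, Fintype.card_fin]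
    push_cast
    ring
  · rintro ⟨A, B⟩ hX
    simp only [Finset.mem_product, Finset.mem_powersetCard] at hX
    rw [avoidProb_self, avoidProb_self]
    simp [hX.1.2, hX.2.2]

/-- The sum over the second configuration does not depend on the first, so the first sum contributes
only a count. Both configurations share the trace η on U, hence the overlaps g and h grow by exactly
its two cardinalities. -/
theorem gadgetMoment2_eq {d n m a b : ℕ} (lam α β : ℝ) (ha : α * n = a) (hb : β * n = b)
    (ηp ηm : Finset (Fin m)) (hab : a + b ≤ n)
    (hN : a + ηp.card + (b + ηm.card) ≤ n + m) :
    gadgetMoment2 d n m lam α β ηp ηm = gadgetMoment1 d n m lam α β ηp ηm ^ 2 *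
      overlapSum d n m a b ηp.card ηm.card := by
  rw [gadgetMoment1_eq lam α β ha hb, gadgetMoment2_eq_sum lam α β ha hb]
  set r₁ := avoidRate (n + m) (a + ηp.card) (b + ηm.card)
  set r₂ := avoidRate n a b
  have key : ∀ X ∈ Finset.powersetCard a (Finset.univ : Finset (Fin n)) ×ˢ
          Finset.powersetCard b (Finset.univ : Finset (Fin n)),
      ∑ Y ∈ Finset.powersetCard a (Finset.univ : Finset (Fin n)) ×ˢ
          Finset.powersetCard b (Finset.univ : Finset (Fin n)),
        avoidProb (X.1.disjSum ηp) (Y.1.disjSum ηp) (X.2.disjSum ηm) (Y.2.disjSum ηm) ^ (d - 1) *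
          avoidProb X.1 Y.1 X.2 Y.2 =
      (n.choose a * n.choose b : ℝ) * ((r₁ ^ (d - 1) * r₂) ^ 2 *
        overlapSum d n m a b ηp.card ηm.card) := by
    rintro ⟨A, B⟩ hX
    simp only [Finset.mem_product, Finset.mem_powersetCard, Finset.subset_univ, true_and] at hX
    obtain ⟨rfl, rfl⟩ := hX
    have h1 := sum_pairs_inter A B (fun g h => (r₁ ^ (d - 1) * r₂) ^ 2 *
      (overlapRatio (n + m) (A.card + ηp.card) (B.card + ηm.card) (g + ηp.card) (h + ηm.card)
        ^ (d - 1) * overlapRatio n A.card B.card g h))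
    rw [Fintype.card_fin] at h1
    rw [overlapSum, Finset.mul_sum]
    simp_rw [Finset.mul_sum] at h1 ⊢
    rw [Finset.sum_congr rfl] at h1
    · refine Eq.trans h1 ?_
      refine Finset.sum_congr rfl fun g _ => Finset.sum_congr rfl fun h _ => ?_
      ring
    rintro ⟨A', B'⟩ hY
    simp only [Finset.mem_product, Finset.mem_powersetCard, Finset.subset_univ, true_and] at hY
    rw [avoidProb_eq A A' B B' hY.1 hY.2 (by simpa using hab),
      avoidProb_eq (A.disjSum ηp) (A'.disjSum ηp) (B.disjSum ηm) (B'.disjSum ηm) (by simp [hY.1])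
        (by simp [hY.2]) (by simpa using hN)]
    simp only [card_disjSum_inter, Finset.card_disjSum, Fintype.card_fin, Fintype.card_sum]
    ring
  rw [Finset.sum_congr rfl key, Finset.sum_const, Finset.card_product, Finset.card_powersetCard,
      Finset.card_powersetCard, nsmul_eq_mul, Finset.card_univ, Fintype.card_fin]
  push_cast
  ring

/-- The first moment of `Z^{α,β}_{MWW}`. -/
noncomputable def mwwFirst (d n : ℕ) (lam : ℝ) (a b : ℕ) : ℝ :=
  lam ^ (a + b) * ((n.choose a * n.choose b : ℝ) * avoidRate n a b ^ d)

/-- For m = 0 the two kinds of ratio coincide and their product is a d-th power. The same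
`overlapSum` thus covers both models, and a single limit theorem serves for both second moments. -/
theorem mwwMoment2_eq {d n a b : ℕ} (hd : 1 ≤ d) (lam α β : ℝ) (ha : α * n = a)
    (hb : β * n = b) (hab : a + b ≤ n) :
    mwwMoment2 d n lam α β = mwwFirst d n lam a b ^ 2 * overlapSum d n 0 a b 0 0 := by
  rw [mwwMoment2_eq_sum lam α β ha hb, mwwFirst]
  set r₂ := avoidRate n a b
  have key : ∀ X ∈ Finset.powersetCard a (Finset.univ : Finset (Fin n)) ×ˢ
          Finset.powersetCard b (Finset.univ : Finset (Fin n)),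
      ∑ Y ∈ Finset.powersetCard a (Finset.univ : Finset (Fin n)) ×ˢ
          Finset.powersetCard b (Finset.univ : Finset (Fin n)),
          avoidProb X.1 Y.1 X.2 Y.2 ^ d =
      (n.choose a * n.choose b : ℝ) * ((r₂ ^ d) ^ 2 * overlapSum d n 0 a b 0 0) := by
    rintro ⟨A, B⟩ hX
    simp only [Finset.mem_product, Finset.mem_powersetCard, Finset.subset_univ, true_and] at hX
    obtain ⟨rfl, rfl⟩ := hX
    have h1 := sum_pairs_inter A B (fun g h => (r₂ ^ d) ^ 2 *
      overlapRatio n A.card B.card g h ^ d)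
    rw [Fintype.card_fin] at h1
    rw [overlapSum, Finset.mul_sum]
    simp_rw [Finset.mul_sum] at h1 ⊢
    rw [Finset.sum_congr rfl] at h1
    · refine Eq.trans h1 ?_
      refine Finset.sum_congr rfl fun g _ => Finset.sum_congr rfl fun h _ => ?_
      simp only [add_zero]
      rw [pow_sub_one_mul (by omega)]
      ring
    rintro ⟨A', B'⟩ hY
    simp only [Finset.mem_product, Finset.mem_powersetCard, Finset.subset_univ, true_and] at hY
    rw [avoidProb_eq A A' B B' hY.1 hY.2 (by simpa using hab)]
    simp only [Fintype.card_fin]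
    ring
  rw [Finset.sum_congr rfl key, Finset.sum_const, Finset.card_product, Finset.card_powersetCard,
      Finset.card_powersetCard, nsmul_eq_mul, Finset.card_univ, Fintype.card_fin]
  push_cast
  ring

/-! ## Taylor expansion of `x log x` and Stirling's formula -/

theorem abs_log_one_add_le {r : ℝ} (hr : |r| ≤ 1 / 2) : |Real.log (1 + r)| ≤ 2 * |r| := by
  have h := Real.abs_log_sub_add_sum_range_le (x := -r) (by rw [abs_neg]; linarith) 0
  simp only [Finset.range_zero, Finset.sum_empty, zero_add, sub_neg_eq_add, abs_neg, pow_one] at h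
  refine h.trans ?_
  rw [div_le_iff₀ (by linarith)]
  nlinarith [abs_nonneg r]

theorem abs_mul_log_taylor {y w : ℝ} (hy : 0 < y) (hw : |w| ≤ y / 2) :
    |(y + w) * Real.log (y + w) - (y * Real.log y + (1 + Real.log y) * w + w ^ 2 / (2 * y))| ≤
      4 * |w| ^ 3 / y ^ 2 := by
  obtain ⟨r, rfl⟩ : ∃ r, w = y * r := ⟨w / y, by field_simp⟩
  have hr : |r| ≤ 1 / 2 := by
    rw [abs_mul, abs_of_pos hy] at hw
    nlinarith
  have hr' := abs_le.mp hr
  -- After scaling w = y r, the logarithm is expanded to second order with remainder |r|³/(1-|r|) ≤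
  -- 2|r|³. Multiplying by 1 + r and adding the cubic term r³/2 gives 7/2, rounded up to 4.
  have h := Real.abs_log_sub_add_sum_range_le (x := -r) (by rw [abs_neg]; linarith) 2
  simp only [Finset.sum_range_succ, Finset.range_zero, Finset.sum_empty, zero_add, sub_neg_eq_add,
    abs_neg] at h
  norm_num at h
  have h2 : |r| ^ 3 / (1 - |r|) ≤ 2 * |r| ^ 3 := by
    rw [div_le_iff₀ (by linarith)]
    have : 0 ≤ |r| ^ 3 := by positivity
    nlinarith
  set e := -r + r ^ 2 / 2 + Real.log (1 + r) with he
  have hlog : Real.log (y + y * r) = Real.log y + (e + r - r ^ 2 / 2) := by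
    rw [show y + y * r = y * (1 + r) by ring, Real.log_mul hy.ne' (by linarith), he]
    ring
  rw [hlog]
  have e1 : (y + y * r) * (Real.log y + (e + r - r ^ 2 / 2)) -
      (y * Real.log y + (1 + Real.log y) * (y * r) + (y * r) ^ 2 / (2 * y)) =
      y * ((1 + r) * e - r ^ 3 / 2) := by
    field_simp; ring
  rw [e1, abs_mul, abs_mul, abs_of_pos hy]
  have e2 : 4 * (y * |r|) ^ 3 / y ^ 2 = y * (4 * |r| ^ 3) := by field_simp
  rw [e2]
  apply mul_le_mul_of_nonneg_left _ hy.le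
  calc |(1 + r) * e - r ^ 3 / 2| ≤ |(1 + r) * e| + |r ^ 3 / 2| := abs_sub _ _
    _ = |1 + r| * |e| + |r| ^ 3 / 2 := by
        rw [abs_mul, abs_div, abs_pow]; norm_num
    _ ≤ 3 / 2 * (2 * |r| ^ 3) + |r| ^ 3 / 2 := by
        have : |1 + r| ≤ 3 / 2 := by rw [abs_le]; constructor <;> linarith
        have := mul_le_mul this (h.trans h2) (abs_nonneg _) (by norm_num)
        linarith
    _ ≤ 4 * |r| ^ 3 := by
        have : 0 ≤ |r| ^ 3 := by positivity
        linarith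

theorem tendsto_log_factorial_sub_stirling :
    Filter.Tendsto (fun k : ℕ => Real.log (k.factorial : ℝ) -
      (k * Real.log k - k + 1 / 2 * Real.log (2 * Real.pi * k))) Filter.atTop (nhds 0) := by
  have h := (Stirling.tendsto_stirlingSeq_sqrt_pi.log
    (Real.sqrt_pos.mpr Real.pi_pos).ne').sub_const (Real.log √Real.pi)
  rw [sub_self] at h
  refine h.congr' ?_
  filter_upwards [Filter.eventually_ge_atTop 1] with k hk
  have hk0 : (0 : ℝ) < k := by exact_mod_cast hk
  rw [Stirling.log_stirlingSeq_formula, Real.log_sqrt Real.pi_pos.le,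
    Real.log_div hk0.ne' (Real.exp_pos 1).ne', Real.log_exp,
    Real.log_mul (by norm_num) hk0.ne', Real.log_mul (by positivity) hk0.ne',
    Real.log_mul (by norm_num) Real.pi_pos.ne']
  ring

/-- A crude form of Stirling valid for every k, including 0. The lower bound is k^k/k! ≤ e^k; the
upper bound is the monotonicity of the Stirling sequence, compared with its value at 1. -/
theorem abs_log_factorial_sub_le (k : ℕ) :
    |Real.log (k.factorial : ℝ) - (k * Real.log k - k)| ≤ 1 + Real.log (k + 1) := by
  rcases Nat.eq_zero_or_pos k with rfl | hk
  · simp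
  have hk0 : (0 : ℝ) < k := by exact_mod_cast hk
  have hk1 : (1 : ℝ) ≤ k := by exact_mod_cast hk
  have hlogk : Real.log k ≤ Real.log (k + 1) := Real.log_le_log hk0 (by linarith)
  have hlogk0 : 0 ≤ Real.log k := Real.log_nonneg hk1
  have lower : k * Real.log k - k ≤ Real.log (k.factorial : ℝ) := by
    have h := Real.pow_div_factorial_le_exp (k : ℝ) hk0.le k
    have hf : (0 : ℝ) < k.factorial := by exact_mod_cast k.factorial_pos
    have h2 := Real.log_le_log (by positivity) h
    rw [Real.log_exp, Real.log_div (by positivity) hf.ne', Real.log_pow] at h2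
    linarith
  have upper : Real.log (k.factorial : ℝ) ≤ k * Real.log k - k + 1 + Real.log k := by
    have hanti := Stirling.stirlingSeq'_antitone (Nat.zero_le (k - 1))
    simp only [Function.comp, Nat.succ_eq_add_one, Nat.sub_add_cancel hk, zero_add] at hanti
    have hpos : 0 < Stirling.stirlingSeq k := by
      have := Stirling.stirlingSeq'_pos (k - 1)
      rwa [Nat.sub_add_cancel hk] at this
    have h2 := Real.log_le_log hpos hanti
    rw [Stirling.log_stirlingSeq_formula, Stirling.stirlingSeq_one,
      Real.log_div (Real.exp_pos 1).ne' (by positivity), Real.log_exp,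
      Real.log_sqrt (by norm_num), Real.log_div hk0.ne' (Real.exp_pos 1).ne', Real.log_exp,
      Real.log_mul (by norm_num) hk0.ne'] at h2
    linarith
  rw [abs_le]
  constructor <;> linarith

theorem exists_nat_rpow_neg_le {c : ℝ} (hc : 0 < c) {ε : ℝ} (hε : 0 < ε) :
    ∃ N : ℕ, ∀ n : ℕ, N ≤ n → (n : ℝ) ^ (-c) ≤ ε := by
  have h := (tendsto_rpow_neg_atTop hc).comp tendsto_natCast_atTop_atTop
  have h2 := h.eventually (ge_mem_nhds hε)
  obtain ⟨N, hN⟩ := Filter.eventually_atTop.mp h2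
  exact ⟨N, fun n hn => hN n hn⟩

/-- The logarithm of Stirling's approximation around `y`, to second order in the deviation `u` and
to first order in the perturbation `e`. -/
noncomputable def stirlingExp (y u e : ℝ) : ℝ :=
  y * Real.log y - y + 1 / 2 * Real.log (2 * Real.pi * y) + (u + e) * Real.log y + u ^ 2 / (2 * y)

/-- Stirling's formula expanded to second order around `y`, uniformly for deviations `u` below
`n ^ 0.65` and perturbations `e` below `n ^ 0.25`. -/
theorem log_factorial_near {κ ε : ℝ} (hκ : 0 < κ) (hε : 0 < ε) :
    ∃ N : ℕ, ∀ n : ℕ, N ≤ n → ∀ (y u e : ℝ) (k : ℕ), κ * n ≤ y → (k : ℝ) = y + u + e →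
      |u| ≤ 2 * (n : ℝ) ^ (65 / 100 : ℝ) → |e| ≤ 5 * (n : ℝ) ^ (1 / 4 : ℝ) →
      |Real.log (k.factorial : ℝ) - stirlingExp y u e| ≤ ε := by
  obtain ⟨K, hK⟩ := Metric.tendsto_atTop.mp tendsto_log_factorial_sub_stirling (ε / 2) (by linarith)
  -- The three summands bound the cubic Taylor remainder (1372 = 4·7³), the change of the
  -- square-root prefactor, and the part of the square that involves e.
  set C : ℝ := 1372 / κ ^ 2 + 7 / κ + 23 / κ with hC
  have hCpos : 0 < C := by positivity
  obtain ⟨N₁, hN₁⟩ := exists_nat_rpow_neg_le (c := 1 / 20) (by norm_num)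
    (ε := min (ε / (2 * C)) (κ / 14)) (by positivity)
  obtain ⟨N₂, hN₂⟩ := exists_nat_ge (2 * K / κ)
  refine ⟨max (max N₁ N₂) 1, fun n hn y u e k hy hk hu he => ?_⟩
  have hn1 : 1 ≤ n := (le_max_right _ _).trans hn
  have hnN1 : N₁ ≤ n := (le_max_left _ _).trans ((le_max_left _ _).trans hn)
  have hnN2 : N₂ ≤ n := (le_max_right _ _).trans ((le_max_left _ _).trans hn)
  have hnr : (1 : ℝ) ≤ n := by exact_mod_cast hn1
  have hn0 : (0 : ℝ) < n := by linarith
  -- All errors are of order t: the cubic one is n^(3·0.65)/n² = n^(-0.05), and the mixed one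
  -- n^(0.25+0.65)/n is smaller still.
  set t : ℝ := (n : ℝ) ^ (-(1 / 20) : ℝ) with ht
  have ht0 : 0 < t := Real.rpow_pos_of_pos hn0 _
  have ht1 := hN₁ n hnN1
  have htC : t ≤ ε / (2 * C) := ht1.trans (min_le_left _ _)
  have htκ : t ≤ κ / 14 := ht1.trans (min_le_right _ _)
  have hle : ∀ s : ℝ, s ≤ 95 / 100 → (n : ℝ) ^ s ≤ n * t := by
    intro s hs
    rw [ht, ← Real.rpow_one_add' hn0.le (by norm_num)]
    exact Real.rpow_le_rpow_of_exponent_le hnr (by linarith)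
  set v : ℝ := (n : ℝ) ^ (65 / 100 : ℝ) with hv
  have hv0 : 0 < v := Real.rpow_pos_of_pos hn0 _
  have hv1 : v ≤ n * t := hle _ (by norm_num)
  have hqv : (n : ℝ) ^ (1 / 4 : ℝ) ≤ v :=
    Real.rpow_le_rpow_of_exponent_le hnr (by norm_num)
  have hq0 : 0 < (n : ℝ) ^ (1 / 4 : ℝ) := Real.rpow_pos_of_pos hn0 _
  have hqv' : (n : ℝ) ^ (1 / 4 : ℝ) * v ≤ n * t := by
    rw [hv, ← Real.rpow_add hn0]
    exact hle _ (by norm_num)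
  have hv3 : v ^ 3 = n ^ 2 * t := by
    rw [hv, ht, ← Real.rpow_natCast, ← Real.rpow_mul hn0.le, ← Real.rpow_natCast (n : ℝ) 2,
      ← Real.rpow_add hn0]
    norm_num
  set w := u + e with hw
  have hwv : |w| ≤ 7 * v := by
    have := abs_add_le u e
    linarith
  have hy0 : 0 < y := lt_of_lt_of_le (by positivity) hy
  have hwy : |w| ≤ y / 2 := by
    have : n * t ≤ n * (κ / 14) := mul_le_mul_of_nonneg_left htκ hn0.le
    linarith
  have hk' : (k : ℝ) = y + w := by rw [hk, hw]; ring
  have hw2 := abs_le.mp hwy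
  have hk0 : (0 : ℝ) < k := by rw [hk']; linarith
  -- Stirling
  have s1 : |Real.log (k.factorial : ℝ) -
      (k * Real.log k - k + 1 / 2 * Real.log (2 * Real.pi * k))| ≤ ε / 2 := by
    have hKk : K ≤ k := by
      have h1 : 2 * K / κ ≤ (n : ℝ) := hN₂.trans (by exact_mod_cast hnN2)
      rw [div_le_iff₀ hκ] at h1
      have : (K : ℝ) ≤ k := by rw [hk']; linarith
      exact_mod_cast this
    have := hK k hKk
    rw [Real.dist_eq, sub_zero] at this
    exact this.le
  -- Taylor
  have s2 := abs_mul_log_taylor hy0 hwy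
  have s2' : 4 * |w| ^ 3 / y ^ 2 ≤ 1372 / κ ^ 2 * t := by
    have h1 : |w| ^ 3 ≤ (7 * v) ^ 3 := pow_le_pow_left₀ (abs_nonneg _) hwv 3
    have h2 : (κ * n) ^ 2 ≤ y ^ 2 := pow_le_pow_left₀ (by positivity) hy 2
    rw [div_le_iff₀ (by positivity)]
    calc 4 * |w| ^ 3 ≤ 4 * (7 * v) ^ 3 := by linarith
      _ = 1372 / κ ^ 2 * t * (κ * n) ^ 2 := by rw [mul_pow, hv3]; field_simp; norm_num
      _ ≤ 1372 / κ ^ 2 * t * y ^ 2 := mul_le_mul_of_nonneg_left h2 (by positivity)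
  -- the prefactor
  have s3 : |1 / 2 * Real.log (2 * Real.pi * k) - 1 / 2 * Real.log (2 * Real.pi * y)| ≤
      7 / κ * t := by
    have h0 : 1 / 2 * Real.log (2 * Real.pi * k) - 1 / 2 * Real.log (2 * Real.pi * y) =
        1 / 2 * Real.log (1 + w / y) := by
      rw [Real.log_mul (by positivity) hk0.ne', Real.log_mul (by positivity) hy0.ne',
        show 1 + w / y = k / y by rw [hk']; field_simp, Real.log_div hk0.ne' hy0.ne']
      ring
    have hr : |w / y| ≤ 1 / 2 := by
      rw [abs_div, abs_of_pos hy0, div_le_iff₀ hy0]; linarith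
    rw [h0, abs_mul]
    have h1 := abs_log_one_add_le hr
    have h2 : |w / y| ≤ 7 / κ * t := by
      rw [abs_div, abs_of_pos hy0, div_le_iff₀ hy0]
      calc |w| ≤ 7 * (n * t) := by linarith
        _ = 7 / κ * t * (κ * n) := by field_simp
        _ ≤ 7 / κ * t * y := mul_le_mul_of_nonneg_left hy (by positivity)
    norm_num
    linarith
  -- the quadratic term
  have s4 : |w ^ 2 / (2 * y) - u ^ 2 / (2 * y)| ≤ 23 / κ * t := by
    rw [show w ^ 2 / (2 * y) - u ^ 2 / (2 * y) = e * (2 * u + e) / (2 * y) by rw [hw]; ring,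
      abs_div, abs_of_pos (show 0 < 2 * y by linarith), div_le_iff₀ (by linarith), abs_mul]
    have h1 : |2 * u + e| ≤ 9 * v := by
      have := abs_add_le (2 * u) e
      rw [abs_mul, abs_two] at this
      linarith
    calc |e| * |2 * u + e| ≤ (5 * (n : ℝ) ^ (1 / 4 : ℝ)) * (9 * v) :=
          mul_le_mul he h1 (abs_nonneg _) (by positivity)
      _ ≤ 45 * (n * t) := by linarith
      _ ≤ 46 * (n * t) := by have : 0 ≤ n * t := by positivity
                             linarith
      _ = 23 / κ * t * (2 * (κ * n)) := by field_simp; norm_num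
      _ ≤ 23 / κ * t * (2 * y) := mul_le_mul_of_nonneg_left (by linarith) (by positivity)
  have hfin : C * t ≤ ε / 2 := by
    calc C * t ≤ C * (ε / (2 * C)) := mul_le_mul_of_nonneg_left htC hCpos.le
      _ = ε / 2 := by field_simp
  have hCt : C * t = 1372 / κ ^ 2 * t + 7 / κ * t + 23 / κ * t := by rw [hC]; ring
  have s2'' := s2.trans s2'
  rw [← hk'] at s2''
  unfold stirlingExp
  rw [abs_le] at s1 s2'' s3 s4 ⊢
  constructor <;> linarith

/-! ## The exponential rate of the second moment near its maximum -/

/-- `x log x`. -/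
noncomputable def xlogx (x : ℝ) : ℝ := x * Real.log x

theorem continuous_xlogx : Continuous xlogx := Real.continuous_mul_log

/-- The second-order Taylor polynomial of `xlogx` at `y`. -/
noncomputable def xlogxTaylor (y w : ℝ) : ℝ :=
  xlogx y + (1 + Real.log y) * w + w ^ 2 / (2 * y)

/-- The exponential rate of `overlapWeight`. -/
noncomputable def weightEnt (α γ : ℝ) : ℝ :=
  2 * xlogx α + 2 * xlogx (1 - α) - xlogx γ - 2 * xlogx (α - γ) - xlogx (1 - 2 * α + γ)

/-- The exponential rate of `overlapTerm`. -/
noncomputable def ratioEnt (α β γ δ s : ℝ) : ℝ :=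
  2 * xlogx (1 - α - β) - 2 * xlogx (1 - α) - 2 * xlogx (1 - β) + xlogx (α - γ)
    + xlogx (1 - 2 * α + γ) + xlogx (β - δ) + xlogx (1 - 2 * β + δ) + xlogx (1 - α - β + s)
    - xlogx s - xlogx (α - γ - s) - xlogx (1 - 2 * α - β + γ + s) - xlogx (β - δ - s)
    - xlogx (1 - α - 2 * β + δ + s)

/-- The exponential rate of the terms of `overlapSum`. -/
noncomputable def totalEnt (d : ℕ) (α β γ δ s : ℝ) : ℝ :=
  weightEnt α γ + weightEnt β δ + d * ratioEnt α β γ δ s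

theorem entH1_eq (x y : ℝ) : entH1 x y = xlogx y - xlogx x - xlogx (y - x) := by
  unfold entH1 xlogx; ring

/-- The summand that does not involve γ, δ, ε is twice the exponential rate of the first moment.
`totalEnt` is therefore the rate of the second moment relative to the squared first moment. -/
theorem rateF_eq (d : ℕ) (lam α β γ δ ε : ℝ) :
    rateF d lam α β γ δ ε =
      (2 * (α + β) * Real.log lam - 2 * (xlogx α + xlogx (1 - α)) - 2 * (xlogx β + xlogx (1 - β))
        + d * (2 * xlogx (1 - α) + 2 * xlogx (1 - β) - 2 * xlogx (1 - α - β)))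
      + totalEnt d α β γ δ (α - γ - ε) := by
  have h1 : xlogx 1 = 0 := by simp [xlogx]
  unfold rateF entH totalEnt weightEnt ratioEnt
  simp only [entH1_eq, h1]
  rw [show α - γ - (α - γ - ε) = ε by ring,
    show 1 - α - (α - γ) = 1 - 2 * α + γ by ring,
    show 1 - β - (β - δ) = 1 - 2 * β + δ by ring,
    show β - δ - (α - γ - ε) = β - δ - α + γ + ε by ring,
    show 1 - γ - (α - γ) = 1 - α by ring,
    show 1 - β - γ - ε - (α - γ) = 1 - α - β - ε by ring,
    show 1 - α - β + (α - γ - ε) = 1 - β - γ - ε by ring,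
    show 1 - 2 * α - β + γ + (α - γ - ε) = 1 - α - β - ε by ring,
    show 1 - α - 2 * β + δ + (α - γ - ε) = 1 - 2 * β + δ - γ - ε by ring]
  ring

/-- Twice the Hessian form of `ratioEnt` at its critical point. -/
noncomputable def ratioQuad (α β x y z : ℝ) : ℝ :=
  x ^ 2 / (α * (1 - α) ^ 2) + y ^ 2 / (β * (1 - β) ^ 2)
    - z ^ 2 * (1 - α - β) / (α * β * ((1 - α) * (1 - β)))
    - (x + z) ^ 2 / (α * (1 - α) * (1 - α - β)) - (y + z) ^ 2 / (β * (1 - β) * (1 - α - β))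

/-- The coefficient of the intersection size in `ratioQuad`. -/
noncomputable def quadCoeff (α β : ℝ) : ℝ :=
  (1 - α - β + 2 * α * β) / (α * β * ((1 - α) * (1 - β)) * (1 - α - β))

/-- The minus of the optimal intersection size in `ratioQuad`, for given `X`, `Y`. -/
noncomputable def quadShift (α β X Y : ℝ) : ℝ :=
  (X + Y) * (α * β * ((1 - α) * (1 - β)) / (1 - α - β + 2 * α * β))

/-- Completing the square in z. Rescaling x and y by the variances α(1-α) and β(1-β) makes the
remaining form symmetric in X and Y, hence diagonal in X - Y and X + Y. -/
theorem ratioQuad_eq {α β : ℝ} (hα : 0 < α) (hβ : 0 < β) (hD : 0 < 1 - α - β) (X Y z : ℝ) :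
    ratioQuad α β (α * (1 - α) * X) (β * (1 - β) * Y) z =
      -(quadCoeff α β * (z + quadShift α β X Y) ^ 2)
      - 1 / 2 * (α * β / (1 - α - β)) * (X - Y) ^ 2
      + 1 / 2 * (α * β / (1 - α - β + 2 * α * β)) * (X + Y) ^ 2 := by
  have h1 : 0 < 1 - α := by linarith
  have h2 : 0 < 1 - β := by linarith
  have h3 : 0 < 1 - α - β + 2 * α * β := by positivity
  -- Opaque names for the recurring factors let `field_simp` treat them as atoms; they are unfolded
  -- again before `ring`.
  obtain ⟨D, hDe⟩ : ∃ D, D = 1 - α - β := ⟨_, rfl⟩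
  obtain ⟨u, hu⟩ : ∃ u, u = 1 - α := ⟨_, rfl⟩
  obtain ⟨v, hv⟩ : ∃ v, v = 1 - β := ⟨_, rfl⟩
  obtain ⟨E, hE⟩ : ∃ E, E = D + 2 * α * β := ⟨_, rfl⟩
  unfold ratioQuad quadCoeff quadShift
  rw [← hDe, ← hE] at h3
  rw [← hDe] at hD
  rw [← hu] at h1
  rw [← hv] at h2
  rw [← hDe, ← hE, ← hu, ← hv]
  field_simp
  subst hE hu hv hDe
  ring

/-- At the product point the cells are α², α(1-α) (twice) and (1-α)², so their logarithms are
additive. The constant and linear terms cancel, and only the quadratic one is left. -/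
theorem weightTaylor_eq {α : ℝ} (hα : 0 < α) (hα1 : 0 < 1 - α) (x : ℝ) :
    2 * xlogx α + 2 * xlogx (1 - α) - xlogxTaylor (α ^ 2) x - 2 * xlogxTaylor (α * (1 - α)) (-x)
      - xlogxTaylor ((1 - α) ^ 2) x = -(x ^ 2 / (α ^ 2 * (1 - α) ^ 2)) / 2 := by
  unfold xlogxTaylor xlogx
  rw [Real.log_pow, Real.log_pow, Real.log_mul hα.ne' hα1.ne']
  have key : x ^ 2 / (2 * α ^ 2) + 2 * ((-x) ^ 2 / (2 * (α * (1 - α)))) +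
      x ^ 2 / (2 * (1 - α) ^ 2) = (x ^ 2 / (α ^ 2 * (1 - α) ^ 2)) / 2 := by
    field_simp
    ring
  push_cast
  linear_combination (-1 : ℝ) * key

/-- The same cancellation: at the product point every cell of `ratioEnt` factors into α, β, 1-α, 1-β
and 1-α-β, and the linear terms vanish because the logarithms balance. -/
theorem ratioTaylor_eq {α β : ℝ} (hα : 0 < α) (hβ : 0 < β) (hD : 0 < 1 - α - β) (x y z : ℝ) :
    2 * xlogx (1 - α - β) - 2 * xlogx (1 - α) - 2 * xlogx (1 - β)
      + xlogxTaylor (α * (1 - α)) (-x) + xlogxTaylor ((1 - α) ^ 2) x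
      + xlogxTaylor (β * (1 - β)) (-y) + xlogxTaylor ((1 - β) ^ 2) y
      + xlogxTaylor ((1 - α) * (1 - β)) z - xlogxTaylor (α * β) z
      - xlogxTaylor (α * (1 - α - β)) (-x - z) - xlogxTaylor ((1 - α) * (1 - α - β)) (x + z)
      - xlogxTaylor (β * (1 - α - β)) (-y - z) - xlogxTaylor ((1 - β) * (1 - α - β)) (y + z) =
      ratioQuad α β x y z / 2 := by
  have h1 : 0 < 1 - α := by linarith
  have h2 : 0 < 1 - β := by linarith
  unfold xlogxTaylor xlogx ratioQuad
  rw [Real.log_pow, Real.log_pow, Real.log_mul hα.ne' h1.ne', Real.log_mul hβ.ne' h2.ne',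
    Real.log_mul h1.ne' h2.ne', Real.log_mul hα.ne' hβ.ne', Real.log_mul hα.ne' hD.ne',
    Real.log_mul h1.ne' hD.ne', Real.log_mul hβ.ne' hD.ne', Real.log_mul h2.ne' hD.ne']
  have k1 : (-x) ^ 2 / (2 * (α * (1 - α))) + x ^ 2 / (2 * (1 - α) ^ 2) =
      (x ^ 2 / (α * (1 - α) ^ 2)) / 2 := by
    field_simp; ring
  have k2 : (-y) ^ 2 / (2 * (β * (1 - β))) + y ^ 2 / (2 * (1 - β) ^ 2) =
      (y ^ 2 / (β * (1 - β) ^ 2)) / 2 := by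
    field_simp; ring
  have k3 : z ^ 2 / (2 * ((1 - α) * (1 - β))) - z ^ 2 / (2 * (α * β)) =
      -(z ^ 2 * (1 - α - β) / (α * β * ((1 - α) * (1 - β)))) / 2 := by
    field_simp; ring
  have k4 : (-x - z) ^ 2 / (2 * (α * (1 - α - β))) + (x + z) ^ 2 / (2 * ((1 - α) * (1 - α - β))) =
      ((x + z) ^ 2 / (α * (1 - α) * (1 - α - β))) / 2 := by
    field_simp; ring
  have k5 : (-y - z) ^ 2 / (2 * (β * (1 - α - β))) + (y + z) ^ 2 / (2 * ((1 - β) * (1 - α - β))) =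
      ((y + z) ^ 2 / (β * (1 - β) * (1 - α - β))) / 2 := by
    field_simp; ring
  push_cast
  linear_combination k1 + k2 + k3 - k4 - k5

theorem xlogx_taylor {c y w a : ℝ} (hc : 0 < c) (hy : c ≤ y) (hw : |w| ≤ c / 2) (ha : a = y + w) :
    |xlogx a - xlogxTaylor y w| ≤ 4 * |w| ^ 3 / c ^ 2 := by
  subst ha
  have hy0 : 0 < y := lt_of_lt_of_le hc hy
  refine (abs_mul_log_taylor hy0 (by linarith)).trans ?_
  have : c ^ 2 ≤ y ^ 2 := pow_le_pow_left₀ hc.le hy 2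
  exact div_le_div_of_nonneg_left (by positivity) (by positivity) this

/-- Every cell is at least κ² at the centre and moves by at most 2r. A cell moving by r costs 4
units of r³/κ⁴ and one moving by 2r costs 32. The two weights cost 16 each; the ratio costs 6·4 +
4·32 = 152, rounded up to 160. -/
theorem totalEnt_taylor {d : ℕ} {α β κ r x y z : ℝ} (hκ : 0 < κ) (hα : κ ≤ α) (hβ : κ ≤ β)
    (hD : κ ≤ 1 - α - β) (hx : |x| ≤ r) (hy : |y| ≤ r) (hz : |z| ≤ r) (hr : 4 * r ≤ κ ^ 2) :
    |totalEnt d α β (α ^ 2 + x) (β ^ 2 + y) (α * β + z) -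
      (-(x ^ 2 / (α ^ 2 * (1 - α) ^ 2)) - y ^ 2 / (β ^ 2 * (1 - β) ^ 2)
        + d * ratioQuad α β x y z) / 2| ≤ (32 + 160 * d) * r ^ 3 / κ ^ 4 := by
  have h1 : κ ≤ 1 - α := by linarith
  have h2 : κ ≤ 1 - β := by linarith
  have hr0 : 0 ≤ r := (abs_nonneg x).trans hx
  have hx' : |(-x)| ≤ r := by rwa [abs_neg]
  have hy' : |(-y)| ≤ r := by rwa [abs_neg]
  have hκ2 : 0 < κ ^ 2 := by positivity
  have mulk : ∀ {p q : ℝ}, κ ≤ p → κ ≤ q → κ ^ 2 ≤ p * q := fun {p q} hp hq => by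
    rw [sq]; exact mul_le_mul hp hq hκ.le (hκ.le.trans hp)
  have sqk : ∀ {p : ℝ}, κ ≤ p → κ ^ 2 ≤ p ^ 2 := fun {p} hp => pow_le_pow_left₀ hκ.le hp 2
  have one : ∀ {p w a : ℝ}, κ ^ 2 ≤ p → |w| ≤ r → a = p + w →
      |xlogx a - xlogxTaylor p w| ≤ 4 * r ^ 3 / κ ^ 4 := fun {p w a} hp hw ha => by
    refine (xlogx_taylor hκ2 hp (by linarith) ha).trans ?_
    rw [← pow_mul]
    have := pow_le_pow_left₀ (abs_nonneg w) hw 3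
    gcongr
  have two : ∀ {p w a : ℝ}, κ ^ 2 ≤ p → |w| ≤ 2 * r → a = p + w →
      |xlogx a - xlogxTaylor p w| ≤ 32 * r ^ 3 / κ ^ 4 := fun {p w a} hp hw ha => by
    refine (xlogx_taylor hκ2 hp (by linarith) ha).trans ?_
    rw [← pow_mul]
    have := pow_le_pow_left₀ (abs_nonneg w) hw 3
    have e : 4 * |w| ^ 3 ≤ 32 * r ^ 3 := by nlinarith
    gcongr
  have hxz : |x + z| ≤ 2 * r := (abs_add_le _ _).trans (by linarith)
  have hyz : |y + z| ≤ 2 * r := (abs_add_le _ _).trans (by linarith)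
  have hxz' : |-x - z| ≤ 2 * r := by rw [show -x - z = -(x + z) by ring, abs_neg]; exact hxz
  have hyz' : |-y - z| ≤ 2 * r := by rw [show -y - z = -(y + z) by ring, abs_neg]; exact hyz
  set M := r ^ 3 / κ ^ 4 with hM
  have hM0 : 0 ≤ M := by positivity
  have hM4 : 4 * r ^ 3 / κ ^ 4 = 4 * M := by rw [hM]; ring
  have hM32 : 32 * r ^ 3 / κ ^ 4 = 32 * M := by rw [hM]; ring
  rw [hM4] at one
  rw [hM32] at two
  have a1 := one (a := α ^ 2 + x) (sqk hα) hx rfl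
  have a2 := one (a := α - (α ^ 2 + x)) (mulk hα h1) hx' (by ring)
  have a3 := one (a := 1 - 2 * α + (α ^ 2 + x)) (sqk h1) hx (by ring)
  have b1 := one (a := β ^ 2 + y) (sqk hβ) hy rfl
  have b2 := one (a := β - (β ^ 2 + y)) (mulk hβ h2) hy' (by ring)
  have b3 := one (a := 1 - 2 * β + (β ^ 2 + y)) (sqk h2) hy (by ring)
  have c1 := one (a := 1 - α - β + (α * β + z)) (mulk h1 h2) hz (by ring)
  have c2 := one (a := α * β + z) (mulk hα hβ) hz rfl
  have c3 := two (a := α - (α ^ 2 + x) - (α * β + z)) (mulk hα hD) hxz' (by ring)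
  have c4 := two (a := 1 - 2 * α - β + (α ^ 2 + x) + (α * β + z)) (mulk h1 hD) hxz (by ring)
  have c5 := two (a := β - (β ^ 2 + y) - (α * β + z)) (mulk hβ hD) hyz' (by ring)
  have c6 := two (a := 1 - α - 2 * β + (β ^ 2 + y) + (α * β + z)) (mulk h2 hD) hyz (by ring)
  have hα0 : 0 < α := by linarith
  have hβ0 : 0 < β := by linarith
  have w1 : |weightEnt α (α ^ 2 + x) - -(x ^ 2 / (α ^ 2 * (1 - α) ^ 2)) / 2| ≤ 16 * M := by
    rw [← weightTaylor_eq hα0 (by linarith), weightEnt]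
    rw [abs_le] at *
    constructor <;> linarith
  have w2 : |weightEnt β (β ^ 2 + y) - -(y ^ 2 / (β ^ 2 * (1 - β) ^ 2)) / 2| ≤ 16 * M := by
    rw [← weightTaylor_eq hβ0 (by linarith), weightEnt]
    rw [abs_le] at *
    constructor <;> linarith
  have w3 : |ratioEnt α β (α ^ 2 + x) (β ^ 2 + y) (α * β + z) - ratioQuad α β x y z / 2| ≤
      160 * M := by
    rw [← ratioTaylor_eq hα0 hβ0 (by linarith), ratioEnt]
    rw [abs_le] at *
    constructor <;> linarith
  have w4 : |d * (ratioEnt α β (α ^ 2 + x) (β ^ 2 + y) (α * β + z) - ratioQuad α β x y z / 2)| ≤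
      d * (160 * M) := by
    rw [abs_mul, abs_of_nonneg (Nat.cast_nonneg d)]
    exact mul_le_mul_of_nonneg_left w3 (Nat.cast_nonneg d)
  rw [show (32 + 160 * (d : ℝ)) * r ^ 3 / κ ^ 4 = 16 * M + 16 * M + d * (160 * M) by
    rw [hM]; ring, totalEnt]
  rw [abs_le] at w1 w2 w4 ⊢
  constructor <;> linarith

theorem totalEnt_center {d : ℕ} {α β : ℝ} (hα : 0 < α) (hβ : 0 < β) (hD : 0 < 1 - α - β) :
    totalEnt d α β (α ^ 2) (β ^ 2) (α * β) = 0 := by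
  obtain ⟨κ, hκ, h1, h2, h3⟩ : ∃ κ : ℝ, 0 < κ ∧ κ ≤ α ∧ κ ≤ β ∧ κ ≤ 1 - α - β :=
    ⟨min α (min β (1 - α - β)), by positivity, min_le_left _ _,
      (min_le_right _ _).trans (min_le_left _ _), (min_le_right _ _).trans (min_le_right _ _)⟩
  -- With radius zero the error bound vanishes and the expansion gives the value at the centre.
  have h := totalEnt_taylor (d := d) (r := 0) (x := 0) (y := 0) (z := 0) hκ h1 h2 h3
    (by simp) (by simp) (by simp) (by rw [mul_zero]; positivity)
  simp only [ratioQuad, add_zero] at h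
  norm_num at h
  exact h

set_option maxHeartbeats 800000 in
-- In the coordinates of `ratioQuad_eq` the form is a negative combination of the squares of X - Y,
-- X + Y and the shifted z. It dominates κ/3 times X² + Y² + W². Returning to x, y, z costs a factor
-- 2, because z² ≤ 2W² + X² + Y².
theorem quad_le_neg {d : ℕ} (hd : 1 ≤ d) {α β κ : ℝ} (hκ : 0 < κ) (hκ1 : κ ≤ 1) (hα : κ ≤ α)
    (hβ : κ ≤ β) (hD : κ ≤ 1 - α - β) (hE : κ ≤ 1 - α - β - ((d : ℝ) - 2) * α * β) (x y z : ℝ) :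
    -(x ^ 2 / (α ^ 2 * (1 - α) ^ 2)) - y ^ 2 / (β ^ 2 * (1 - β) ^ 2) + d * ratioQuad α β x y z ≤
      -(κ / 6) * (x ^ 2 + y ^ 2 + z ^ 2) := by
  have hα0 : 0 < α := by linarith
  have hβ0 : 0 < β := by linarith
  have hD0 : 0 < 1 - α - β := by linarith
  have h1 : 0 < 1 - α := by linarith
  have h2 : 0 < 1 - β := by linarith
  obtain ⟨X, rfl⟩ : ∃ X, x = α * (1 - α) * X := ⟨x / (α * (1 - α)), by field_simp⟩
  obtain ⟨Y, rfl⟩ : ∃ Y, y = β * (1 - β) * Y := ⟨y / (β * (1 - β)), by field_simp⟩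
  rw [ratioQuad_eq hα0 hβ0 hD0,
    show (α * (1 - α) * X) ^ 2 / (α ^ 2 * (1 - α) ^ 2) = X ^ 2 by field_simp,
    show (β * (1 - β) * Y) ^ 2 / (β ^ 2 * (1 - β) ^ 2) = Y ^ 2 by field_simp]
  have hd' : (1 : ℝ) ≤ d := by exact_mod_cast hd
  have hk : 0 < α * β := by positivity
  have hkk : 2 * α * β = 2 * (α * β) := by ring
  have hE2 : 0 < 1 - α - β + 2 * α * β := by positivity
  have hk1 : α * β ≤ 1 := by nlinarith
  have hP0 : 0 < (1 - α) * (1 - β) := by positivity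
  have hP1 : (1 - α) * (1 - β) ≤ 1 := by nlinarith
  -- the coefficient of `z`
  have hcz : 1 ≤ quadCoeff α β := by
    unfold quadCoeff
    rw [le_div_iff₀ (by positivity), one_mul]
    have : α * β * ((1 - α) * (1 - β)) ≤ 1 := by nlinarith
    nlinarith
  set W := z + quadShift α β X Y with hW
  have hshift : quadShift α β X Y ^ 2 ≤ (X ^ 2 + Y ^ 2) / 2 := by
    unfold quadShift
    have hq : α * β * ((1 - α) * (1 - β)) / (1 - α - β + 2 * α * β) ≤ 1 / 2 := by
      rw [div_le_iff₀ hE2]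
      nlinarith
    have hq0 : 0 ≤ α * β * ((1 - α) * (1 - β)) / (1 - α - β + 2 * α * β) := by positivity
    set q := α * β * ((1 - α) * (1 - β)) / (1 - α - β + 2 * α * β)
    have hq2 : q ^ 2 ≤ 1 / 4 := by nlinarith
    rw [mul_pow]
    nlinarith [sq_nonneg (X - Y), sq_nonneg (X + Y)]
  have hz : z ^ 2 ≤ 2 * W ^ 2 + (X ^ 2 + Y ^ 2) := by
    have : z = W - quadShift α β X Y := by rw [hW]; ring
    rw [this]
    nlinarith [sq_nonneg (W + quadShift α β X Y)]
  -- the coefficients of `X - Y` and `X + Y`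
  have hA : 0 ≤ (d : ℝ) * (1 / 2 * (α * β / (1 - α - β)) * (X - Y) ^ 2) := by positivity
  -- The only coefficient that can degenerate: its numerator is 1-α-β-(d-2)αβ, bounded below by
  -- `hE`, and its denominator is at most 3.
  have hB : κ / 3 ≤ 1 - d * (α * β / (1 - α - β + 2 * α * β)) := by
    have : 1 - d * (α * β / (1 - α - β + 2 * α * β)) =
        (1 - α - β - ((d : ℝ) - 2) * α * β) / (1 - α - β + 2 * α * β) := by
      field_simp; ring
    rw [this, le_div_iff₀ hE2]
    nlinarith
  have hWd : W ^ 2 ≤ d * (quadCoeff α β * W ^ 2) := by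
    have h0 := sq_nonneg W
    calc W ^ 2 ≤ quadCoeff α β * W ^ 2 := by nlinarith
      _ ≤ d * (quadCoeff α β * W ^ 2) := by
        have : 0 ≤ quadCoeff α β * W ^ 2 := by nlinarith
        nlinarith
  have hXs : (α * (1 - α) * X) ^ 2 ≤ X ^ 2 := by
    rw [mul_pow]
    have : (α * (1 - α)) ^ 2 ≤ 1 := by
      apply pow_le_one₀ (by positivity); nlinarith
    nlinarith [sq_nonneg X]
  have hYs : (β * (1 - β) * Y) ^ 2 ≤ Y ^ 2 := by
    rw [mul_pow]
    have : (β * (1 - β)) ^ 2 ≤ 1 := by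
      apply pow_le_one₀ (by positivity); nlinarith
    nlinarith [sq_nonneg Y]
  have hBS : κ / 3 * (X + Y) ^ 2 ≤ (1 - d * (α * β / (1 - α - β + 2 * α * β))) * (X + Y) ^ 2 :=
    mul_le_mul_of_nonneg_right hB (sq_nonneg _)
  have hXY : X ^ 2 + Y ^ 2 = 1 / 2 * (X + Y) ^ 2 + 1 / 2 * (X - Y) ^ 2 := by ring
  have hκm : κ / 3 * (X - Y) ^ 2 ≤ (X - Y) ^ 2 := by nlinarith [sq_nonneg (X - Y)]
  have hκW : κ / 3 * W ^ 2 ≤ W ^ 2 := by nlinarith [sq_nonneg W]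
  have hκz : κ / 6 * z ^ 2 ≤ κ / 6 * (2 * W ^ 2 + (X ^ 2 + Y ^ 2)) :=
    mul_le_mul_of_nonneg_left hz (by positivity)
  have hκx : κ / 6 * ((α * (1 - α) * X) ^ 2 + (β * (1 - β) * Y) ^ 2) ≤ κ / 6 * (X ^ 2 + Y ^ 2) :=
    mul_le_mul_of_nonneg_left (by linarith) (by positivity)
  have hsum : κ / 3 * (X ^ 2 + Y ^ 2) = 1 / 2 * (κ / 3 * (X + Y) ^ 2)
      + 1 / 2 * (κ / 3 * (X - Y) ^ 2) := by ring
  have hsplit : (d : ℝ) * (-(quadCoeff α β * W ^ 2)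
      - 1 / 2 * (α * β / (1 - α - β)) * (X - Y) ^ 2
      + 1 / 2 * (α * β / (1 - α - β + 2 * α * β)) * (X + Y) ^ 2) =
      -(d * (quadCoeff α β * W ^ 2)) - d * (1 / 2 * (α * β / (1 - α - β)) * (X - Y) ^ 2)
      + 1 / 2 * ((X + Y) ^ 2 -
        (1 - d * (α * β / (1 - α - β + 2 * α * β))) * (X + Y) ^ 2) := by ring
  rw [hsplit]
  linarith

/-! ## Consequences of the technical condition -/

/-- `SecondMomentRegion` in the coordinates used for `totalEnt`. -/
def EntRegion (α β γ δ s : ℝ) : Prop :=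
  0 ≤ γ ∧ 0 ≤ δ ∧ 0 ≤ s ∧ 0 ≤ α - γ - s ∧ 0 ≤ β - δ - s ∧
    0 ≤ 1 - α - 2 * β + δ + s ∧ 0 ≤ 1 - 2 * α - β + γ + s

theorem secondMomentRegion_iff {α β γ δ s : ℝ} :
    SecondMomentRegion α β γ δ (α - γ - s) ↔ EntRegion α β γ δ s := by
  unfold SecondMomentRegion EntRegion
  constructor
  · rintro ⟨h1, h2, h3, h4, h5, h6, h7, h8⟩
    refine ⟨?_, ?_, ?_, ?_, ?_, ?_, ?_⟩ <;> linarith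
  · rintro ⟨h1, h2, h3, h4, h5, h6, h7⟩
    refine ⟨?_, ?_, ?_, ?_, ?_, ?_, ?_, ?_⟩ <;> linarith

/-- `totalEnt` is negative away from its critical point, on an open neighbourhood. -/
def EntNegAt (d : ℕ) (α β : ℝ) : Prop :=
  ∀ γ δ s : ℝ, EntRegion α β γ δ s → (γ, δ, s) ≠ (α ^ 2, β ^ 2, α * β) →
    totalEnt d α β γ δ s < totalEnt d α β (α ^ 2) (β ^ 2) (α * β)

theorem TechnicalCondition.exists_entNegAt {d : ℕ} {lam : ℝ} (h : TechnicalCondition d lam) :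
    ∃ χ : ℝ, 0 < χ ∧ ∀ α β : ℝ, |α - pMinus d lam| < χ → |β - pPlus d lam| < χ →
      SecondMomentRegion α β (α ^ 2) (β ^ 2) (α * (1 - α - β)) ∧ EntNegAt d α β := by
  obtain ⟨χ, hχ, h⟩ := h
  refine ⟨χ, hχ, fun α β hα hβ => ?_⟩
  rw [abs_sub_comm] at hα hβ
  obtain ⟨h1, h2⟩ := h α β hα hβ
  refine ⟨h1, fun γ δ s hs hne => ?_⟩
  have h3 := h2 γ δ (α - γ - s) (secondMomentRegion_iff.mpr hs) (by
    intro heq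
    apply hne
    simp only [Prod.mk.injEq] at heq ⊢
    obtain ⟨e1, e2, e3⟩ := heq
    refine ⟨e1, e2, ?_⟩
    rw [e1] at e3
    linarith)
  rw [rateF_eq, rateF_eq, show α - γ - (α - γ - s) = s by ring,
    show α - α ^ 2 - α * (1 - α - β) = α * β by ring] at h3
  linarith

/-- Positivity is read off from the feasibility of the product point: β-β² ≥ 0 gives β ≥ 0, the cell
αβ ≥ 0 then gives α ≥ 0, and α(1-α-β) ≥ 0 gives the last bound. Each sign holds on an open interval,
hence strictly, which permits the next division. -/
theorem densities_nonneg {p q χ : ℝ}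
    (h : ∀ α β : ℝ, |α - p| < χ → |β - q| < χ →
      SecondMomentRegion α β (α ^ 2) (β ^ 2) (α * (1 - α - β))) {α β : ℝ}
    (hα : |α - p| < χ) (hβ : |β - q| < χ) : 0 ≤ α ∧ 0 ≤ β ∧ 0 ≤ 1 - α - β := by
  have hβ0 : ∀ β', |β' - q| < χ → 0 ≤ β' := by
    intro β' hβ'
    have h2 := (h α β' hα hβ').2.1
    nlinarith [sq_nonneg β']
  have hβ1 : 0 < β := by
    rw [abs_lt] at hβ
    -- The midpoint between β and the left end of the interval is still admissible, so β exceeds a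
    -- nonnegative number.
    have := hβ0 (β - (β - q + χ) / 2) (by rw [abs_lt]; constructor <;> linarith)
    linarith
  have hα0 : ∀ α', |α' - p| < χ → 0 ≤ α' := by
    intro α' hα'
    have h2 := (h α' β hα' hβ).1
    have : 0 ≤ α' * β := by nlinarith
    exact nonneg_of_mul_nonneg_left this hβ1
  have hα1 : 0 < α := by
    rw [abs_lt] at hα
    have := hα0 (α - (α - p + χ) / 2) (by rw [abs_lt]; constructor <;> linarith)
    linarith
  refine ⟨hα1.le, hβ1.le, ?_⟩
  have h2 := (h α β hα hβ).2.2.2.2.2.1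
  exact nonneg_of_mul_nonneg_right h2 hα1

/-- If the quantity were negative, `totalEnt` would increase from the centre in the direction X = Y
with the optimal z, contradicting maximality. -/
theorem hessian_nonneg {d : ℕ} {α β : ℝ} (hα : 0 < α) (hβ : 0 < β) (hD : 0 < 1 - α - β)
    (h : EntNegAt d α β) : 0 ≤ 1 - α - β - ((d : ℝ) - 2) * α * β := by
  by_contra hE
  rw [not_le] at hE
  obtain ⟨κ, hκ, k1, k2, k3⟩ : ∃ κ : ℝ, 0 < κ ∧ κ ≤ α ∧ κ ≤ β ∧ κ ≤ 1 - α - β :=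
    ⟨min α (min β (1 - α - β)), by positivity, min_le_left _ _,
      (min_le_right _ _).trans (min_le_left _ _), (min_le_right _ _).trans (min_le_right _ _)⟩
  have h1 : 0 < 1 - α := by linarith
  have h2 : 0 < 1 - β := by linarith
  have hk : 0 < α * β := by positivity
  have hE2 : 0 < 1 - α - β + 2 * α * β := by positivity
  set q := α * β * ((1 - α) * (1 - β)) / (1 - α - β + 2 * α * β) with hq
  have hq0 : 0 < q := by positivity
  have hq2 : q ≤ 1 / 2 := by
    rw [hq, div_le_iff₀ hE2]
    have : (1 - α) * (1 - β) ≤ 1 := by nlinarith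
    nlinarith
  set B := (((d : ℝ) - 2) * α * β - (1 - α - β)) / (1 - α - β + 2 * α * β) with hB
  have hB0 : 0 < B := div_pos (by linarith) hE2
  set C := (32 + 160 * (d : ℝ)) / κ ^ 4 with hC
  have hC0 : 0 < C := by positivity
  -- The first bound keeps the displaced point inside the range of the Taylor expansion; the second
  -- makes the cubic error at most half of the quadratic gain B τ².
  set τ := min (κ ^ 2 / 4) (B / (2 * C)) with hτ
  have hτ0 : 0 < τ := by positivity
  have hτ1 : 4 * τ ≤ κ ^ 2 := by
    have := min_le_left (κ ^ 2 / 4) (B / (2 * C))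
    linarith
  have hτ2 : C * τ ≤ B / 2 := by
    have := mul_le_mul_of_nonneg_left (min_le_right (κ ^ 2 / 4) (B / (2 * C))) hC0.le
    rw [← hτ] at this
    refine this.trans_eq ?_
    field_simp
  have hα2 : α * (1 - α) ≤ 1 := by nlinarith
  have hβ2 : β * (1 - β) ≤ 1 := by nlinarith
  have hx0 : 0 < α * (1 - α) * τ := by positivity
  have hy0 : 0 < β * (1 - β) * τ := by positivity
  have hxτ : α * (1 - α) * τ ≤ τ := mul_le_of_le_one_left hτ0.le hα2
  have hyτ : β * (1 - β) * τ ≤ τ := mul_le_of_le_one_left hτ0.le hβ2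
  have hz0 : 0 < 2 * τ * q := by positivity
  have hzτ : 2 * τ * q ≤ τ := by nlinarith
  -- This z makes the completed square vanish, so only the term in (X + Y)² contributes to the gain.
  have ht := totalEnt_taylor (d := d) (r := τ) (x := α * (1 - α) * τ) (y := β * (1 - β) * τ)
    (z := -(2 * τ * q)) hκ k1 k2 k3 (by rwa [abs_of_pos hx0]) (by rwa [abs_of_pos hy0])
    (by rwa [abs_neg, abs_of_pos hz0]) hτ1
  rw [ratioQuad_eq hα hβ hD,
    show (α * (1 - α) * τ) ^ 2 / (α ^ 2 * (1 - α) ^ 2) = τ ^ 2 by field_simp,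
    show (β * (1 - β) * τ) ^ 2 / (β ^ 2 * (1 - β) ^ 2) = τ ^ 2 by field_simp,
    show -(2 * τ * q) + quadShift α β τ τ = 0 by rw [quadShift, ← hq]; ring,
    show (-τ ^ 2 - τ ^ 2 + (d : ℝ) * (-(quadCoeff α β * 0 ^ 2)
      - 1 / 2 * (α * β / (1 - α - β)) * (τ - τ) ^ 2
      + 1 / 2 * (α * β / (1 - α - β + 2 * α * β)) * (τ + τ) ^ 2)) / 2 = B * τ ^ 2 by
      rw [hB]; field_simp; ring,
    show (32 + 160 * (d : ℝ)) * τ ^ 3 / κ ^ 4 = C * τ * τ ^ 2 by rw [hC]; ring] at ht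
  have hpos : 0 < totalEnt d α β (α ^ 2 + α * (1 - α) * τ) (β ^ 2 + β * (1 - β) * τ)
      (α * β + -(2 * τ * q)) := by
    have h5 : C * τ * τ ^ 2 ≤ B / 2 * τ ^ 2 := mul_le_mul_of_nonneg_right hτ2 (sq_nonneg _)
    have h6 : 0 < B * τ ^ 2 := by positivity
    have := (abs_le.mp ht).1
    linarith
  have hneg := h (α ^ 2 + α * (1 - α) * τ) (β ^ 2 + β * (1 - β) * τ) (α * β + -(2 * τ * q)) (by
    have mulk : ∀ {p q : ℝ}, κ ≤ p → κ ≤ q → κ ^ 2 ≤ p * q := fun {p q} hp hq => by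
      rw [sq]; exact mul_le_mul hp hq hκ.le (hκ.le.trans hp)
    have m1 := mulk k1 k2
    have m2 := mulk k1 k3
    have m3 := mulk k2 k3
    have m4 := mulk (show κ ≤ 1 - α by linarith) k3
    have m5 := mulk (show κ ≤ 1 - β by linarith) k3
    refine ⟨by positivity, by positivity, by linarith, ?_, ?_, ?_, ?_⟩ <;> nlinarith) (by
    intro heq
    simp only [Prod.mk.injEq] at heq
    linarith [heq.1])
  rw [totalEnt_center hα hβ hD] at hneg
  linarith

theorem isClosed_entRegion : IsClosed {v : ℝ × ℝ × ℝ × ℝ × ℝ |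
    EntRegion v.1 v.2.1 v.2.2.1 v.2.2.2.1 v.2.2.2.2} := by
  simp only [EntRegion, Set.ofPred_and]
  refine IsClosed.inter ?_ (IsClosed.inter ?_ (IsClosed.inter ?_ (IsClosed.inter ?_
    (IsClosed.inter ?_ (IsClosed.inter ?_ ?_))))) <;>
    exact isClosed_le continuous_const (by fun_prop)

theorem continuous_totalEnt (d : ℕ) : Continuous fun v : ℝ × ℝ × ℝ × ℝ × ℝ =>
    totalEnt d v.1 v.2.1 v.2.2.1 v.2.2.2.1 v.2.2.2.2 := by
  unfold totalEnt weightEnt ratioEnt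
  have := continuous_xlogx
  fun_prop

/-- The squared distance of `(γ, δ, s)` to the critical point of `totalEnt`. -/
noncomputable def critDist (α β γ δ s : ℝ) : ℝ :=
  (γ - α ^ 2) ^ 2 + (δ - β ^ 2) ^ 2 + (s - α * β) ^ 2

theorem critDist_le_three {α β γ δ s : ℝ} (hα : 0 ≤ α) (hα1 : α ≤ 1) (hβ : 0 ≤ β) (hβ1 : β ≤ 1)
    (hγ : 0 ≤ γ) (hγ1 : γ ≤ 1) (hδ : 0 ≤ δ) (hδ1 : δ ≤ 1) (hs : 0 ≤ s) (hs1 : s ≤ 1) :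
    critDist α β γ δ s ≤ 3 := by
  have key : ∀ {a b : ℝ}, 0 ≤ a → a ≤ 1 → 0 ≤ b → b ≤ 1 → (a - b) ^ 2 ≤ 1 := by
    intro a b h1 h2 h3 h4
    rw [sq_le_one_iff_abs_le_one, abs_le]
    constructor <;> linarith
  have h1 := key hγ hγ1 (sq_nonneg α) (pow_le_one₀ hα hα1)
  have h2 := key hδ hδ1 (sq_nonneg β) (pow_le_one₀ hβ hβ1)
  have h3 := key hs hs1 (mul_nonneg hα hβ) (mul_le_one₀ hα1 hβ hβ1)
  unfold critDist
  linarith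

set_option maxHeartbeats 400000 in
-- Near the centre the Taylor expansion and the negative definite Hessian give the bound; away from
-- it, compactness does. All constants are uniform because the densities are confined to a smaller
-- closed neighbourhood.
theorem TechnicalCondition.exists_quadratic_bound {d : ℕ} (hd : 2 ≤ d) {lam : ℝ}
    (h : TechnicalCondition d lam) :
    ∃ χ κ c : ℝ, 0 < χ ∧ 0 < κ ∧ 0 < c ∧ ∀ α β : ℝ,
      |α - pMinus d lam| ≤ χ → |β - pPlus d lam| ≤ χ →
      κ ≤ α ∧ κ ≤ β ∧ κ ≤ 1 - α - β ∧ κ ≤ 1 - α - β - ((d : ℝ) - 2) * α * β ∧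
      ∀ γ δ s : ℝ, EntRegion α β γ δ s →
        totalEnt d α β γ δ s ≤ -c * critDist α β γ δ s := by
  obtain ⟨χ, hχ, h⟩ := h.exists_entNegAt
  set p := pMinus d lam
  set q := pPlus d lam
  have hd' : (2 : ℝ) ≤ d := by exact_mod_cast hd
  have nonneg := fun {α β : ℝ} => densities_nonneg (p := p) (q := q) (χ := χ) (α := α) (β := β)
    fun α β hα hβ => (h α β hα hβ).1
  have pos : ∀ {α β : ℝ}, |α - p| ≤ 3 / 4 * χ → |β - q| ≤ 3 / 4 * χ →
      χ / 8 ≤ α ∧ χ / 8 ≤ β ∧ χ / 8 ≤ 1 - α - β := by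
    intro α β hα hβ
    rw [abs_le] at hα hβ
    obtain ⟨h1, h2, -⟩ := nonneg (α := α - χ / 8) (β := β - χ / 8)
      (by rw [abs_lt]; constructor <;> linarith) (by rw [abs_lt]; constructor <;> linarith)
    obtain ⟨-, -, h3⟩ := nonneg (α := α + χ / 8) (β := β + χ / 8)
      (by rw [abs_lt]; constructor <;> linarith) (by rw [abs_lt]; constructor <;> linarith)
    exact ⟨by linarith, by linarith, by linarith⟩
  have bounds : ∀ {α β : ℝ}, |α - p| ≤ χ / 2 → |β - q| ≤ χ / 2 →
      χ / 8 ≤ α ∧ χ / 8 ≤ β ∧ χ / 8 ≤ 1 - α - β ∧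
        χ / 8 ≤ 1 - α - β - ((d : ℝ) - 2) * α * β := by
    intro α β hα hβ
    obtain ⟨h1, h2, h3⟩ := pos (α := α) (β := β) (by linarith) (by linarith)
    refine ⟨h1, h2, h3, ?_⟩
    rw [abs_le] at hα hβ
    -- Semidefiniteness is applied at the enlarged densities. Since 1-α-β-(d-2)αβ decreases in both,
    -- coming back to (α,β) gains a definite margin.
    have a1 : |α + χ / 8 - p| ≤ 3 / 4 * χ := by rw [abs_le]; constructor <;> linarith
    have a2 : |β + χ / 8 - q| ≤ 3 / 4 * χ := by rw [abs_le]; constructor <;> linarith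
    obtain ⟨g1, g2, g3⟩ := pos a1 a2
    have := hessian_nonneg (by linarith) (by linarith) (by linarith)
      (h (α + χ / 8) (β + χ / 8) (by linarith) (by linarith)).2
    have e1 : α * β ≤ (α + χ / 8) * (β + χ / 8) := by nlinarith
    have e2 : ((d : ℝ) - 2) * (α * β) ≤ ((d : ℝ) - 2) * ((α + χ / 8) * (β + χ / 8)) :=
      mul_le_mul_of_nonneg_left e1 (by linarith)
    linarith
  set κ := min (χ / 8) 1 with hκ
  have hκ0 : 0 < κ := by positivity
  have hκ1 : κ ≤ 1 := min_le_right _ _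
  have hκχ : κ ≤ χ / 8 := min_le_left _ _
  set C := (32 + 160 * (d : ℝ)) / κ ^ 4 with hC
  have hC0 : 0 < C := by positivity
  -- The quadratic part contributes at most -κ/12 times the squared distance, and within ρ the cubic
  -- error is at most κ/24 times it, which leaves κ/24.
  set ρ := min (κ ^ 2 / 4) (κ / (24 * C)) with hρ
  have hρ0 : 0 < ρ := by positivity
  have hρ1 : 4 * ρ ≤ κ ^ 2 := by
    have := min_le_left (κ ^ 2 / 4) (κ / (24 * C))
    linarith
  have hρ2 : C * ρ ≤ κ / 24 := by
    have := mul_le_mul_of_nonneg_left (min_le_right (κ ^ 2 / 4) (κ / (24 * C))) hC0.le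
    rw [← hρ] at this
    refine this.trans_eq ?_
    field_simp
  -- near the critical point
  have near : ∀ {α β γ δ s : ℝ}, |α - p| ≤ χ / 2 → |β - q| ≤ χ / 2 →
      critDist α β γ δ s ≤ ρ ^ 2 → totalEnt d α β γ δ s ≤ -(κ / 24) * critDist α β γ δ s := by
    intro α β γ δ s hα hβ hdist
    obtain ⟨h1, h2, h3, h4⟩ := bounds hα hβ
    obtain ⟨x, rfl⟩ : ∃ x, γ = α ^ 2 + x := ⟨γ - α ^ 2, by ring⟩
    obtain ⟨y, rfl⟩ : ∃ y, δ = β ^ 2 + y := ⟨δ - β ^ 2, by ring⟩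
    obtain ⟨z, rfl⟩ : ∃ z, s = α * β + z := ⟨s - α * β, by ring⟩
    have hcd : critDist α β (α ^ 2 + x) (β ^ 2 + y) (α * β + z) = x ^ 2 + y ^ 2 + z ^ 2 := by
      unfold critDist; ring
    rw [hcd] at hdist ⊢
    set r := √(x ^ 2 + y ^ 2 + z ^ 2) with hr
    have hr2 : r ^ 2 = x ^ 2 + y ^ 2 + z ^ 2 := Real.sq_sqrt (by positivity)
    have hr0 : 0 ≤ r := Real.sqrt_nonneg _
    have hrρ : r ≤ ρ := by
      rw [hr, Real.sqrt_le_left hρ0.le]; exact hdist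
    have hx : |x| ≤ r := abs_le_of_sq_le_sq (by rw [hr2]; nlinarith [sq_nonneg y, sq_nonneg z]) hr0
    have hy : |y| ≤ r := abs_le_of_sq_le_sq (by rw [hr2]; nlinarith [sq_nonneg x, sq_nonneg z]) hr0
    have hz : |z| ≤ r := abs_le_of_sq_le_sq (by rw [hr2]; nlinarith [sq_nonneg y, sq_nonneg x]) hr0
    have ht := totalEnt_taylor (d := d) (α := α) (β := β) hκ0 (by linarith) (by linarith) (by linarith) hx hy hz
      (by linarith)
    have hqd := quad_le_neg (d := d) (by omega) hκ0 hκ1 (by linarith : κ ≤ α)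
      (by linarith : κ ≤ β) (by linarith) (by linarith) x y z
    rw [show (32 + 160 * (d : ℝ)) * r ^ 3 / κ ^ 4 = C * r * r ^ 2 by rw [hC]; ring] at ht
    have h5 : C * r * r ^ 2 ≤ κ / 24 * r ^ 2 := by
      apply mul_le_mul_of_nonneg_right _ (sq_nonneg _)
      exact (mul_le_mul_of_nonneg_left hrρ hC0.le).trans hρ2
    rw [← hr2] at hqd ⊢
    have := (abs_le.mp ht).2
    have h6 : 0 ≤ κ * r ^ 2 := by positivity
    linarith
  -- far from the critical point
  set S : Set (ℝ × ℝ × ℝ × ℝ × ℝ) := {v | |v.1 - p| ≤ χ / 2 ∧ |v.2.1 - q| ≤ χ / 2 ∧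
    ρ ^ 2 ≤ critDist v.1 v.2.1 v.2.2.1 v.2.2.2.1 v.2.2.2.2} ∩
    {v | EntRegion v.1 v.2.1 v.2.2.1 v.2.2.2.1 v.2.2.2.2} with hS
  have unit : ∀ v ∈ S, v ∈ Set.Icc (0 : ℝ × ℝ × ℝ × ℝ × ℝ) (1, 1, 1, 1, 1) := by
    rintro ⟨α, β, γ, δ, s⟩ ⟨⟨h1, h2, -⟩, h3, h4, h5, h6, h7, h8, h9⟩
    obtain ⟨b1, b2, b3, -⟩ := bounds h1 h2
    dsimp only at *
    refine ⟨⟨?_, ?_, ?_, ?_, ?_⟩, ⟨?_, ?_, ?_, ?_, ?_⟩⟩ <;>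
      simp only [Prod.fst_zero, Prod.snd_zero] <;> linarith
  -- The densities are coordinates of S as well, so the maximum over S bounds all of them at once.
  have hcomp : IsCompact S := by
    refine IsCompact.of_isClosed_subset (isCompact_Icc (a := (0 : ℝ × ℝ × ℝ × ℝ × ℝ))
      (b := (1, 1, 1, 1, 1))) ?_ unit
    refine IsClosed.inter ?_ isClosed_entRegion
    unfold critDist
    simp only [Set.ofPred_and]
    refine IsClosed.inter ?_ (IsClosed.inter ?_ ?_) <;>
      exact isClosed_le (by fun_prop) (by fun_prop)
  have far : ∃ η : ℝ, 0 < η ∧ ∀ v ∈ S,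
      totalEnt d v.1 v.2.1 v.2.2.1 v.2.2.2.1 v.2.2.2.2 ≤ -η := by
    rcases S.eq_empty_or_nonempty with hemp | hne
    · exact ⟨1, one_pos, fun v hv => by rw [hemp] at hv; exact absurd hv (Set.notMem_empty v)⟩
    obtain ⟨v, hv, hmax⟩ := hcomp.exists_isMaxOn hne (continuous_totalEnt d).continuousOn
    refine ⟨-totalEnt d v.1 v.2.1 v.2.2.1 v.2.2.2.1 v.2.2.2.2, ?_, fun w hw => ?_⟩
    · obtain ⟨⟨h1, h2, h3⟩, h4⟩ := hv
      obtain ⟨b1, b2, b3, -⟩ := bounds h1 h2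
      have := (h v.1 v.2.1 (by linarith) (by linarith)).2 _ _ _ h4 (by
        intro heq
        simp only [Prod.mk.injEq] at heq
        obtain ⟨e1, e2, e3⟩ := heq
        rw [critDist, e1, e2, e3] at h3
        have : 0 < ρ ^ 2 := by positivity
        simp at h3
        linarith)
      rw [totalEnt_center (by linarith) (by linarith) (by linarith)] at this
      linarith
    · rw [neg_neg]; exact hmax hw
  obtain ⟨η, hη, far⟩ := far
  -- The second entry is η/3 because `critDist` never exceeds 3 on the region.
  refine ⟨χ / 2, κ, min (κ / 24) (η / 3), by linarith, hκ0, by positivity,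
    fun α β hα hβ => ?_⟩
  obtain ⟨b1, b2, b3, b4⟩ := bounds hα hβ
  refine ⟨by linarith, by linarith, by linarith, by linarith, fun γ δ s hreg => ?_⟩
  have hc0 : 0 ≤ critDist α β γ δ s := by unfold critDist; positivity
  rcases le_total (critDist α β γ δ s) (ρ ^ 2) with hle | hle
  · have h1 := near hα hβ hle
    have h2 := mul_le_mul_of_nonneg_right (min_le_left (κ / 24) (η / 3)) hc0
    linarith
  · have hmem : ((α, β, γ, δ, s) : ℝ × ℝ × ℝ × ℝ × ℝ) ∈ S := ⟨⟨hα, hβ, hle⟩, hreg⟩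
    have h1 := far _ hmem
    have hu := unit _ hmem
    obtain ⟨⟨u1, u2, u3, u4, u5⟩, ⟨w1, w2, w3, w4, w5⟩⟩ := hu
    dsimp only [Prod.fst_zero, Prod.snd_zero] at *
    have h3 : critDist α β γ δ s ≤ 3 := critDist_le_three u1 w1 u2 w2 u3 w3 u4 w4 u5 w5
    have h2 := mul_le_mul_of_nonneg_right (min_le_right (κ / 24) (η / 3)) hc0
    have h4 := mul_le_mul_of_nonneg_left h3 (by positivity : 0 ≤ η / 3)
    linarith

/-! ## Multiplicative approximation -/

/-- `x` and `y` agree up to a factor between `exp (-ε)` and `exp ε`. -/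
def ExpNear (ε x y : ℝ) : Prop := Real.exp (-ε) * y ≤ x ∧ x ≤ Real.exp ε * y

namespace ExpNear

theorem of_abs_sub_le {ε a b : ℝ} (h : |a - b| ≤ ε) : ExpNear ε (Real.exp a) (Real.exp b) := by
  rw [abs_le] at h
  constructor
  · rw [← Real.exp_add]; exact Real.exp_le_exp.mpr (by linarith)
  · rw [← Real.exp_add]; exact Real.exp_le_exp.mpr (by linarith)

theorem mono {ε ε' x y : ℝ} (h : ExpNear ε x y) (hε : ε ≤ ε') (hy : 0 ≤ y) : ExpNear ε' x y :=
  ⟨(mul_le_mul_of_nonneg_right (Real.exp_le_exp.mpr (by linarith)) hy).trans h.1,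
    h.2.trans (mul_le_mul_of_nonneg_right (Real.exp_le_exp.mpr hε) hy)⟩

theorem nonneg {ε x y : ℝ} (h : ExpNear ε x y) (hy : 0 ≤ y) : 0 ≤ x :=
  (mul_nonneg (Real.exp_pos _).le hy).trans h.1

theorem mul {ε ε' x y x' y' : ℝ} (h : ExpNear ε x y) (h' : ExpNear ε' x' y') (hy : 0 ≤ y)
    (hy' : 0 ≤ y') : ExpNear (ε + ε') (x * x') (y * y') := by
  have hx := h.nonneg hy
  have hx' := h'.nonneg hy'
  constructor
  · rw [show -(ε + ε') = -ε + -ε' by ring, Real.exp_add, mul_mul_mul_comm]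
    exact mul_le_mul h.1 h'.1 (by positivity) hx
  · rw [Real.exp_add, mul_mul_mul_comm]
    exact mul_le_mul h.2 h'.2 hx' (by positivity)

theorem pow {ε x y : ℝ} (h : ExpNear ε x y) (hy : 0 ≤ y) (k : ℕ) :
    ExpNear (k * ε) (x ^ k) (y ^ k) := by
  have hx := h.nonneg hy
  constructor
  · rw [show -(k * ε) = k * -ε by ring, Real.exp_nat_mul, ← mul_pow]
    exact pow_le_pow_left₀ (by positivity) h.1 k
  · rw [Real.exp_nat_mul, ← mul_pow]
    exact pow_le_pow_left₀ hx h.2 k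

theorem trans {ε ε' x y z : ℝ} (h : ExpNear ε x y) (h' : ExpNear ε' y z) :
    ExpNear (ε + ε') x z := by
  constructor
  · rw [show -(ε + ε') = -ε + -ε' by ring, Real.exp_add, mul_assoc]
    exact (mul_le_mul_of_nonneg_left h'.1 (Real.exp_pos _).le).trans h.1
  · rw [Real.exp_add, mul_assoc]
    exact h.2.trans (mul_le_mul_of_nonneg_left h'.2 (Real.exp_pos _).le)

theorem sum {ι : Type*} {s : Finset ι} {ε : ℝ} {f g : ι → ℝ}
    (h : ∀ i ∈ s, ExpNear ε (f i) (g i)) : ExpNear ε (∑ i ∈ s, f i) (∑ i ∈ s, g i) := by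
  constructor
  · rw [Finset.mul_sum]; exact Finset.sum_le_sum fun i hi => (h i hi).1
  · rw [Finset.mul_sum]; exact Finset.sum_le_sum fun i hi => (h i hi).2

theorem const_mul {ε x y c : ℝ} (h : ExpNear ε x y) (hc : 0 ≤ c) : ExpNear ε (c * x) (c * y) := by
  constructor
  · rw [mul_left_comm]; exact mul_le_mul_of_nonneg_left h.1 hc
  · rw [mul_left_comm]; exact mul_le_mul_of_nonneg_left h.2 hc

theorem abs_div_sub_one_le {ε x y : ℝ} (h : ExpNear ε x y) (hy : 0 < y) (hε0 : 0 ≤ ε)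
    (hε : ε ≤ 1) : |x / y - 1| ≤ 2 * ε := by
  have h1 : Real.exp (-ε) ≤ x / y := by rw [le_div_iff₀ hy]; exact h.1
  have h2 : x / y ≤ Real.exp ε := by rw [div_le_iff₀ hy]; exact h.2
  have h3 := Real.add_one_le_exp (-ε)
  have h4 := (abs_le.mp (Real.abs_exp_sub_one_le (x := ε) (by rwa [abs_of_nonneg hε0]))).2
  rw [abs_of_nonneg hε0] at h4
  rw [abs_le]
  constructor <;> linarith

end ExpNear

/-! ## Gaussian sums over the integers -/

open MeasureTheory in
theorem integral_shifted_gaussian (b μ : ℝ) :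
    ∫ t : ℝ, Real.exp (-b * (t - μ) ^ 2) = √(Real.pi / b) := by
  rw [integral_sub_right_eq_self (fun t => Real.exp (-b * t ^ 2)) μ, integral_gaussian]

open MeasureTheory in
theorem integrable_shifted_gaussian {b : ℝ} (hb : 0 < b) (μ : ℝ) :
    Integrable fun t : ℝ => Real.exp (-b * (t - μ) ^ 2) :=
  (integrable_exp_neg_mul_sq hb).comp_sub_right μ

open MeasureTheory in
-- Outside the window half of the exponent supplies the factor exp(-bW²/2), and the other half is a
-- Gaussian whose integral is √2 times the original one.
theorem gaussian_integral_window {b μ W : ℝ} (hb : 0 < b) (hW : 0 ≤ W) :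
    (1 - √2 * Real.exp (-(b / 2 * W ^ 2))) * √(Real.pi / b) ≤
      ∫ t in {t : ℝ | |t - μ| ≤ W}, Real.exp (-b * (t - μ) ^ 2) := by
  set I : Set ℝ := {t : ℝ | |t - μ| ≤ W} with hI
  have hmeas : MeasurableSet I := by
    apply IsClosed.measurableSet
    exact isClosed_le (by fun_prop) continuous_const
  have hint := integrable_shifted_gaussian hb μ
  have hint2 := integrable_shifted_gaussian (half_pos hb) μ
  have hsplit := integral_add_compl hmeas hint
  rw [integral_shifted_gaussian] at hsplit
  have htail : ∫ t in Iᶜ, Real.exp (-b * (t - μ) ^ 2) ≤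
      √2 * Real.exp (-(b / 2 * W ^ 2)) * √(Real.pi / b) := by
    calc ∫ t in Iᶜ, Real.exp (-b * (t - μ) ^ 2)
        ≤ ∫ t in Iᶜ, Real.exp (-(b / 2 * W ^ 2)) * Real.exp (-(b / 2) * (t - μ) ^ 2) := by
          refine setIntegral_mono_on hint.integrableOn (hint2.const_mul _).integrableOn
            hmeas.compl fun t ht => ?_
          rw [← Real.exp_add]
          apply Real.exp_le_exp.mpr
          have ht' : W < |t - μ| := not_le.mp ht
          have : W ^ 2 ≤ (t - μ) ^ 2 := by
            rw [← sq_abs (t - μ)]; exact pow_le_pow_left₀ hW ht'.le 2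
          nlinarith
      _ ≤ ∫ t, Real.exp (-(b / 2 * W ^ 2)) * Real.exp (-(b / 2) * (t - μ) ^ 2) :=
          setIntegral_le_integral (hint2.const_mul _)
            (Filter.Eventually.of_forall fun t => by positivity)
      _ = √2 * Real.exp (-(b / 2 * W ^ 2)) * √(Real.pi / b) := by
          rw [integral_const_mul, integral_shifted_gaussian,
            show Real.pi / (b / 2) = 2 * (Real.pi / b) by field_simp,
            Real.sqrt_mul (by norm_num)]
          ring
  linarith

open MeasureTheory in
-- Each summand is compared with the integral over the cell (k, k+1]: in a window of radius 2n^0.65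
-- the exponent varies by O(n^(-0.35)) over a cell. The cells cover an interval of radius n^0.60 - 1
-- about μ, many standard deviations, so the integral over them is almost complete.
theorem gaussian_sum_near {c₀ c₁ ε : ℝ} (hc₀ : 0 < c₀) (hε : 0 < ε) :
    ∃ N : ℕ, ∀ n : ℕ, N ≤ n → ∀ c μ : ℝ, c₀ ≤ c → c ≤ c₁ → ∀ S : Finset ℕ,
      (∀ k ∈ S, |(k : ℝ) - μ| ≤ 2 * (n : ℝ) ^ (65 / 100 : ℝ)) →
      (n : ℝ) ^ (60 / 100 : ℝ) ≤ μ →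
      (∀ k : ℕ, |(k : ℝ) - μ| ≤ (n : ℝ) ^ (60 / 100 : ℝ) → k ∈ S) →
      ExpNear ε (∑ k ∈ S, Real.exp (-(c * ((k : ℝ) - μ) ^ 2 / n))) (√(Real.pi * n / c)) := by
  set θ := 1 - Real.exp (-(ε / 2)) with hθ
  have hθ0 : 0 < θ := by
    rw [hθ, sub_pos, Real.exp_lt_one_iff]; linarith
  set c₂ := max c₁ 1 with hc₂
  have hc₂0 : 0 < c₂ := lt_of_lt_of_le one_pos (le_max_right _ _)
  -- N₁ controls the variation of the exponent within a cell, N₂ the mass outside the window, and N₃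
  -- makes the window wide enough for W - 1 ≥ W/2.
  obtain ⟨N₁, hN₁⟩ := exists_nat_rpow_neg_le (c := 35 / 100) (by norm_num)
    (ε := ε / (10 * c₂)) (by positivity)
  obtain ⟨N₂, hN₂⟩ := exists_nat_rpow_neg_le (c := 20 / 100) (by norm_num)
    (ε := θ * c₀ / 16) (by positivity)
  obtain ⟨N₃, hN₃⟩ := exists_nat_rpow_neg_le (c := 60 / 100) (by norm_num)
    (ε := 1 / 2) (by norm_num)
  refine ⟨max (max N₁ N₂) (max N₃ 1), fun n hn c μ hc0 hc1 S hS hμ hmem => ?_⟩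
  simp only [max_le_iff] at hn
  obtain ⟨⟨hn1, hn2⟩, hn3, hn4⟩ := hn
  have hnr : (1 : ℝ) ≤ n := by exact_mod_cast hn4
  have hn0 : (0 : ℝ) < n := by linarith
  have hc : 0 < c := by linarith
  have hcc₂ : c ≤ c₂ := hc1.trans (le_max_left _ _)
  set v := (n : ℝ) ^ (65 / 100 : ℝ) with hv
  set W := (n : ℝ) ^ (60 / 100 : ℝ) with hW
  have hv1 : 1 ≤ v := Real.one_le_rpow hnr (by norm_num)
  have hW0 : 0 < W := Real.rpow_pos_of_pos hn0 _
  have hW2 : 2 ≤ W := by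
    have := hN₃ n hn3
    rw [Real.rpow_neg hn0.le, ← hW, inv_le_comm₀ hW0 (by norm_num)] at this
    linarith
  have hvn : 5 * c * v / n ≤ ε / 2 := by
    have h1 := hN₁ n hn1
    have h2 : v / n = (n : ℝ) ^ (-(35 / 100) : ℝ) := by
      rw [hv, ← Real.rpow_sub_one hn0.ne']; norm_num
    rw [mul_div_assoc, h2]
    calc 5 * c * (n : ℝ) ^ (-(35 / 100) : ℝ) ≤ 5 * c₂ * (ε / (10 * c₂)) := by
          gcongr
      _ = ε / 2 := by field_simp; norm_num
  set b := c / n with hb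
  have hb0 : 0 < b := by positivity
  set f : ℝ → ℝ := fun t => Real.exp (-b * (t - μ) ^ 2) with hf
  have hint : Integrable f := integrable_shifted_gaussian hb0 μ
  have htot : ∫ t, f t = √(Real.pi * n / c) := by
    rw [hf, integral_shifted_gaussian]; congr 1; rw [hb]; field_simp
  have hcmp : ∀ k ∈ S, ∀ t ∈ Set.Ioc (k : ℝ) (k + 1), |-b * (t - μ) ^ 2 - -b * (k - μ) ^ 2| ≤
      ε / 2 := by
    intro k hk t ht
    have h1 := hS k hk
    rw [show -b * (t - μ) ^ 2 - -b * (k - μ) ^ 2 = -(b * ((t - k) * ((t - k) + 2 * (k - μ)))) by ring,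
      abs_neg, abs_mul, abs_of_pos hb0, abs_mul]
    have h2 : |t - k| ≤ 1 := by rw [abs_le]; constructor <;> linarith [ht.1, ht.2]
    have h3 : |(t - k) + 2 * (k - μ)| ≤ 5 * v := by
      have := abs_add_le (t - k) (2 * (k - μ))
      rw [abs_mul, abs_two] at this
      linarith
    calc b * (|t - k| * |(t - k) + 2 * (k - μ)|) ≤ b * (1 * (5 * v)) :=
          mul_le_mul_of_nonneg_left (mul_le_mul h2 h3 (abs_nonneg _) zero_le_one) hb0.le
      _ = 5 * c * v / n := by rw [hb]; ring
      _ ≤ ε / 2 := hvn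
  have hvol : ∀ k : ℕ, volume.real (Set.Ioc (k : ℝ) (k + 1)) = 1 := fun k => by
    rw [Real.volume_real_Ioc_of_le (by linarith)]; ring
  have hcell : ∀ k ∈ S, ExpNear (ε / 2) (f k) (∫ t in Set.Ioc (k : ℝ) (k + 1), f t) := by
    intro k hk
    have hfin : volume (Set.Ioc (k : ℝ) (k + 1)) ≠ ⊤ := by simp
    have lo : ∫ t in Set.Ioc (k : ℝ) (k + 1), f t ≤ Real.exp (ε / 2) * f k := by
      calc ∫ t in Set.Ioc (k : ℝ) (k + 1), f t
          ≤ ∫ _ in Set.Ioc (k : ℝ) (k + 1), Real.exp (ε / 2) * f k := by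
            refine setIntegral_mono_on hint.integrableOn (integrableOn_const hfin)
              measurableSet_Ioc fun t ht => ?_
            exact (ExpNear.of_abs_sub_le (hcmp k hk t ht)).2
        _ = Real.exp (ε / 2) * f k := by rw [setIntegral_const, hvol, one_smul]
    have hi : Real.exp (-(ε / 2)) * f k ≤ ∫ t in Set.Ioc (k : ℝ) (k + 1), f t := by
      calc Real.exp (-(ε / 2)) * f k
          = ∫ _ in Set.Ioc (k : ℝ) (k + 1), Real.exp (-(ε / 2)) * f k := by
            rw [setIntegral_const, hvol, one_smul]
        _ ≤ ∫ t in Set.Ioc (k : ℝ) (k + 1), f t := by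
            refine setIntegral_mono_on (integrableOn_const hfin) hint.integrableOn
              measurableSet_Ioc fun t ht => ?_
            exact (ExpNear.of_abs_sub_le (hcmp k hk t ht)).1
    constructor
    · rw [Real.exp_neg, inv_mul_le_iff₀ (Real.exp_pos _)]; exact lo
    · rwa [Real.exp_neg, inv_mul_le_iff₀ (Real.exp_pos _)] at hi
  have hsumcell := ExpNear.sum hcell
  set U : Set ℝ := ⋃ k ∈ S, Set.Ioc (k : ℝ) (k + 1) with hU
  have hUint : ∫ t in U, f t = ∑ k ∈ S, ∫ t in Set.Ioc (k : ℝ) (k + 1), f t := by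
    rw [hU, integral_biUnion_finset]
    · exact fun _ _ => measurableSet_Ioc
    · intro i _ j _ hij
      rw [Function.onFun, Set.disjoint_left]
      intro t ht ht'
      apply hij
      have h1 : (i : ℝ) < j + 1 := ht.1.trans_le ht'.2
      have h2 : (j : ℝ) < i + 1 := ht'.1.trans_le ht.2
      have h3 : i < j + 1 := by exact_mod_cast h1
      have h4 : j < i + 1 := by exact_mod_cast h2
      omega
    · exact fun _ _ => hint.integrableOn
  rw [← hUint] at hsumcell
  have hUle : ∫ t in U, f t ≤ √(Real.pi * n / c) := by
    rw [← htot]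
    exact setIntegral_le_integral hint (Filter.Eventually.of_forall fun t => (Real.exp_pos _).le)
  have hUge : Real.exp (-(ε / 2)) * √(Real.pi * n / c) ≤ ∫ t in U, f t := by
    have hsub : {t : ℝ | |t - μ| ≤ W - 1} ⊆ U := by
      intro t ht
      have ht' := abs_le.mp (show |t - μ| ≤ W - 1 from ht)
      -- Since μ ≥ W, the point t is positive, and ⌈t⌉ - 1, which indexes the cell containing t, is
      -- a natural number.
      have hc1' : 0 < ⌈t⌉ := by
        rw [Int.ceil_pos]; linarith
      obtain ⟨k, hk⟩ : ∃ k : ℕ, (k : ℤ) = ⌈t⌉ - 1 := ⟨(⌈t⌉ - 1).toNat, by omega⟩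
      have hkr : (k : ℝ) = ⌈t⌉ - 1 := by exact_mod_cast congrArg (Int.cast : ℤ → ℝ) hk
      have e1 := Int.le_ceil t
      have e2 := Int.ceil_lt_add_one t
      simp only [hU, Set.mem_iUnion]
      refine ⟨k, hmem k ?_, ?_, ?_⟩
      · rw [hkr, abs_le]; constructor <;> linarith
      · rw [hkr]; linarith
      · rw [hkr]; linarith
    have h1 := gaussian_integral_window (μ := μ) hb0 (show 0 ≤ W - 1 by linarith)
    have h2 : ∫ t in {t : ℝ | |t - μ| ≤ W - 1}, f t ≤ ∫ t in U, f t :=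
      setIntegral_mono_set hint.integrableOn
        (Filter.Eventually.of_forall fun t => (Real.exp_pos _).le) hsub.eventuallyLE
    have h3 : √(Real.pi / b) = √(Real.pi * n / c) := by congr 1; rw [hb]; field_simp
    rw [h3] at h1
    refine le_trans ?_ (h1.trans h2)
    apply mul_le_mul_of_nonneg_right _ (Real.sqrt_nonneg _)
    have h4 : c₀ / 8 * (n : ℝ) ^ (20 / 100 : ℝ) ≤ b / 2 * (W - 1) ^ 2 := by
      have h5 : W ^ 2 = n * (n : ℝ) ^ (20 / 100 : ℝ) := by
        rw [hW, ← Real.rpow_natCast, ← Real.rpow_mul hn0.le, ← Real.rpow_one_add' hn0.le]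
        · norm_num
        · norm_num
      have h6 : W ^ 2 / 4 ≤ (W - 1) ^ 2 := by nlinarith
      calc c₀ / 8 * (n : ℝ) ^ (20 / 100 : ℝ) ≤ c / 8 * (n : ℝ) ^ (20 / 100 : ℝ) := by gcongr
        _ = b / 2 * (W ^ 2 / 4) := by rw [h5, hb]; field_simp; norm_num
        _ ≤ b / 2 * (W - 1) ^ 2 := mul_le_mul_of_nonneg_left h6 (by positivity)
    have h7 : Real.exp (-(b / 2 * (W - 1) ^ 2)) ≤ θ / 2 := by
      set T := (n : ℝ) ^ (20 / 100 : ℝ) with hT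
      have hT0 : 0 < T := Real.rpow_pos_of_pos hn0 _
      have h8 := hN₂ n hn2
      rw [Real.rpow_neg hn0.le, ← hT, inv_le_iff_one_le_mul₀ hT0] at h8
      have h9 : 2 / θ ≤ Real.exp (b / 2 * (W - 1) ^ 2) := by
        have h10 := Real.add_one_le_exp (b / 2 * (W - 1) ^ 2)
        have : 2 / θ ≤ c₀ / 8 * T := by
          rw [div_le_iff₀ hθ0]; linarith
        linarith
      rw [Real.exp_neg, inv_le_comm₀ (Real.exp_pos _) (by positivity)]
      rwa [inv_div]
    have h11 : √2 ≤ 2 := by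
      rw [Real.sqrt_le_left (by norm_num)]; norm_num
    have h12 : √2 * Real.exp (-(b / 2 * (W - 1) ^ 2)) ≤ 2 * (θ / 2) :=
      mul_le_mul h11 h7 (Real.exp_pos _).le (by norm_num)
    have h13 : Real.exp (-(ε / 2)) = 1 - θ := by rw [hθ]; ring
    linarith
  have hfs : ∀ k : ℕ, Real.exp (-(c * ((k : ℝ) - μ) ^ 2 / n)) = f k := by
    intro k; rw [hf, hb]; congr 1; ring
  simp_rw [hfs]
  have hU2 : ExpNear (ε / 2) (∫ t in U, f t) √(Real.pi * n / c) :=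
    ⟨hUge, hUle.trans (le_mul_of_one_le_left (Real.sqrt_nonneg _)
      (Real.one_le_exp (by linarith)))⟩
  have := hsumcell.trans hU2
  rwa [add_halves] at this

/-! ## Overlap weights and terms through factorials -/

theorem log_choose {n k : ℕ} (h : k ≤ n) : Real.log (n.choose k : ℝ) =
    Real.log (n.factorial : ℝ) - Real.log (k.factorial : ℝ) -
      Real.log ((n - k).factorial : ℝ) := by
  have h1 : (n.factorial : ℝ) ≠ 0 := by exact_mod_cast n.factorial_ne_zero
  have h2 : (k.factorial : ℝ) ≠ 0 := by exact_mod_cast k.factorial_ne_zero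
  have h3 : ((n - k).factorial : ℝ) ≠ 0 := by exact_mod_cast (n - k).factorial_ne_zero
  rw [Nat.cast_choose ℝ h, Real.log_div h1 (mul_ne_zero h2 h3), Real.log_mul h2 h3]
  ring

theorem choose_ne_zero_real {n k : ℕ} (h : k ≤ n) : (n.choose k : ℝ) ≠ 0 := by
  exact_mod_cast (Nat.choose_pos h).ne'

theorem overlapWeight_nonneg (n a g : ℕ) : 0 ≤ overlapWeight n a g := by
  unfold overlapWeight; positivity

theorem avoidRate_nonneg (N a b : ℕ) : 0 ≤ avoidRate N a b := by
  unfold avoidRate; positivity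

theorem overlapTerm_nonneg (N a b g h s : ℕ) : 0 ≤ overlapTerm N a b g h s := by
  have := avoidRate_nonneg N a b
  unfold overlapTerm; positivity

/-- The parameters are the cells of two sets of equal size: g points in both, i in each one alone, j
in neither. All differences become sums, which avoids truncated subtraction. -/
theorem overlapWeight_eq_exp (g i j : ℕ) :
    overlapWeight (g + i + (i + j)) (g + i) g =
      Real.exp (2 * Real.log ((g + i).factorial : ℝ) + 2 * Real.log ((i + j).factorial : ℝ)
        - Real.log ((g + i + (i + j)).factorial : ℝ) - Real.log (g.factorial : ℝ)
        - 2 * Real.log (i.factorial : ℝ) - Real.log (j.factorial : ℝ)) := by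
  have e1 : g + i + (i + j) - (g + i) = i + j := by omega
  have e2 : g + i - g = i := by omega
  have e3 : i + j - i = j := by omega
  have c1 : ((g + i).choose g : ℝ) ≠ 0 := choose_ne_zero_real (by omega)
  have c2 : ((i + j).choose i : ℝ) ≠ 0 := choose_ne_zero_real (by omega)
  have c3 : ((g + i + (i + j)).choose (g + i) : ℝ) ≠ 0 := choose_ne_zero_real (by omega)
  unfold overlapWeight
  rw [e1, e2]
  have hpos : (0 : ℝ) < ((g + i).choose g * (i + j).choose i : ℝ) /
      ((g + i + (i + j)).choose (g + i) : ℝ) := by positivity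
  rw [← Real.exp_log hpos, Real.log_div (mul_ne_zero c1 c2) c3, Real.log_mul c1 c2,
    log_choose (show g ≤ g + i by omega), log_choose (show i ≤ i + j by omega),
    log_choose (show g + i ≤ g + i + (i + j) by omega), e1, e2, e3]
  congr 1
  ring

/-- In the notation of `sum_avoid_pairs`, i points of C lie outside A ∪ B and j points lie outside
A, B and C, while k points of B lie in neither C nor T and l points lie outside B, C and T. Counting
the points outside A ∪ B in two ways gives i + j = k + l. -/
theorem overlapTerm_eq_exp {g h s i j k l : ℕ} (hij : i + j = k + l) :
    overlapTerm (g + s + i + (h + s + k) + (i + j)) (g + s + i) (h + s + k) g h s =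
      Real.exp (2 * Real.log ((i + j).factorial : ℝ)
        + Real.log ((g + s + i + (h + s + k) + (i + j)).factorial : ℝ)
        - 2 * Real.log ((h + s + k + (i + j)).factorial : ℝ)
        - 2 * Real.log ((g + s + i + (i + j)).factorial : ℝ)
        + Real.log ((s + i).factorial : ℝ) + Real.log ((h + k + j).factorial : ℝ)
        + Real.log ((s + k).factorial : ℝ) + Real.log ((g + i + l).factorial : ℝ)
        + Real.log ((i + j + s).factorial : ℝ) - Real.log (s.factorial : ℝ)
        - Real.log (i.factorial : ℝ) - Real.log (j.factorial : ℝ) - Real.log (k.factorial : ℝ)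
        - Real.log (l.factorial : ℝ)) := by
  set N := g + s + i + (h + s + k) + (i + j) with hN
  set a := g + s + i with ha
  set b := h + s + k with hb
  have c1 : (b.choose s : ℝ) ≠ 0 := choose_ne_zero_real (by omega)
  have c2 : ((i + j).choose i : ℝ) ≠ 0 := choose_ne_zero_real (by omega)
  have c3 : ((h + k).choose h : ℝ) ≠ 0 := choose_ne_zero_real (by omega)
  have c4 : ((i + j + s).choose (s + k) : ℝ) ≠ 0 := choose_ne_zero_real (by omega)
  have c5 : ((b + (i + j)).choose (s + i) : ℝ) ≠ 0 := choose_ne_zero_real (by omega)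
  have c6 : (b.choose h : ℝ) ≠ 0 := choose_ne_zero_real (by omega)
  have c7 : ((a + (i + j)).choose (s + k) : ℝ) ≠ 0 := choose_ne_zero_real (by omega)
  have c8 : ((a + (i + j)).choose a : ℝ) ≠ 0 := choose_ne_zero_real (by omega)
  have c9 : (N.choose a : ℝ) ≠ 0 := choose_ne_zero_real (by omega)
  unfold overlapTerm avoidRate
  rw [show N - a - b = i + j by omega, show a - g - s = i by omega, show b - s = h + k by omega,
    show b - h = s + k by omega, show N - a = b + (i + j) by omega, show a - g = s + i by omega,
    show N - b = a + (i + j) by omega]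
  have hpos : (0 : ℝ) < (b.choose s * (i + j).choose i *
      ((h + k).choose h * (i + j + s).choose (s + k)) : ℝ) /
      ((b + (i + j)).choose (s + i) * (b.choose h * (a + (i + j)).choose (s + k))) /
      ((a + (i + j)).choose a / N.choose a) := by positivity
  rw [← Real.exp_log hpos, Real.log_div (by positivity) (div_ne_zero c8 c9), Real.log_div c8 c9,
    Real.log_div (by positivity) (by positivity), Real.log_mul (by positivity) (by positivity),
    Real.log_mul c1 c2, Real.log_mul c3 c4, Real.log_mul c5 (by positivity), Real.log_mul c6 c7,
    log_choose (show s ≤ b by omega), log_choose (show i ≤ i + j by omega),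
    log_choose (show h ≤ h + k by omega), log_choose (show s + k ≤ i + j + s by omega),
    log_choose (show s + i ≤ b + (i + j) by omega), log_choose (show h ≤ b by omega),
    log_choose (show s + k ≤ a + (i + j) by omega), log_choose (show a ≤ a + (i + j) by omega),
    log_choose (show a ≤ N by omega),
    show i + j - i = j by omega, show b - s = h + k by omega, show h + k - h = k by omega,
    show i + j + s - (s + k) = l by omega, show b + (i + j) - (s + i) = h + k + j by omega,
    show b - h = s + k by omega, show a + (i + j) - (s + k) = g + i + l by omega,
    show a + (i + j) - a = i + j by omega, show N - a = b + (i + j) by omega]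
  congr 1
  ring

theorem exists_of_overlapWeight_ne_zero {n a g : ℕ} (hg : g ≤ a) (ha : a ≤ n)
    (h : overlapWeight n a g ≠ 0) : ∃ i j, a = g + i ∧ n = g + i + (i + j) := by
  have h1 : (n - a).choose (a - g) ≠ 0 := by
    intro h0
    apply h
    unfold overlapWeight
    rw [h0]; simp
  have h2 : a - g ≤ n - a := by
    by_contra hlt
    exact h1 (Nat.choose_eq_zero_of_lt (by omega))
  exact ⟨a - g, n - a - (a - g), by omega, by omega⟩

/-- A nonzero binomial coefficient says that its lower entry is at most its upper one, so all
truncated differences are genuine and the contingency table exists. -/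
theorem exists_of_overlapTerm_ne_zero {N a b g h s : ℕ} (hab : a + b ≤ N) (hs : s ≤ a - g)
    (hg : g ≤ a) (ht : overlapTerm N a b g h s ≠ 0) :
    ∃ i j k l, i + j = k + l ∧ a = g + s + i ∧ b = h + s + k ∧
      N = g + s + i + (h + s + k) + (i + j) := by
  have key : b.choose s ≠ 0 ∧ (N - a - b).choose (a - g - s) ≠ 0 ∧ (b - s).choose h ≠ 0 ∧
      (N - a - b + s).choose (b - h) ≠ 0 := by
    refine ⟨?_, ?_, ?_, ?_⟩ <;> intro h0 <;> apply ht <;> unfold overlapTerm <;> rw [h0] <;> simp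
  have le_of : ∀ {x y : ℕ}, x.choose y ≠ 0 → y ≤ x := fun {x y} hx => by
    by_contra hlt
    exact hx (Nat.choose_eq_zero_of_lt (by omega))
  obtain ⟨k1, k2, k3, k4⟩ := key
  have k1 := le_of k1
  have k2 := le_of k2
  have k3 := le_of k3
  have k4 := le_of k4
  exact ⟨a - g - s, N - a - b - (a - g - s), b - s - h, N - a - b + s - (b - h), by omega,
    by omega, by omega, by omega⟩

/-! ## Exponential bounds -/

theorem mul_xlogx_div {N : ℝ} (hN : 0 < N) (k : ℕ) :
    N * xlogx (k / N) = (k * Real.log k - k) + k * (1 - Real.log N) := by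
  unfold xlogx
  rcases Nat.eq_zero_or_pos k with rfl | hk
  · simp
  have hk0 : (0 : ℝ) < k := by exact_mod_cast hk
  rw [Real.log_div hk0.ne' hN.ne']
  field_simp
  ring

theorem abs_log_factorial_sub_le' {k N : ℕ} (h : k ≤ N) :
    |Real.log (k.factorial : ℝ) - (k * Real.log k - k)| ≤ 1 + Real.log (N + 1) := by
  refine (abs_log_factorial_sub_le k).trans ?_
  have : (k : ℝ) ≤ N := by exact_mod_cast h
  have := Real.log_le_log (show (0 : ℝ) < k + 1 by positivity) (by linarith : (k : ℝ) + 1 ≤ N + 1)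
  linarith

/-- The 9 counts the factorials with multiplicity, each costing one crude Stirling error. The parts
linear in the cells cancel because the cells add up to n. -/
theorem overlapWeight_le_exp {n a g : ℕ} (hn : 0 < n) (hg : g ≤ a) (ha : a ≤ n) :
    overlapWeight n a g ≤
      Real.exp (n * weightEnt (a / n) (g / n) + 9 * (1 + Real.log (n + 1))) := by
  by_cases h0 : overlapWeight n a g = 0
  · rw [h0]; exact (Real.exp_pos _).le
  obtain ⟨i, j, rfl, rfl⟩ := exists_of_overlapWeight_ne_zero hg ha h0
  rw [overlapWeight_eq_exp]
  apply Real.exp_le_exp.mpr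
  set n := g + i + (i + j) with hnn
  have hn0 : (0 : ℝ) < n := by exact_mod_cast hn
  have hnr : (n : ℝ) = g + i + (i + j) := by rw [hnn]; push_cast; ring
  unfold weightEnt
  rw [show (1 : ℝ) - ((g + i : ℕ) : ℝ) / n = ((i + j : ℕ) : ℝ) / n by
      field_simp; rw [hnr]; push_cast; ring,
    show ((g + i : ℕ) : ℝ) / n - (g : ℝ) / n = (i : ℝ) / n by push_cast; ring,
    show (1 : ℝ) - 2 * (((g + i : ℕ) : ℝ) / n) + (g : ℝ) / n = (j : ℝ) / n by
      field_simp; rw [hnr]; push_cast; ring]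
  have e1 := mul_xlogx_div hn0 (g + i)
  have e2 := mul_xlogx_div hn0 (i + j)
  have e3 := mul_xlogx_div hn0 g
  have e4 := mul_xlogx_div hn0 i
  have e5 := mul_xlogx_div hn0 j
  have b1 := abs_le.mp (abs_log_factorial_sub_le' (show g + i ≤ n by omega))
  have b2 := abs_le.mp (abs_log_factorial_sub_le' (show i + j ≤ n by omega))
  have b3 := abs_le.mp (abs_log_factorial_sub_le' (show g ≤ n by omega))
  have b4 := abs_le.mp (abs_log_factorial_sub_le' (show i ≤ n by omega))
  have b5 := abs_le.mp (abs_log_factorial_sub_le' (show j ≤ n by omega))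
  have b6 := abs_le.mp (abs_log_factorial_sub_le' (le_refl n))
  have lin : 2 * ((g + i : ℕ) * (1 - Real.log n)) + 2 * ((i + j : ℕ) * (1 - Real.log n))
      - g * (1 - Real.log n) - 2 * (i * (1 - Real.log n)) - j * (1 - Real.log n)
      = n * (1 - Real.log n) := by
    rw [hnr]; push_cast; ring
  have expand : ∀ A B C D E : ℝ, (n : ℝ) * (2 * A + 2 * B - C - 2 * D - E) =
      2 * (n * A) + 2 * (n * B) - n * C - 2 * (n * D) - n * E := fun A B C D E => by ring
  rw [expand, e1, e2, e3, e4, e5]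
  linarith

/-- Here 17 factorials occur, counted with multiplicity. A term that does not vanish also has all
its cells nonnegative, so its densities lie in the region where the technical condition speaks. -/
theorem overlapTerm_le_exp {N a b g h s : ℕ} (hN : 0 < N) (hab : a + b ≤ N) (hs : s ≤ a - g)
    (hg : g ≤ a) (ht : overlapTerm N a b g h s ≠ 0) :
    EntRegion (a / N) (b / N) (g / N) (h / N) (s / N) ∧
    overlapTerm N a b g h s ≤
      Real.exp (N * ratioEnt (a / N) (b / N) (g / N) (h / N) (s / N)
        + 17 * (1 + Real.log (N + 1))) := by
  obtain ⟨i, j, k, l, hij, rfl, rfl, rfl⟩ := exists_of_overlapTerm_ne_zero hab hs hg ht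
  rw [overlapTerm_eq_exp hij]
  set N := g + s + i + (h + s + k) + (i + j) with hNN
  have hN0 : (0 : ℝ) < N := by exact_mod_cast hN
  have hNr : (N : ℝ) = g + s + i + (h + s + k) + (i + j) := by rw [hNN]; push_cast; ring
  have hijr : (i : ℝ) + j = k + l := by exact_mod_cast hij
  have a1 : (1 : ℝ) - ((g + s + i : ℕ) : ℝ) / N - ((h + s + k : ℕ) : ℝ) / N =
      ((i + j : ℕ) : ℝ) / N := by
    field_simp; rw [hNr]; push_cast; ring
  have a2 : (1 : ℝ) - ((g + s + i : ℕ) : ℝ) / N = ((h + s + k + (i + j) : ℕ) : ℝ) / N := by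
    field_simp; rw [hNr]; push_cast; ring
  have a3 : (1 : ℝ) - ((h + s + k : ℕ) : ℝ) / N = ((g + s + i + (i + j) : ℕ) : ℝ) / N := by
    field_simp; rw [hNr]; push_cast; ring
  have a4 : ((g + s + i : ℕ) : ℝ) / N - (g : ℝ) / N = ((s + i : ℕ) : ℝ) / N := by
    push_cast; ring
  have a5 : (1 : ℝ) - 2 * (((g + s + i : ℕ) : ℝ) / N) + (g : ℝ) / N =
      ((h + k + j : ℕ) : ℝ) / N := by
    field_simp; rw [hNr]; push_cast; ring
  have a6 : ((h + s + k : ℕ) : ℝ) / N - (h : ℝ) / N = ((s + k : ℕ) : ℝ) / N := by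
    push_cast; ring
  have a7 : (1 : ℝ) - 2 * (((h + s + k : ℕ) : ℝ) / N) + (h : ℝ) / N =
      ((g + i + l : ℕ) : ℝ) / N := by
    field_simp; rw [hNr]; push_cast; linarith
  have a8 : (1 : ℝ) - ((g + s + i : ℕ) : ℝ) / N - ((h + s + k : ℕ) : ℝ) / N + (s : ℝ) / N =
      ((i + j + s : ℕ) : ℝ) / N := by
    rw [a1]; push_cast; ring
  have a9 : ((g + s + i : ℕ) : ℝ) / N - (g : ℝ) / N - (s : ℝ) / N = (i : ℝ) / N := by
    push_cast; ring
  have a10 : (1 : ℝ) - 2 * (((g + s + i : ℕ) : ℝ) / N) - ((h + s + k : ℕ) : ℝ) / N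
      + (g : ℝ) / N + (s : ℝ) / N = (j : ℝ) / N := by
    field_simp; rw [hNr]; push_cast; ring
  have a11 : ((h + s + k : ℕ) : ℝ) / N - (h : ℝ) / N - (s : ℝ) / N = (k : ℝ) / N := by
    push_cast; ring
  have a12 : (1 : ℝ) - ((g + s + i : ℕ) : ℝ) / N - 2 * (((h + s + k : ℕ) : ℝ) / N)
      + (h : ℝ) / N + (s : ℝ) / N = (l : ℝ) / N := by
    field_simp; rw [hNr]; push_cast; linarith
  constructor
  · refine ⟨by positivity, by positivity, by positivity, ?_, ?_, ?_, ?_⟩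
    · rw [a9]; positivity
    · rw [a11]; positivity
    · rw [a12]; positivity
    · rw [a10]; positivity
  apply Real.exp_le_exp.mpr
  unfold ratioEnt
  rw [a10, a12, a8, a1, a5, a7, a2, a3, a9, a4, a11, a6]
  have e1 := mul_xlogx_div hN0 (i + j)
  have e2 := mul_xlogx_div hN0 (h + s + k + (i + j))
  have e3 := mul_xlogx_div hN0 (g + s + i + (i + j))
  have e4 := mul_xlogx_div hN0 (s + i)
  have e5 := mul_xlogx_div hN0 (h + k + j)
  have e6 := mul_xlogx_div hN0 (s + k)
  have e7 := mul_xlogx_div hN0 (g + i + l)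
  have e8 := mul_xlogx_div hN0 (i + j + s)
  have e9 := mul_xlogx_div hN0 s
  have e10 := mul_xlogx_div hN0 i
  have e11 := mul_xlogx_div hN0 j
  have e12 := mul_xlogx_div hN0 k
  have e13 := mul_xlogx_div hN0 l
  have b0 := abs_le.mp (abs_log_factorial_sub_le' (le_refl N))
  have b1 := abs_le.mp (abs_log_factorial_sub_le' (show i + j ≤ N by omega))
  have b2 := abs_le.mp (abs_log_factorial_sub_le' (show h + s + k + (i + j) ≤ N by omega))
  have b3 := abs_le.mp (abs_log_factorial_sub_le' (show g + s + i + (i + j) ≤ N by omega))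
  have b4 := abs_le.mp (abs_log_factorial_sub_le' (show s + i ≤ N by omega))
  have b5 := abs_le.mp (abs_log_factorial_sub_le' (show h + k + j ≤ N by omega))
  have b6 := abs_le.mp (abs_log_factorial_sub_le' (show s + k ≤ N by omega))
  have b7 := abs_le.mp (abs_log_factorial_sub_le' (show g + i + l ≤ N by omega))
  have b8 := abs_le.mp (abs_log_factorial_sub_le' (show i + j + s ≤ N by omega))
  have b9 := abs_le.mp (abs_log_factorial_sub_le' (show s ≤ N by omega))
  have b10 := abs_le.mp (abs_log_factorial_sub_le' (show i ≤ N by omega))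
  have b11 := abs_le.mp (abs_log_factorial_sub_le' (show j ≤ N by omega))
  have b12 := abs_le.mp (abs_log_factorial_sub_le' (show k ≤ N by omega))
  have b13 := abs_le.mp (abs_log_factorial_sub_le' (show l ≤ N by omega))
  have lin : 2 * ((i + j : ℕ) * (1 - Real.log N)) - 2 * ((h + s + k + (i + j) : ℕ) *
      (1 - Real.log N)) - 2 * ((g + s + i + (i + j) : ℕ) * (1 - Real.log N))
      + (s + i : ℕ) * (1 - Real.log N) + (h + k + j : ℕ) * (1 - Real.log N)
      + (s + k : ℕ) * (1 - Real.log N) + (g + i + l : ℕ) * (1 - Real.log N)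
      + (i + j + s : ℕ) * (1 - Real.log N) - s * (1 - Real.log N) - i * (1 - Real.log N)
      - j * (1 - Real.log N) - k * (1 - Real.log N) - l * (1 - Real.log N)
      = -(N * (1 - Real.log N)) := by
    rw [hNr]; push_cast; ring
  have expand : ∀ A B C D E F G H I J K L M : ℝ,
      (N : ℝ) * (2 * A - 2 * B - 2 * C + D + E + F + G + H - I - J - K - L - M) =
      2 * (N * A) - 2 * (N * B) - 2 * (N * C) + N * D + N * E + N * F + N * G + N * H - N * I
        - N * J - N * K - N * L - N * M := fun A B C D E F G H I J K L M => by ring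
  rw [expand, e1, e2, e3, e4, e5, e6, e7, e8, e9, e10, e11, e12, e13]
  linarith

/-! ## Local asymptotics of the overlap weights and terms -/

/-- Isolates the dependence on n. In a balanced combination of cells the multiples of log n coming
from sizes, deviations and perturbations cancel. -/
theorem stirlingExp_scale {n κ : ℝ} (hn : 0 < n) (hκ : 0 < κ) (u e : ℝ) :
    stirlingExp (n * κ) u e = n * xlogxTaylor κ (u / n) + (n * κ + u) * (Real.log n - 1)
      + e * (Real.log n + Real.log κ) + 1 / 2 * Real.log κ
      + 1 / 2 * Real.log (2 * Real.pi * n) := by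
  unfold stirlingExp xlogxTaylor xlogx
  rw [Real.log_mul hn.ne' hκ.ne', show 2 * Real.pi * (n * κ) = 2 * Real.pi * n * κ by ring,
    Real.log_mul (by positivity) hκ.ne']
  field_simp
  ring

theorem xlogxTaylor_zero (κ : ℝ) : xlogxTaylor κ 0 = xlogx κ := by
  unfold xlogxTaylor; ring

theorem weight_stirling {α n : ℝ} (hα : 0 < α) (hα1 : 0 < 1 - α) (hn : 0 < n) (x : ℝ) :
    2 * stirlingExp (n * α) 0 0 + 2 * stirlingExp (n * (1 - α)) 0 0 - stirlingExp (n * 1) 0 0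
      - stirlingExp (n * α ^ 2) x 0 - 2 * stirlingExp (n * (α * (1 - α))) (-x) 0
      - stirlingExp (n * (1 - α) ^ 2) x 0 =
      -(1 / 2) * Real.log (2 * Real.pi * n * (α * (1 - α)) ^ 2)
        - x ^ 2 / (2 * n * (α * (1 - α)) ^ 2) := by
  rw [stirlingExp_scale hn hα, stirlingExp_scale hn hα1, stirlingExp_scale hn one_pos,
    stirlingExp_scale hn (by positivity), stirlingExp_scale hn (by positivity),
    stirlingExp_scale hn (by positivity)]
  have h := weightTaylor_eq hα hα1 (x / n)
  simp only [zero_div, xlogxTaylor_zero, neg_div] at *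
  rw [Real.log_mul (x := 2 * Real.pi * n) (y := (α * (1 - α)) ^ 2) (by positivity)
    (by positivity), Real.log_pow, Real.log_pow, Real.log_pow, Real.log_mul hα.ne' hα1.ne',
    Real.log_one]
  have h1 : xlogx 1 = 0 := by simp [xlogx]
  have h2 : x ^ 2 / (2 * n * (α * (1 - α)) ^ 2) =
      n * ((x / n) ^ 2 / (α ^ 2 * (1 - α) ^ 2)) / 2 := by
    field_simp
  rw [h1, h2]
  push_cast
  linear_combination n * h

/-- The right side is free of m, p and q: their first-order contributions, multiplied by the
logarithms of the factored cells, add up to zero. This is why the boundary does not change the limit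
of `overlapRatio`. -/
theorem term_stirling {α β n : ℝ} (hα : 0 < α) (hβ : 0 < β) (hD : 0 < 1 - α - β) (hn : 0 < n)
    (x y z m p q : ℝ) :
    2 * stirlingExp (n * (1 - α - β)) 0 (m - p - q) + stirlingExp (n * 1) 0 m
      - 2 * stirlingExp (n * (1 - α)) 0 (m - p) - 2 * stirlingExp (n * (1 - β)) 0 (m - q)
      + stirlingExp (n * (α * (1 - α))) (-x) 0 + stirlingExp (n * (1 - α) ^ 2) x (m - p)
      + stirlingExp (n * (β * (1 - β))) (-y) 0 + stirlingExp (n * (1 - β) ^ 2) y (m - q)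
      + stirlingExp (n * ((1 - α) * (1 - β))) z (m - p - q) - stirlingExp (n * (α * β)) z 0
      - stirlingExp (n * (α * (1 - α - β))) (-x - z) 0
      - stirlingExp (n * ((1 - α) * (1 - α - β))) (x + z) (m - p - q)
      - stirlingExp (n * (β * (1 - α - β))) (-y - z) 0
      - stirlingExp (n * ((1 - β) * (1 - α - β))) (y + z) (m - p - q) =
      1 / 2 * Real.log ((1 - α) * (1 - β) / (2 * Real.pi * n * (α * β * (1 - α - β) ^ 2)))
        + ratioQuad α β x y z / (2 * n) := by
  have h1 : 0 < 1 - α := by linarith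
  have h2 : 0 < 1 - β := by linarith
  rw [stirlingExp_scale hn hD, stirlingExp_scale hn one_pos, stirlingExp_scale hn h1,
    stirlingExp_scale hn h2, stirlingExp_scale hn (mul_pos hα h1),
    stirlingExp_scale hn (pow_pos h1 2), stirlingExp_scale hn (mul_pos hβ h2),
    stirlingExp_scale hn (pow_pos h2 2), stirlingExp_scale hn (mul_pos h1 h2),
    stirlingExp_scale hn (mul_pos hα hβ), stirlingExp_scale hn (mul_pos hα hD),
    stirlingExp_scale hn (mul_pos h1 hD), stirlingExp_scale hn (mul_pos hβ hD),
    stirlingExp_scale hn (mul_pos h2 hD)]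
  have h := ratioTaylor_eq hα hβ hD (x / n) (y / n) (z / n)
  have hquad : ratioQuad α β x y z / (2 * n) = n * (ratioQuad α β (x / n) (y / n) (z / n) / 2) := by
    unfold ratioQuad
    field_simp
  have hx1 : xlogx 1 = 0 := by simp [xlogx]
  rw [hquad, ← h]
  simp only [zero_div, xlogxTaylor_zero, neg_div, sub_div, add_div, hx1, Real.log_one]
  rw [Real.log_div (by positivity) (by positivity), Real.log_mul (x := 2 * Real.pi * n)
    (by positivity) (by positivity), Real.log_mul (x := α * β) (by positivity) (by positivity),
    Real.log_pow, Real.log_pow, Real.log_pow, Real.log_mul hα.ne' h1.ne',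
    Real.log_mul hβ.ne' h2.ne', Real.log_mul h1.ne' h2.ne', Real.log_mul hα.ne' hβ.ne',
    Real.log_mul hα.ne' hD.ne', Real.log_mul h1.ne' hD.ne', Real.log_mul hβ.ne' hD.ne',
    Real.log_mul h2.ne' hD.ne']
  push_cast
  ring

theorem overlapWeight_near {κ ε : ℝ} (hκ : 0 < κ) (hε : 0 < ε) :
    ∃ N : ℕ, ∀ n : ℕ, N ≤ n → ∀ (α x : ℝ) (a g : ℕ), (a : ℝ) = α * n → κ ≤ α → κ ≤ 1 - α →
      (g : ℝ) = α ^ 2 * n + x → |x| ≤ (n : ℝ) ^ (65 / 100 : ℝ) →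
      ExpNear ε (overlapWeight n a g)
        (Real.exp (-(1 / 2) * Real.log (2 * Real.pi * n * (α * (1 - α)) ^ 2)
          - x ^ 2 / (2 * n * (α * (1 - α)) ^ 2))) := by
  obtain ⟨N₁, hN₁⟩ := log_factorial_near (κ := κ ^ 2) (ε := ε / 9) (by positivity) (by positivity)
  obtain ⟨N₂, hN₂⟩ := exists_nat_rpow_neg_le (c := 35 / 100) (by norm_num)
    (ε := κ ^ 2 / 2) (by positivity)
  refine ⟨max N₁ (max N₂ 1), fun n hn α x a g ha hα hα1 hg hx => ?_⟩
  simp only [max_le_iff] at hn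
  obtain ⟨hn1, hn2, hn3⟩ := hn
  have hnr : (1 : ℝ) ≤ n := by exact_mod_cast hn3
  have hn0 : (0 : ℝ) < n := by linarith
  have hα0 : 0 < α := by linarith
  have h10 : 0 < 1 - α := by linarith
  have hκ1 : κ ≤ 1 := by linarith
  have F := hN₁ n hn1
  set v := (n : ℝ) ^ (65 / 100 : ℝ) with hv
  have hv0 : 0 ≤ v := by positivity
  have hq0 : (0 : ℝ) ≤ (n : ℝ) ^ (1 / 4 : ℝ) := by positivity
  have hvn : v ≤ κ ^ 2 / 2 * n := by
    have := hN₂ n hn2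
    have h2 : v / n = (n : ℝ) ^ (-(35 / 100) : ℝ) := by
      rw [hv, ← Real.rpow_sub_one hn0.ne']; norm_num
    rw [← h2, div_le_iff₀ hn0] at this
    exact this
  have mulk : ∀ {p q : ℝ}, κ ≤ p → κ ≤ q → κ ^ 2 * n ≤ n * (p * q) := fun {p q} hp hq => by
    rw [mul_comm (n : ℝ)]
    apply mul_le_mul_of_nonneg_right _ hn0.le
    rw [sq]; exact mul_le_mul hp hq hκ.le (hκ.le.trans hp)
  have onek : ∀ {p : ℝ}, κ ≤ p → κ ^ 2 * n ≤ n * p := fun {p} hp => by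
    have := mulk hp hκ1
    rwa [mul_one] at this
  have hx2 := abs_le.mp hx
  have hgap : g ≤ a := by
    have : (g : ℝ) ≤ a := by
      rw [hg, ha]
      have := mulk hα hα1
      nlinarith
    exact_mod_cast this
  obtain ⟨i, rfl⟩ : ∃ i, a = g + i := ⟨a - g, by omega⟩
  have hnap : g + i + i ≤ n := by
    have : ((g + i : ℕ) : ℝ) + i ≤ n := by
      have := mulk hα1 hα1
      push_cast at ha ⊢
      nlinarith
    exact_mod_cast this
  obtain ⟨j, rfl⟩ : ∃ j, n = g + i + (i + j) := ⟨n - (g + i + i), by omega⟩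
  rw [overlapWeight_eq_exp]
  set n := g + i + (i + j) with hnn
  have hnr2 : (n : ℝ) = g + i + (i + j) := by rw [hnn]; push_cast; ring
  have ha' : (g : ℝ) + i = α * n := by rw [← ha]; push_cast; ring
  apply ExpNear.of_abs_sub_le
  rw [← weight_stirling hα0 h10 hn0]
  have hzero : |(0 : ℝ)| ≤ 2 * v := by rw [abs_zero]; positivity
  have hzero' : |(0 : ℝ)| ≤ 5 * (n : ℝ) ^ (1 / 4 : ℝ) := by rw [abs_zero]; positivity
  have hxv : |x| ≤ 2 * v := by linarith
  have hxv' : |(-x)| ≤ 2 * v := by rw [abs_neg]; exact hxv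
  have b1 := abs_le.mp (F (n * α) 0 0 (g + i) (onek hα) (by push_cast; linarith) hzero hzero')
  have b2 := abs_le.mp (F (n * (1 - α)) 0 0 (i + j) (onek hα1) (by push_cast; linarith)
    hzero hzero')
  have b3 := abs_le.mp (F (n * 1) 0 0 n (onek hκ1) (by ring) hzero hzero')
  have b4 := abs_le.mp (F (n * α ^ 2) x 0 g (by rw [sq α]; exact mulk hα hα) (by linarith)
    hxv hzero')
  have b5 := abs_le.mp (F (n * (α * (1 - α))) (-x) 0 i (mulk hα hα1) (by linarith) hxv' hzero')
  have b6 := abs_le.mp (F (n * (1 - α) ^ 2) x 0 j (by rw [sq (1 - α)]; exact mulk hα1 hα1)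
    (by linarith) hxv hzero')
  rw [abs_le]
  constructor <;> linarith

set_option maxHeartbeats 1000000 in
-- The expansion is made around the densities for n points; the boundary enters only as the
-- perturbation e of each cell, at most 5n^(1/4). The factorials number 17 with multiplicity, whence
-- ε/17.
theorem overlapTerm_near {κ ε : ℝ} (hκ : 0 < κ) (hε : 0 < ε) :
    ∃ N : ℕ, ∀ n : ℕ, N ≤ n → ∀ (α β x y z : ℝ) (m p q a b g h s : ℕ),
      (m : ℝ) ≤ (n : ℝ) ^ (1 / 4 : ℝ) → p ≤ m → q ≤ m →
      (a : ℝ) = α * n → (b : ℝ) = β * n → κ ≤ α → κ ≤ β → κ ≤ 1 - α - β →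
      (g : ℝ) = α ^ 2 * n + x → (h : ℝ) = β ^ 2 * n + y → (s : ℝ) = α * β * n + z →
      |x| ≤ (n : ℝ) ^ (65 / 100 : ℝ) → |y| ≤ (n : ℝ) ^ (65 / 100 : ℝ) →
      |z| ≤ (n : ℝ) ^ (65 / 100 : ℝ) →
      ExpNear ε (overlapTerm (n + m) (a + p) (b + q) (g + p) (h + q) s)
        (Real.exp (1 / 2 * Real.log ((1 - α) * (1 - β) /
          (2 * Real.pi * n * (α * β * (1 - α - β) ^ 2))) + ratioQuad α β x y z / (2 * n))) := by
  obtain ⟨N₁, hN₁⟩ := log_factorial_near (κ := κ ^ 2) (ε := ε / 17) (by positivity) (by positivity)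
  obtain ⟨N₂, hN₂⟩ := exists_nat_rpow_neg_le (c := 35 / 100) (by norm_num)
    (ε := κ ^ 2 / 6) (by positivity)
  refine ⟨max N₁ (max N₂ 1), fun n hn α β x y z m p q a b g h s hm hp hq ha hb hα hβ hD hg hh hs
    hx hy hz => ?_⟩
  simp only [max_le_iff] at hn
  obtain ⟨hn1, hn2, hn3⟩ := hn
  have hnr : (1 : ℝ) ≤ n := by exact_mod_cast hn3
  have hn0 : (0 : ℝ) < n := by linarith
  have hα0 : 0 < α := by linarith
  have hβ0 : 0 < β := by linarith
  have hD0 : 0 < 1 - α - β := by linarith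
  have hα1 : κ ≤ 1 - α := by linarith
  have hβ1 : κ ≤ 1 - β := by linarith
  have hκ1 : κ ≤ 1 := by linarith
  have F := hN₁ n hn1
  set v := (n : ℝ) ^ (65 / 100 : ℝ) with hv
  have hv0 : 0 ≤ v := by positivity
  set r := (n : ℝ) ^ (1 / 4 : ℝ) with hr
  have hq0 : 0 ≤ r := by positivity
  have hrv : r ≤ v := Real.rpow_le_rpow_of_exponent_le hnr (by norm_num)
  -- Every cell is at least κ²n at the centre, so it stays nonnegative after all deviations and
  -- perturbations.
  have hvn : 6 * v ≤ κ ^ 2 * n := by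
    have := hN₂ n hn2
    have h2 : v / n = (n : ℝ) ^ (-(35 / 100) : ℝ) := by
      rw [hv, ← Real.rpow_sub_one hn0.ne']; norm_num
    rw [← h2, div_le_iff₀ hn0] at this
    linarith
  have mulk : ∀ {p q : ℝ}, κ ≤ p → κ ≤ q → κ ^ 2 * n ≤ n * (p * q) := fun {p q} hp hq => by
    rw [mul_comm (n : ℝ)]
    apply mul_le_mul_of_nonneg_right _ hn0.le
    rw [sq]; exact mul_le_mul hp hq hκ.le (hκ.le.trans hp)
  have onek : ∀ {p : ℝ}, κ ≤ p → κ ^ 2 * n ≤ n * p := fun {p} hp => by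
    have := mulk hp hκ1
    rwa [mul_one] at this
  have hx2 := abs_le.mp hx
  have hy2 := abs_le.mp hy
  have hz2 := abs_le.mp hz
  have hpr : (p : ℝ) ≤ m := by exact_mod_cast hp
  have hqr : (q : ℝ) ≤ m := by exact_mod_cast hq
  have hp0 : (0 : ℝ) ≤ p := p.cast_nonneg
  have hqq0 : (0 : ℝ) ≤ q := q.cast_nonneg
  have m1 := mulk hα hD
  have m2 := mulk hβ hD
  have m3 := mulk hα1 hD
  have m4 := mulk hβ1 hD
  -- the remaining cells of the contingency table
  have gi : g + s ≤ a := by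
    have : (g : ℝ) + s ≤ a := by rw [hg, hs, ha]; linarith
    exact_mod_cast this
  obtain ⟨i, rfl⟩ : ∃ i, a = g + s + i := ⟨a - g - s, by omega⟩
  have gk : h + s ≤ b := by
    have : (h : ℝ) + s ≤ b := by rw [hh, hs, hb]; linarith
    exact_mod_cast this
  obtain ⟨k, rfl⟩ : ∃ k, b = h + s + k := ⟨b - h - s, by omega⟩
  push_cast at ha hb
  have ei : (i : ℝ) = n * (α * (1 - α - β)) + (-x - z) + 0 := by linarith
  have ek : (k : ℝ) = n * (β * (1 - α - β)) + (-y - z) + 0 := by linarith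
  have gj : g + p + s + i + (h + q + s + k) + i ≤ n + m := by
    have : (g : ℝ) + p + s + i + (h + q + s + k) + i ≤ n + m := by linarith
    exact_mod_cast this
  obtain ⟨j, hj⟩ : ∃ j, n + m = g + p + s + i + (h + q + s + k) + (i + j) :=
    ⟨n + m - (g + p + s + i + (h + q + s + k) + i), by omega⟩
  have hjr : (n : ℝ) + m = g + p + s + i + (h + q + s + k) + (i + j) := by exact_mod_cast hj
  have ej : (j : ℝ) = n * ((1 - α) * (1 - α - β)) + (x + z) + (m - p - q) := by linarith
  have gl : k ≤ i + j := by
    have : (k : ℝ) ≤ i + j := by linarith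
    exact_mod_cast this
  obtain ⟨l, hl⟩ : ∃ l, i + j = k + l := ⟨i + j - k, by omega⟩
  have hlr : (i : ℝ) + j = k + l := by exact_mod_cast hl
  have el : (l : ℝ) = n * ((1 - β) * (1 - α - β)) + (y + z) + (m - p - q) := by linarith
  rw [show g + s + i + p = g + p + s + i by omega, show h + s + k + q = h + q + s + k by omega, hj,
    overlapTerm_eq_exp hl]
  apply ExpNear.of_abs_sub_le
  rw [← term_stirling hα0 hβ0 hD0 hn0 x y z m p q]
  have zu : |(0 : ℝ)| ≤ 2 * v := by rw [abs_zero]; positivity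
  have ze : |(0 : ℝ)| ≤ 5 * r := by rw [abs_zero]; positivity
  have e1 : |(m : ℝ) - p - q| ≤ 5 * r := by rw [abs_le]; constructor <;> linarith
  have e2 : |(m : ℝ) - p| ≤ 5 * r := by rw [abs_le]; constructor <;> linarith
  have e3 : |(m : ℝ) - q| ≤ 5 * r := by rw [abs_le]; constructor <;> linarith
  have e4 : |(m : ℝ)| ≤ 5 * r := by rw [abs_le]; constructor <;> linarith
  have u1 : |x| ≤ 2 * v := by linarith
  have u1' : |(-x)| ≤ 2 * v := by rw [abs_neg]; exact u1
  have u2 : |y| ≤ 2 * v := by linarith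
  have u2' : |(-y)| ≤ 2 * v := by rw [abs_neg]; exact u2
  have u3 : |z| ≤ 2 * v := by linarith
  have u4 : |x + z| ≤ 2 * v := by rw [abs_le]; constructor <;> linarith
  have u4' : |-x - z| ≤ 2 * v := by rw [abs_le]; constructor <;> linarith
  have u5 : |y + z| ≤ 2 * v := by rw [abs_le]; constructor <;> linarith
  have u5' : |-y - z| ≤ 2 * v := by rw [abs_le]; constructor <;> linarith
  have b1 := abs_le.mp (F (n * (1 - α - β)) 0 (m - p - q) (i + j) (onek hD)
    (by push_cast; linarith) zu e1)
  have b2 := abs_le.mp (F (n * 1) 0 m (g + p + s + i + (h + q + s + k) + (i + j)) (onek hκ1)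
    (by push_cast; linarith) zu e4)
  have b3 := abs_le.mp (F (n * (1 - α)) 0 (m - p) (h + q + s + k + (i + j)) (onek hα1)
    (by push_cast; linarith) zu e2)
  have b4 := abs_le.mp (F (n * (1 - β)) 0 (m - q) (g + p + s + i + (i + j)) (onek hβ1)
    (by push_cast; linarith) zu e3)
  have b5 := abs_le.mp (F (n * (α * (1 - α))) (-x) 0 (s + i) (mulk hα hα1)
    (by push_cast; linarith) u1' ze)
  have b6 := abs_le.mp (F (n * (1 - α) ^ 2) x (m - p) (h + q + k + j)
    (by rw [sq (1 - α)]; exact mulk hα1 hα1) (by push_cast; linarith) u1 e2)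
  have b7 := abs_le.mp (F (n * (β * (1 - β))) (-y) 0 (s + k) (mulk hβ hβ1)
    (by push_cast; linarith) u2' ze)
  have b8 := abs_le.mp (F (n * (1 - β) ^ 2) y (m - q) (g + p + i + l)
    (by rw [sq (1 - β)]; exact mulk hβ1 hβ1) (by push_cast; linarith) u2 e3)
  have b9 := abs_le.mp (F (n * ((1 - α) * (1 - β))) z (m - p - q) (i + j + s) (mulk hα1 hβ1)
    (by push_cast; linarith) u3 e1)
  have b10 := abs_le.mp (F (n * (α * β)) z 0 s (mulk hα hβ) (by linarith) u3 ze)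
  have b11 := abs_le.mp (F (n * (α * (1 - α - β))) (-x - z) 0 i (mulk hα hD) ei u4' ze)
  have b12 := abs_le.mp (F (n * ((1 - α) * (1 - α - β))) (x + z) (m - p - q) j (mulk hα1 hD) ej
    u4 e1)
  have b13 := abs_le.mp (F (n * (β * (1 - α - β))) (-y - z) 0 k (mulk hβ hD) ek u5' ze)
  have b14 := abs_le.mp (F (n * ((1 - β) * (1 - α - β))) (y + z) (m - p - q) l (mulk hβ1 hD) el
    u5 e1)
  rw [abs_le]
  constructor <;> linarith

/-! ### Asymptotics of the avoidance rate -/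

theorem log_avoidRate {k i j : ℕ} :
    Real.log (avoidRate (k + i + j) k i) = Real.log ((k + j).factorial : ℝ)
      + Real.log ((i + j).factorial : ℝ) - Real.log ((k + i + j).factorial : ℝ)
      - Real.log (j.factorial : ℝ) := by
  have c1 : ((k + j).choose k : ℝ) ≠ 0 := choose_ne_zero_real (by omega)
  have c2 : ((k + i + j).choose k : ℝ) ≠ 0 := choose_ne_zero_real (by omega)
  unfold avoidRate
  rw [show k + i + j - i = k + j by omega, Real.log_div c1 c2,
    log_choose (show k ≤ k + j by omega), log_choose (show k ≤ k + i + j by omega),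
    show k + j - k = j by omega, show k + i + j - k = i + j by omega]
  ring

/-- The effect on `avoidRate` of adding `m` points, with `p` and `q` points in the two sets. -/
theorem avoidRate_near {κ ε : ℝ} (hκ : 0 < κ) (hε : 0 < ε) :
    ∃ N : ℕ, ∀ n : ℕ, N ≤ n → ∀ (α β : ℝ) (m p q a b : ℕ),
      (m : ℝ) ≤ (n : ℝ) ^ (1 / 4 : ℝ) → p ≤ m → q ≤ m →
      (a : ℝ) = α * n → (b : ℝ) = β * n → κ ≤ α → κ ≤ β → κ ≤ 1 - α - β →
      a + p + (b + q) ≤ n + m →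
      ExpNear ε (avoidRate (n + m) (a + p) (b + q))
        (((1 - α) * (1 - β) / (1 - α - β)) ^ m * ((1 - α - β) / (1 - β)) ^ q *
          ((1 - α - β) / (1 - α)) ^ p * avoidRate n a b) := by
  obtain ⟨N₁, hN₁⟩ := log_factorial_near (κ := κ ^ 2) (ε := ε / 9) (by positivity) (by positivity)
  refine ⟨max N₁ 1, fun n hn α β m p q a b hm hp hq ha hb hα hβ hD hN => ?_⟩
  simp only [max_le_iff] at hn
  obtain ⟨hn1, hn3⟩ := hn
  have hnr : (1 : ℝ) ≤ n := by exact_mod_cast hn3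
  have hn0 : (0 : ℝ) < n := by linarith
  have hα0 : 0 < α := by linarith
  have hβ0 : 0 < β := by linarith
  have hD0 : 0 < 1 - α - β := by linarith
  have hα1 : κ ≤ 1 - α := by linarith
  have hβ1 : κ ≤ 1 - β := by linarith
  have hκ1 : κ ≤ 1 := by linarith
  have h1 : 0 < 1 - α := by linarith
  have h2 : 0 < 1 - β := by linarith
  have F := hN₁ n hn1
  set r := (n : ℝ) ^ (1 / 4 : ℝ) with hr
  have hq0 : 0 ≤ r := by positivity
  have onek : ∀ {p : ℝ}, κ ≤ p → κ ^ 2 * n ≤ n * p := fun {p} hp => by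
    rw [mul_comm (n : ℝ)]
    apply mul_le_mul_of_nonneg_right _ hn0.le
    nlinarith
  have hpr : (p : ℝ) ≤ m := by exact_mod_cast hp
  have hqr : (q : ℝ) ≤ m := by exact_mod_cast hq
  have hp0 : (0 : ℝ) ≤ p := p.cast_nonneg
  have hqq0 : (0 : ℝ) ≤ q := q.cast_nonneg
  have hab : a + b ≤ n := by
    have : (a : ℝ) + b ≤ n := by rw [ha, hb]; nlinarith
    exact_mod_cast this
  obtain ⟨j, hj⟩ : ∃ j, n = a + b + j := ⟨n - (a + b), by omega⟩
  obtain ⟨j', hj'⟩ : ∃ j', n + m = a + p + (b + q) + j' := ⟨n + m - (a + p + (b + q)), by omega⟩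
  have hjr : (n : ℝ) = a + b + j := by exact_mod_cast hj
  have hjr' : (n : ℝ) + m = a + p + (b + q) + j' := by exact_mod_cast hj'
  have zu : |(0 : ℝ)| ≤ 2 * (n : ℝ) ^ (65 / 100 : ℝ) := by rw [abs_zero]; positivity
  have ze : |(0 : ℝ)| ≤ 5 * r := by rw [abs_zero]; positivity
  have e1 : |(m : ℝ) - p - q| ≤ 5 * r := by rw [abs_le]; constructor <;> linarith
  have e2 : |(m : ℝ) - p| ≤ 5 * r := by rw [abs_le]; constructor <;> linarith
  have e3 : |(m : ℝ) - q| ≤ 5 * r := by rw [abs_le]; constructor <;> linarith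
  have e4 : |(m : ℝ)| ≤ 5 * r := by rw [abs_le]; constructor <;> linarith
  have b1 := abs_le.mp (F (n * (1 - α - β)) 0 (m - p - q) j' (onek hD) (by linarith) zu e1)
  have b2 := abs_le.mp (F (n * 1) 0 m (n + m) (onek hκ1) (by push_cast; ring) zu e4)
  have b3 := abs_le.mp (F (n * (1 - α)) 0 (m - p) (b + q + j') (onek hα1)
    (by push_cast; linarith) zu e2)
  have b4 := abs_le.mp (F (n * (1 - β)) 0 (m - q) (a + p + j') (onek hβ1)
    (by push_cast; linarith) zu e3)
  have b5 := abs_le.mp (F (n * (1 - α - β)) 0 0 j (onek hD) (by linarith) zu ze)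
  have b6 := abs_le.mp (F (n * 1) 0 0 n (onek hκ1) (by ring) zu ze)
  have b7 := abs_le.mp (F (n * (1 - α)) 0 0 (b + j) (onek hα1) (by push_cast; linarith) zu ze)
  have b8 := abs_le.mp (F (n * (1 - β)) 0 0 (a + j) (onek hβ1) (by push_cast; linarith) zu ze)
  have hr1 : 0 < avoidRate n a b := avoidRate_pos hab
  have hr2 : 0 < avoidRate (n + m) (a + p) (b + q) := avoidRate_pos hN
  have l1 : Real.log (avoidRate n a b) = Real.log ((a + j).factorial : ℝ)
      + Real.log ((b + j).factorial : ℝ) - Real.log (n.factorial : ℝ)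
      - Real.log (j.factorial : ℝ) := by
    rw [hj]; exact log_avoidRate
  have l2 : Real.log (avoidRate (n + m) (a + p) (b + q)) =
      Real.log ((a + p + j').factorial : ℝ) + Real.log ((b + q + j').factorial : ℝ)
      - Real.log ((n + m).factorial : ℝ) - Real.log (j'.factorial : ℝ) := by
    rw [hj']; exact log_avoidRate
  have hpos : 0 < ((1 - α) * (1 - β) / (1 - α - β)) ^ m * ((1 - α - β) / (1 - β)) ^ q *
          ((1 - α - β) / (1 - α)) ^ p := by positivity
  rw [← Real.exp_log hr2, ← Real.exp_log (mul_pos hpos hr1)]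
  apply ExpNear.of_abs_sub_le
  rw [Real.log_mul hpos.ne' hr1.ne', Real.log_mul (by positivity) (by positivity),
    Real.log_mul (by positivity) (by positivity), Real.log_pow, Real.log_pow, Real.log_pow,
    Real.log_div (by positivity) hD0.ne', Real.log_mul h1.ne' h2.ne', Real.log_div hD0.ne' h2.ne',
    Real.log_div hD0.ne' h1.ne', l1, l2]
  -- Without a deviation the perturbation enters linearly, so the eight factorials differ only by
  -- multiples of log(1-α), log(1-β) and log(1-α-β), which form the claimed powers.
  have st : ∀ y e : ℝ, stirlingExp y 0 e = stirlingExp y 0 0 + e * Real.log y := by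
    intro y e; unfold stirlingExp; ring
  rw [st _ (m - p - q), Real.log_mul hn0.ne' hD0.ne'] at b1
  rw [st _ (m : ℝ), mul_one] at b2
  rw [st _ (m - p), Real.log_mul hn0.ne' h1.ne'] at b3
  rw [st _ (m - q), Real.log_mul hn0.ne' h2.ne'] at b4
  rw [mul_one] at b6
  rw [abs_le]
  constructor <;> linarith

/-! ## Bounds away from the critical point -/

theorem log_factorial_add_le {k e N : ℕ} (h : k + e ≤ N) (hN : 0 < N) :
    Real.log ((k + e).factorial : ℝ) ≤ Real.log (k.factorial : ℝ) + e * Real.log N := by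
  have h1 : (k + e).factorial ≤ k.factorial * N ^ e := by
    rw [← Nat.factorial_mul_ascFactorial]
    exact Nat.mul_le_mul_left _ ((Nat.ascFactorial_le_pow_add k e).trans (Nat.pow_le_pow_left h e))
  have hN0 : (0 : ℝ) < N := by exact_mod_cast hN
  have hk : (0 : ℝ) < k.factorial := by exact_mod_cast k.factorial_pos
  have hke : (0 : ℝ) < (k + e).factorial := by exact_mod_cast (k + e).factorial_pos
  have h2 : ((k + e).factorial : ℝ) ≤ k.factorial * (N : ℝ) ^ e := by exact_mod_cast h1
  have := Real.log_le_log hke h2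
  rwa [Real.log_mul hk.ne' (by positivity), Real.log_pow] at this

theorem log_factorial_mono {k l : ℕ} (h : k ≤ l) :
    Real.log (k.factorial : ℝ) ≤ Real.log (l.factorial : ℝ) :=
  Real.log_le_log (by exact_mod_cast k.factorial_pos) (by exact_mod_cast Nat.factorial_le h)

/-- The entropy bound needs weights and ratios at the same size, while `overlapSum` has weights for
n points and most ratios for n + m. The change costs one factor n + m per shifted unit of a
factorial, 2m in all, which is harmless for m ≤ n^(1/4). -/
theorem overlapWeight_shift {n m a g p : ℕ} (hn : 0 < n) (hp : p ≤ m) (hg : g ≤ a) (ha : a ≤ n) :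
    overlapWeight n a g ≤ overlapWeight (n + m) (a + p) (g + p) *
      Real.exp (2 * m * Real.log ((n + m : ℕ) : ℝ)) := by
  by_cases h0 : overlapWeight n a g = 0
  · rw [h0]
    exact mul_nonneg (overlapWeight_nonneg _ _ _) (Real.exp_pos _).le
  obtain ⟨i, j, rfl, rfl⟩ := exists_of_overlapWeight_ne_zero hg ha h0
  obtain ⟨r, rfl⟩ : ∃ r, m = p + r := ⟨m - p, by omega⟩
  rw [overlapWeight_eq_exp, show g + i + (i + j) + (p + r) = g + p + i + (i + (j + r)) by omega,
    show g + i + p = g + p + i by omega, overlapWeight_eq_exp, ← Real.exp_add]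
  apply Real.exp_le_exp.mpr
  set N := g + p + i + (i + (j + r)) with hN
  have b1 := log_factorial_mono (show g + i ≤ g + p + i by omega)
  have b2 := log_factorial_mono (show i + j ≤ i + (j + r) by omega)
  have b3 := log_factorial_add_le (k := g + i + (i + j)) (e := p + r) (N := N) (by omega) (by omega)
  rw [show g + i + (i + j) + (p + r) = N by omega] at b3
  have b4 := log_factorial_add_le (k := g) (e := p) (N := N) (by omega) (by omega)
  have b5 := log_factorial_add_le (k := j) (e := r) (N := N) (by omega) (by omega)
  push_cast at b3 ⊢
  linarith

theorem abs_center_shift {n m p q a b : ℕ} (hn : 0 < n) (hp : p ≤ m) (hq : q ≤ m) (ha : a ≤ n)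
    (hb : b ≤ n) (hap : a + p ≤ n + m) :
    |((a + p : ℕ) : ℝ) * ((b + q : ℕ) : ℝ) / ((n + m : ℕ) : ℝ) - a * b / n| ≤ 2 * m := by
  have hn0 : (0 : ℝ) < n := by exact_mod_cast hn
  have hN0 : (0 : ℝ) < ((n + m : ℕ) : ℝ) := by exact_mod_cast (by omega : 0 < n + m)
  have hpr : (p : ℝ) ≤ m := by exact_mod_cast hp
  have hqr : (q : ℝ) ≤ m := by exact_mod_cast hq
  have har : (a : ℝ) ≤ n := by exact_mod_cast ha
  have hbr : (b : ℝ) ≤ n := by exact_mod_cast hb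
  have hapr : (a : ℝ) + p ≤ n + m := by exact_mod_cast hap
  have p0 : (0 : ℝ) ≤ p := p.cast_nonneg
  have q0 : (0 : ℝ) ≤ q := q.cast_nonneg
  have a0 : (0 : ℝ) ≤ a := a.cast_nonneg
  have b0 : (0 : ℝ) ≤ b := b.cast_nonneg
  have m0 : (0 : ℝ) ≤ m := m.cast_nonneg
  push_cast at hN0 ⊢
  rw [show (a + p : ℝ) * (b + q) / (n + m) - a * b / n =
    (n * ((a + p) * q + p * b) - m * (a * b)) / (n * (n + m)) by field_simp; ring,
    abs_div, abs_of_pos (by positivity : (0 : ℝ) < n * (n + m)), div_le_iff₀ (by positivity),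
    abs_le]
  have e1 : (a + p : ℝ) * q ≤ (n + m) * m := mul_le_mul hapr hqr q0 (by positivity)
  have e2 : (p : ℝ) * b ≤ m * (n + m) := mul_le_mul hpr (by linarith) b0 m0
  have e3 : (a : ℝ) * b ≤ n * (n + m) := mul_le_mul har (by linarith) b0 hn0.le
  have e4 : (m : ℝ) * (a * b) ≤ m * (n * (n + m)) := mul_le_mul_of_nonneg_left e3 m0
  have e5 : 0 ≤ (n : ℝ) * ((a + p) * q + p * b) := by positivity
  have e6 : (n : ℝ) * ((a + p) * q + p * b) ≤ n * ((n + m) * m + m * (n + m)) :=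
    mul_le_mul_of_nonneg_left (by linarith) hn0.le
  have e7 : 0 ≤ (m : ℝ) * (a * b) := by positivity
  have e8 : 0 ≤ (m : ℝ) * (n * (n + m)) := by positivity
  constructor <;> linarith

/-- The exponent 1/200 is small enough for n^(1/4) log n to stay of order n^(51/200), below the gain
n^(26/100) of the tail. -/
theorem one_add_log_le {n m : ℕ} (hn : 1 ≤ n) (hm : m ≤ n) :
    1 + Real.log (((n + m : ℕ) : ℝ) + 1) ≤ 203 * (n : ℝ) ^ (1 / 200 : ℝ) := by
  have hnr : (1 : ℝ) ≤ n := by exact_mod_cast hn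
  have hmr : (m : ℝ) ≤ n := by exact_mod_cast hm
  have h1 : Real.log (((n + m : ℕ) : ℝ) + 1) ≤ Real.log (3 * n) := by
    apply Real.log_le_log (by positivity)
    push_cast
    linarith
  rw [Real.log_mul (by norm_num) (by positivity)] at h1
  have h2 := Real.log_le_rpow_div (x := n) (by positivity) (show (0 : ℝ) < 1 / 200 by norm_num)
  have h3 : Real.log 3 ≤ 2 := by
    have := Real.log_le_sub_one_of_pos (show (0 : ℝ) < 3 by norm_num)
    linarith
  have h4 : (1 : ℝ) ≤ (n : ℝ) ^ (1 / 200 : ℝ) := Real.one_le_rpow hnr (by norm_num)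
  have h5 : (n : ℝ) ^ (1 / 200 : ℝ) / (1 / 200) = 200 * (n : ℝ) ^ (1 / 200 : ℝ) := by ring
  rw [h5] at h2
  linarith

theorem half_sq_le {u u' e : ℝ} (h : |u' - u| ≤ e) : u ^ 2 / 2 - e ^ 2 ≤ u' ^ 2 := by
  have h1 : (u' - u) ^ 2 ≤ e ^ 2 := by
    rw [← sq_abs (u' - u)]; exact pow_le_pow_left₀ (abs_nonneg _) h 2
  nlinarith [sq_nonneg (u' + (u' - u))]

/-- The squared distance of the overlaps `g`, `h`, `s` to their typical values. -/
noncomputable def overlapDist (n a b g h s : ℕ) : ℝ :=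
  ((g : ℝ) - a * a / n) ^ 2 + ((h : ℝ) - b * b / n) ^ 2 + ((s : ℝ) - a * b / n) ^ 2

/-- Adding the boundary moves each deviation by at most 3m, and three squares give 27m² ≤ 27n. The
factor 4 is a factor 2 from `half_sq_le` and one from n + m ≤ 2n. -/
theorem overlapDist_shift {n m p q a b g h s : ℕ} (hn : 0 < n) (hp : p ≤ m) (hq : q ≤ m)
    (hab : a + b ≤ n) (hN : a + p + (b + q) ≤ n + m) (hmn : m ≤ n) (hm2 : (m : ℝ) ^ 2 ≤ n) :
    overlapDist n a b g h s / (4 * n) - 27 ≤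
      ((n + m : ℕ) : ℝ) * critDist (((a + p : ℕ) : ℝ) / ((n + m : ℕ) : ℝ))
        (((b + q : ℕ) : ℝ) / ((n + m : ℕ) : ℝ)) (((g + p : ℕ) : ℝ) / ((n + m : ℕ) : ℝ))
        (((h + q : ℕ) : ℝ) / ((n + m : ℕ) : ℝ)) ((s : ℝ) / ((n + m : ℕ) : ℝ)) := by
  have hn0 : (0 : ℝ) < n := by exact_mod_cast hn
  have hN0 : (0 : ℝ) < ((n + m : ℕ) : ℝ) := by exact_mod_cast (by omega : 0 < n + m)
  have hpr : (p : ℝ) ≤ m := by exact_mod_cast hp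
  have hqr : (q : ℝ) ≤ m := by exact_mod_cast hq
  have p0 : (0 : ℝ) ≤ p := p.cast_nonneg
  have q0 : (0 : ℝ) ≤ q := q.cast_nonneg
  have c1 := abs_le.mp (abs_center_shift (p := p) (q := p) (a := a) (b := a) hn hp hp (by omega)
    (by omega) (by omega))
  have c2 := abs_le.mp (abs_center_shift (p := q) (q := q) (a := b) (b := b) hn hq hq (by omega)
    (by omega) (by omega))
  have c3 := abs_center_shift (p := p) (q := q) (a := a) (b := b) hn hp hq (by omega) (by omega)
    (by omega)
  set N := ((n + m : ℕ) : ℝ) with hNdef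
  set A := ((a + p : ℕ) : ℝ)
  set B := ((b + q : ℕ) : ℝ)
  have h1 : |(((g + p : ℕ) : ℝ) - A * A / N) - ((g : ℝ) - a * a / n)| ≤ 3 * m := by
    rw [abs_le]; push_cast; constructor <;> linarith
  have h2 : |(((h + q : ℕ) : ℝ) - B * B / N) - ((h : ℝ) - b * b / n)| ≤ 3 * m := by
    rw [abs_le]; push_cast; constructor <;> linarith
  have h3 : |((s : ℝ) - A * B / N) - ((s : ℝ) - a * b / n)| ≤ 3 * m := by
    rw [abs_le] at *; constructor <;> linarith [(m.cast_nonneg : (0 : ℝ) ≤ m)]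
  have k1 := half_sq_le h1
  have k2 := half_sq_le h2
  have k3 := half_sq_le h3
  have e : N * critDist (A / N) (B / N) (((g + p : ℕ) : ℝ) / N) (((h + q : ℕ) : ℝ) / N)
      ((s : ℝ) / N) = ((((g + p : ℕ) : ℝ) - A * A / N) ^ 2 + (((h + q : ℕ) : ℝ) - B * B / N) ^ 2
        + ((s : ℝ) - A * B / N) ^ 2) / N := by
    unfold critDist
    field_simp
  rw [e, le_div_iff₀ hN0]
  have hN2 : N ≤ 2 * n := by
    have : (m : ℝ) ≤ n := by exact_mod_cast hmn
    rw [hNdef]; push_cast; linarith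
  have hNn : (n : ℝ) ≤ N := by
    rw [hNdef]; push_cast; linarith [(m.cast_nonneg : (0 : ℝ) ≤ m)]
  have hd0 : 0 ≤ overlapDist n a b g h s := by unfold overlapDist; positivity
  have h5 : overlapDist n a b g h s / (4 * n) * N ≤ overlapDist n a b g h s / 2 := by
    rw [div_mul_eq_mul_div, div_le_iff₀ (by positivity)]
    nlinarith
  have h6 : overlapDist n a b g h s / 2 = ((g : ℝ) - a * a / n) ^ 2 / 2
    + ((h : ℝ) - b * b / n) ^ 2 / 2 + ((s : ℝ) - a * b / n) ^ 2 / 2 := by unfold overlapDist; ring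
  nlinarith

set_option maxHeartbeats 1000000 in
-- The bound is for the d-th power of one term at one size, because `totalEnt` contains d copies of
-- `ratioEnt` with a common s. The mixture of sizes and the sum over s are treated in
-- `mul_pow_sub_le` and `mul_sum_pow_le`.
theorem tail_bound {d : ℕ} (hd : 1 ≤ d) {c χ P Q : ℝ} (hc : 0 < c) (hχ : 0 < χ)
    (H : ∀ α β : ℝ, |α - P| ≤ χ → |β - Q| ≤ χ → ∀ γ δ s : ℝ, EntRegion α β γ δ s →
      totalEnt d α β γ δ s ≤ -c * critDist α β γ δ s) :
    ∃ (K : ℝ) (N : ℕ), 0 < K ∧ ∀ n : ℕ, N ≤ n → ∀ m p q a b g h s : ℕ,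
      (m : ℝ) ≤ (n : ℝ) ^ (1 / 4 : ℝ) → p ≤ m → q ≤ m → |(a : ℝ) / n - P| ≤ χ / 2 →
      |(b : ℝ) / n - Q| ≤ χ / 2 → a + b ≤ n → a + p + (b + q) ≤ n + m → g ≤ a → h ≤ b →
      s ≤ a - g →
      overlapWeight n a g * overlapWeight n b h *
          overlapTerm (n + m) (a + p) (b + q) (g + p) (h + q) s ^ d ≤
        Real.exp (K * (n : ℝ) ^ (51 / 200 : ℝ) - c / 4 * overlapDist n a b g h s / n) := by
  obtain ⟨N₁, hN₁⟩ := exists_nat_rpow_neg_le (c := 3 / 4) (by norm_num) (ε := χ / 2) (by positivity)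
  -- The costs are 18 + 17d crude Stirling errors, 4m log(n+m) from shifting two weights (812 =
  -- 4·203), and 27c from recentring the distance.
  refine ⟨203 * (18 + 17 * d) + 812 + 27 * c, max N₁ 1, by positivity,
    fun n hn m p q a b g h s hm hp hq ha hb hab hN hg hh hs => ?_⟩
  simp only [max_le_iff] at hn
  obtain ⟨hn1, hn3⟩ := hn
  by_cases h0 : overlapTerm (n + m) (a + p) (b + q) (g + p) (h + q) s = 0
  · rw [h0, zero_pow (by omega), mul_zero]
    exact (Real.exp_pos _).le
  have hnr : (1 : ℝ) ≤ n := by exact_mod_cast hn3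
  have hn0 : (0 : ℝ) < n := by linarith
  set r := (n : ℝ) ^ (1 / 4 : ℝ) with hr
  have hr1 : 1 ≤ r := Real.one_le_rpow hnr (by norm_num)
  have hrn : r ^ 2 ≤ n := by
    rw [hr, ← Real.rpow_natCast, ← Real.rpow_mul hn0.le]
    calc (n : ℝ) ^ ((1 / 4 : ℝ) * ((2 : ℕ) : ℝ)) ≤ (n : ℝ) ^ (1 : ℝ) :=
          Real.rpow_le_rpow_of_exponent_le hnr (by norm_num)
      _ = n := Real.rpow_one _
  have m0 : (0 : ℝ) ≤ m := m.cast_nonneg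
  have hm2 : (m : ℝ) ^ 2 ≤ n := (pow_le_pow_left₀ m0 hm 2).trans hrn
  have hmnr : (m : ℝ) ≤ n := by nlinarith
  have hmn : m ≤ n := by exact_mod_cast hmnr
  have hNpos : 0 < n + m := by omega
  have hN0 : (0 : ℝ) < ((n + m : ℕ) : ℝ) := by exact_mod_cast hNpos
  -- the densities for `n + m` points
  have dens : ∀ {x u : ℕ} {X : ℝ}, u ≤ m → x ≤ n → |(x : ℝ) / n - X| ≤ χ / 2 →
      |((x + u : ℕ) : ℝ) / ((n + m : ℕ) : ℝ) - X| ≤ χ := by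
    intro x u X hu hx hX
    have hur : (u : ℝ) ≤ m := by exact_mod_cast hu
    have hxr : (x : ℝ) ≤ n := by exact_mod_cast hx
    have h1 : |((x + u : ℕ) : ℝ) / ((n + m : ℕ) : ℝ) - (x : ℝ) / n| ≤ χ / 2 := by
      have h2 : (m : ℝ) / n ≤ χ / 2 := by
        refine le_trans ?_ (hN₁ n hn1)
        rw [div_le_iff₀ hn0, ← Real.rpow_add_one hn0.ne']
        refine hm.trans_eq ?_
        norm_num [hr]
      refine le_trans ?_ h2
      push_cast at hN0 ⊢
      rw [show ((x : ℝ) + u) / (n + m) - x / n = (n * u - x * m) / (n * (n + m)) by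
        field_simp; ring, abs_div, abs_of_pos (by positivity : (0 : ℝ) < n * (n + m)),
        div_le_div_iff₀ (by positivity) hn0]
      have h3 : |(n : ℝ) * u - x * m| ≤ n * m := by
        have e1 : (n : ℝ) * u ≤ n * m := mul_le_mul_of_nonneg_left hur hn0.le
        have e2 : (x : ℝ) * m ≤ n * m := mul_le_mul_of_nonneg_right hxr m0
        have e3 : 0 ≤ (n : ℝ) * u := by positivity
        have e4 : 0 ≤ (x : ℝ) * m := by positivity
        rw [abs_le]; constructor <;> linarith
      calc |(n : ℝ) * u - x * m| * n ≤ n * m * n := mul_le_mul_of_nonneg_right h3 hn0.le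
        _ ≤ m * (n * (n + m)) := by nlinarith [mul_nonneg (mul_nonneg m0 hn0.le) m0]
    rw [abs_le] at *
    constructor <;> linarith
  have hα := dens hp (by omega) ha
  have hβ := dens hq (by omega) hb
  obtain ⟨hreg, hterm⟩ := overlapTerm_le_exp (N := n + m) (a := a + p) (b := b + q) (g := g + p)
    (h := h + q) (s := s) hNpos hN (by omega) (by omega) h0
  have hent := H _ _ hα hβ _ _ _ hreg
  have w1 := overlapWeight_shift (n := n) (m := m) (p := p) (by omega) hp hg (by omega : a ≤ n)
  have w2 := overlapWeight_shift (n := n) (m := m) (p := q) (by omega) hq hh (by omega : b ≤ n)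
  have v1 := overlapWeight_le_exp (n := n + m) (a := a + p) (g := g + p) hNpos (by omega) (by omega)
  have v2 := overlapWeight_le_exp (n := n + m) (a := b + q) (g := h + q) hNpos (by omega) (by omega)
  have hdist := overlapDist_shift (g := g) (h := h) (s := s) (by omega : 0 < n) hp hq hab hN hmn hm2
  have hlog := one_add_log_le hn3 hmn
  set N := ((n + m : ℕ) : ℝ) with hNdef
  set ℓ := 1 + Real.log (N + 1) with hℓ
  have hlogN : Real.log N ≤ ℓ := by
    have := Real.log_le_log hN0 (by linarith : N ≤ N + 1)
    linarith
  have u1 := w1.trans (mul_le_mul_of_nonneg_right v1 (Real.exp_pos _).le)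
  have u2 := w2.trans (mul_le_mul_of_nonneg_right v2 (Real.exp_pos _).le)
  rw [← Real.exp_add] at u1 u2
  have u3 := pow_le_pow_left₀ (overlapTerm_nonneg _ _ _ _ _ _) hterm d
  rw [← Real.exp_nat_mul] at u3
  have u4 := mul_le_mul (mul_le_mul u1 u2 (overlapWeight_nonneg _ _ _) (Real.exp_pos _).le) u3
    (pow_nonneg (overlapTerm_nonneg _ _ _ _ _ _) _) (by positivity)
  refine u4.trans ?_
  rw [← Real.exp_add, ← Real.exp_add]
  apply Real.exp_le_exp.mpr
  set t := (n : ℝ) ^ (1 / 200 : ℝ) with ht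
  have ht1 : 1 ≤ t := Real.one_le_rpow hnr (by norm_num)
  have hrt : r * t = (n : ℝ) ^ (51 / 200 : ℝ) := by
    rw [hr, ht, ← Real.rpow_add hn0]; norm_num
  rw [← hrt]
  have hmlog : (m : ℝ) * Real.log N ≤ r * (203 * t) := by
    have h1 : (m : ℝ) * Real.log N ≤ m * (203 * t) :=
      mul_le_mul_of_nonneg_left (hlogN.trans hlog) m0
    exact h1.trans (mul_le_mul_of_nonneg_right hm (by positivity))
  have hℓrt : ℓ ≤ 203 * (r * t) := by
    have : t ≤ r * t := le_mul_of_one_le_left (by linarith) hr1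
    linarith
  have hrt1 : 1 ≤ r * t := by nlinarith
  have hdℓ : (18 + 17 * (d : ℝ)) * ℓ ≤ (18 + 17 * d) * (203 * (r * t)) :=
    mul_le_mul_of_nonneg_left hℓrt (by positivity)
  have hcd : c * (overlapDist n a b g h s / (4 * n) - 27) ≤ c * (N *
      critDist (((a + p : ℕ) : ℝ) / N) (((b + q : ℕ) : ℝ) / N) (((g + p : ℕ) : ℝ) / N)
        (((h + q : ℕ) : ℝ) / N) ((s : ℝ) / N)) := mul_le_mul_of_nonneg_left hdist hc.le
  have hNent := mul_le_mul_of_nonneg_left hent hN0.le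
  rw [show c / 4 * overlapDist n a b g h s / n = c * (overlapDist n a b g h s / (4 * n)) by
    field_simp]
  have h27 : 27 * c ≤ 27 * c * (r * t) := le_mul_of_one_le_right (by positivity) hrt1
  unfold totalEnt at hNent
  linarith

/-! ## The central part of the sum over the overlaps -/

theorem exists_rpow_le_mul {κ s t : ℝ} (hκ : 0 < κ) (hst : s < t) :
    ∃ N : ℕ, ∀ n : ℕ, N ≤ n → (n : ℝ) ^ s ≤ κ * (n : ℝ) ^ t := by
  obtain ⟨N, hN⟩ := exists_nat_rpow_neg_le (c := t - s) (by linarith) hκ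
  refine ⟨max N 1, fun n hn => ?_⟩
  have hn0 : (0 : ℝ) < n := by
    have : 1 ≤ n := (le_max_right _ _).trans hn
    exact_mod_cast this
  have h := hN n ((le_max_left _ _).trans hn)
  calc (n : ℝ) ^ s = (n : ℝ) ^ (-(t - s)) * (n : ℝ) ^ t := by
        rw [← Real.rpow_add hn0]; congr 1; ring
    _ ≤ κ * (n : ℝ) ^ t := mul_le_mul_of_nonneg_right h (by positivity)

/-- The nested windows used for the overlaps. -/
theorem exists_windows {κ : ℝ} (hκ : 0 < κ) :
    ∃ N : ℕ, ∀ n : ℕ, N ≤ n → 1 ≤ n ∧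
      2 * (n : ℝ) ^ (60 / 100 : ℝ) ≤ (n : ℝ) ^ (63 / 100 : ℝ) ∧
      2 * (n : ℝ) ^ (63 / 100 : ℝ) ≤ κ * (n : ℝ) ^ (64 / 100 : ℝ) ∧
      2 * (n : ℝ) ^ (64 / 100 : ℝ) ≤ κ * (n : ℝ) ^ (65 / 100 : ℝ) ∧
      4 * (n : ℝ) ^ (65 / 100 : ℝ) ≤ κ * n := by
  obtain ⟨N₁, h₁⟩ := exists_rpow_le_mul (κ := 1 / 2) (s := 60 / 100) (t := 63 / 100)
    (by norm_num) (by norm_num)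
  obtain ⟨N₂, h₂⟩ := exists_rpow_le_mul (κ := κ / 2) (s := 63 / 100) (t := 64 / 100)
    (by positivity) (by norm_num)
  obtain ⟨N₃, h₃⟩ := exists_rpow_le_mul (κ := κ / 2) (s := 64 / 100) (t := 65 / 100)
    (by positivity) (by norm_num)
  obtain ⟨N₄, h₄⟩ := exists_rpow_le_mul (κ := κ / 4) (s := 65 / 100) (t := 1)
    (by positivity) (by norm_num)
  refine ⟨max (max N₁ N₂) (max (max N₃ N₄) 1), fun n hn => ?_⟩
  simp only [max_le_iff] at hn
  obtain ⟨⟨n1, n2⟩, ⟨n3, n4⟩, n5⟩ := hn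
  have a1 := h₁ n n1
  have a2 := h₂ n n2
  have a3 := h₃ n n3
  have a4 := h₄ n n4
  rw [Real.rpow_one] at a4
  exact ⟨n5, by linarith, by linarith, by linarith, by linarith⟩

/-- The overlaps `g` within `n ^ e` of the typical value `a b / n`. -/
noncomputable def overlapWindow (e : ℝ) (n a b M : ℕ) : Finset ℕ :=
  (Finset.range (M + 1)).filter fun k => |(k : ℝ) - a * b / n| ≤ (n : ℝ) ^ e

theorem mem_overlapWindow {e : ℝ} {n a b M k : ℕ} :
    k ∈ overlapWindow e n a b M ↔ k ≤ M ∧ |(k : ℝ) - a * b / n| ≤ (n : ℝ) ^ e := by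
  rw [overlapWindow, Finset.mem_filter, Finset.mem_range, Nat.lt_succ_iff]

theorem quadCoeff_bounds {α β κ : ℝ} (hκ : 0 < κ) (hα : κ ≤ α) (hβ : κ ≤ β)
    (hD : κ ≤ 1 - α - β) : 1 ≤ quadCoeff α β ∧ quadCoeff α β ≤ 3 / κ ^ 5 := by
  have hα0 : 0 < α := by linarith
  have hβ0 : 0 < β := by linarith
  have hD0 : 0 < 1 - α - β := by linarith
  have h1 : κ ≤ 1 - α := by linarith
  have h2 : κ ≤ 1 - β := by linarith
  have h10 : 0 < 1 - α := by linarith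
  have h20 : 0 < 1 - β := by linarith
  have hk : α * β ≤ 1 := mul_le_one₀ (by linarith) hβ0.le (by linarith)
  have hP : (1 - α) * (1 - β) ≤ 1 := mul_le_one₀ (by linarith) h20.le (by linarith)
  have hk0 : 0 < α * β := by positivity
  have hP0 : 0 < (1 - α) * (1 - β) := by positivity
  unfold quadCoeff
  constructor
  · rw [le_div_iff₀ (by positivity), one_mul]
    have := mul_le_one₀ hk hP0.le hP
    nlinarith
  · have k1 : κ ^ 2 ≤ α * β := by rw [sq]; exact mul_le_mul hα hβ hκ.le hα0.le
    have k2 : κ ^ 2 ≤ (1 - α) * (1 - β) := by rw [sq]; exact mul_le_mul h1 h2 hκ.le h10.le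
    have k3 : κ ^ 5 ≤ α * β * ((1 - α) * (1 - β)) * (1 - α - β) := by
      calc κ ^ 5 = κ ^ 2 * κ ^ 2 * κ := by ring
        _ ≤ _ := by gcongr
    apply div_le_div₀ (by norm_num) (by nlinarith) (by positivity) k3

theorem abs_quadShift_le {α β : ℝ} (hα : 0 < α) (hβ : 0 < β) (hD : 0 < 1 - α - β) (X Y : ℝ) :
    |quadShift α β X Y| ≤ (|X| + |Y|) / 2 := by
  have h10 : 0 < 1 - α := by linarith
  have h20 : 0 < 1 - β := by linarith
  have hP : (1 - α) * (1 - β) ≤ 1 := mul_le_one₀ (by linarith) h20.le (by linarith)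
  have hk0 : 0 < α * β := by positivity
  have hE : 0 < 1 - α - β + 2 * α * β := by positivity
  have hq : α * β * ((1 - α) * (1 - β)) / (1 - α - β + 2 * α * β) ≤ 1 / 2 := by
    rw [div_le_iff₀ hE]
    nlinarith
  have hq0 : 0 ≤ α * β * ((1 - α) * (1 - β)) / (1 - α - β + 2 * α * β) := by positivity
  unfold quadShift
  rw [abs_mul, abs_of_nonneg hq0]
  have := mul_le_mul (abs_add_le X Y) hq hq0 (by positivity)
  linarith

/-- The exponent of `overlapRatio` after the intersection size has been summed out. -/
noncomputable def ratioMain (α β X Y : ℝ) : ℝ :=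
  -(1 / 2 * (α * β / (1 - α - β)) * (X - Y) ^ 2)
    + 1 / 2 * (α * β / (1 - α - β + 2 * α * β)) * (X + Y) ^ 2

/-- The value of `overlapRatio` at typical overlaps. -/
noncomputable def ratioConst (α β : ℝ) : ℝ :=
  (1 - α) * (1 - β) / √((1 - α - β) * (1 - α - β + 2 * α * β))

/-- The Stirling prefactor is of order n^(-1/2), and the Gaussian sum over s restores √n; the
product no longer depends on n. -/
theorem ratioConst_eq {α β n : ℝ} (hα : 0 < α) (hβ : 0 < β) (hD : 0 < 1 - α - β) (hn : 0 < n) :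
    Real.exp (1 / 2 * Real.log ((1 - α) * (1 - β) /
      (2 * Real.pi * n * (α * β * (1 - α - β) ^ 2)))) *
      √(Real.pi * n / (quadCoeff α β / 2)) = ratioConst α β := by
  have h10 : 0 < 1 - α := by linarith
  have h20 : 0 < 1 - β := by linarith
  have hE : 0 < 1 - α - β + 2 * α * β := by positivity
  have hpos : 0 < (1 - α) * (1 - β) / (2 * Real.pi * n * (α * β * (1 - α - β) ^ 2)) := by
    positivity
  rw [show 1 / 2 * Real.log ((1 - α) * (1 - β) / (2 * Real.pi * n * (α * β * (1 - α - β) ^ 2))) =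
    Real.log ((1 - α) * (1 - β) / (2 * Real.pi * n * (α * β * (1 - α - β) ^ 2))) / 2 by ring,
    ← Real.log_sqrt hpos.le, Real.exp_log (Real.sqrt_pos.mpr hpos), ← Real.sqrt_mul hpos.le]
  have hPP : (1 - α) * (1 - β) = √(((1 - α) * (1 - β)) ^ 2) := by
    rw [Real.sqrt_sq (by positivity)]
  rw [ratioConst, hPP, ← Real.sqrt_div (by positivity), ← hPP]
  congr 1
  unfold quadCoeff
  field_simp

theorem abs_div_le_of_window {κ α w X L : ℝ} (hκ : 0 < κ) (hα : κ ^ 2 ≤ α) (hw : w = α * X)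
    (h : |w| ≤ L) : κ ^ 2 * |X| ≤ L := by
  rw [hw, abs_mul, abs_of_pos (lt_of_lt_of_le (by positivity) hα)] at h
  exact (mul_le_mul_of_nonneg_right hα (abs_nonneg X)).trans h

set_option maxHeartbeats 1000000 in
-- For fixed g and h the sum over s is Gaussian, with mean displaced by `quadShift`. The
-- displacement is linear in the deviations of g and h, so their smaller windows keep it well inside
-- the window of s.
theorem overlapRatio_central {κ ε : ℝ} (hκ : 0 < κ) (hε : 0 < ε) :
    ∃ N : ℕ, ∀ n : ℕ, N ≤ n → ∀ (α β X Y : ℝ) (m p q a b g h : ℕ),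
      (m : ℝ) ≤ (n : ℝ) ^ (1 / 4 : ℝ) → p ≤ m → q ≤ m →
      (a : ℝ) = α * n → (b : ℝ) = β * n → κ ≤ α → κ ≤ β → κ ≤ 1 - α - β →
      (g : ℝ) = α ^ 2 * n + α * (1 - α) * X → (h : ℝ) = β ^ 2 * n + β * (1 - β) * Y →
      |α * (1 - α) * X| ≤ (n : ℝ) ^ (63 / 100 : ℝ) →
      |β * (1 - β) * Y| ≤ (n : ℝ) ^ (64 / 100 : ℝ) →
      ExpNear ε (∑ s ∈ overlapWindow (65 / 100) n a b (a - g),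
          overlapTerm (n + m) (a + p) (b + q) (g + p) (h + q) s)
        (ratioConst α β * Real.exp (ratioMain α β X Y / (2 * n))) := by
  obtain ⟨N₁, hN₁⟩ := overlapTerm_near hκ (half_pos hε)
  obtain ⟨N₂, hN₂⟩ := gaussian_sum_near (c₀ := 1 / 2) (c₁ := 3 / κ ^ 5 / 2) (by norm_num)
    (half_pos hε)
  obtain ⟨N₃, hN₃⟩ := exists_windows (κ := min (κ ^ 2) 1) (by positivity)
  refine ⟨max N₁ (max N₂ N₃), fun n hn α β X Y m p q a b g h hm hp hq ha hb hα hβ hD hg hh hX hY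
    => ?_⟩
  simp only [max_le_iff] at hn
  obtain ⟨hn1, hn2, hn3⟩ := hn
  obtain ⟨hn, L1, L2, L3, L4⟩ := hN₃ n hn3
  have hnr : (1 : ℝ) ≤ n := by exact_mod_cast hn
  have hn0 : (0 : ℝ) < n := by linarith
  have hα0 : 0 < α := by linarith
  have hβ0 : 0 < β := by linarith
  have hD0 : 0 < 1 - α - β := by linarith
  have hα1 : κ ≤ 1 - α := by linarith
  have hβ1 : κ ≤ 1 - β := by linarith
  have mulk : ∀ {p q : ℝ}, κ ≤ p → κ ≤ q → κ ^ 2 ≤ p * q := fun {p q} hp hq => by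
    rw [sq]; exact mul_le_mul hp hq hκ.le (hκ.le.trans hp)
  have p60 : 0 ≤ (n : ℝ) ^ (60 / 100 : ℝ) := by positivity
  have p63 : 0 ≤ (n : ℝ) ^ (63 / 100 : ℝ) := by positivity
  have p64 : 0 ≤ (n : ℝ) ^ (64 / 100 : ℝ) := by positivity
  have p65 : 0 ≤ (n : ℝ) ^ (65 / 100 : ℝ) := by positivity
  have hmin1 : min (κ ^ 2) 1 ≤ κ ^ 2 := min_le_left _ _
  have hmin2 : min (κ ^ 2) 1 ≤ 1 := min_le_right _ _
  have i63 : 2 * (n : ℝ) ^ (63 / 100 : ℝ) ≤ (n : ℝ) ^ (64 / 100 : ℝ) := L2.trans (mul_le_of_le_one_left p64 hmin2)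
  have i64 : 2 * (n : ℝ) ^ (64 / 100 : ℝ) ≤ (n : ℝ) ^ (65 / 100 : ℝ) := L3.trans (mul_le_of_le_one_left p65 hmin2)
  have j64 : 2 * (n : ℝ) ^ (64 / 100 : ℝ) ≤ κ ^ 2 * (n : ℝ) ^ (65 / 100 : ℝ) := L3.trans (mul_le_mul_of_nonneg_right hmin1 p65)
  have j65 : 4 * (n : ℝ) ^ (65 / 100 : ℝ) ≤ κ ^ 2 * n := L4.trans (mul_le_mul_of_nonneg_right hmin1 hn0.le)
  have hkD : κ ^ 2 * n ≤ α * (1 - α - β) * n :=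
    mul_le_mul_of_nonneg_right (mulk hα hD) hn0.le
  have hkk : κ ^ 2 * n ≤ α * β * n := mul_le_mul_of_nonneg_right (mulk hα hβ) hn0.le
  have hab : (a : ℝ) * b / n = α * β * n := by rw [ha, hb]; field_simp
  have hXb := abs_div_le_of_window hκ (mulk hα hα1) rfl hX
  have hYb := abs_div_le_of_window hκ (mulk hβ hβ1) rfl hY
  have hshift : |quadShift α β X Y| ≤ (n : ℝ) ^ (65 / 100 : ℝ) / 2 := by
    have h1 := abs_quadShift_le hα0 hβ0 hD0 X Y
    have h2 : κ ^ 2 * ((|X| + |Y|) / 2) ≤ κ ^ 2 * ((n : ℝ) ^ (65 / 100 : ℝ) / 2) := by linarith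
    exact h1.trans (le_of_mul_le_mul_left h2 (by positivity))
  have hshift' := abs_le.mp hshift
  have hX' := abs_le.mp hX
  obtain ⟨hc1, hc2⟩ := quadCoeff_bounds hκ hα hβ hD
  set μ := α * β * n - quadShift α β X Y with hμ
  have step1 : ExpNear (ε / 2) (∑ s ∈ overlapWindow (65 / 100) n a b (a - g),
          overlapTerm (n + m) (a + p) (b + q) (g + p) (h + q) s)
      (∑ s ∈ overlapWindow (65 / 100) n a b (a - g),
        Real.exp (1 / 2 * Real.log ((1 - α) * (1 - β) /
          (2 * Real.pi * n * (α * β * (1 - α - β) ^ 2)))) *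
        Real.exp (ratioMain α β X Y / (2 * n)) *
        Real.exp (-(quadCoeff α β / 2 * ((s : ℝ) - μ) ^ 2 / n))) := by
    refine ExpNear.sum fun s hs => ?_
    rw [mem_overlapWindow, hab] at hs
    have h1 := hN₁ n hn1 α β (α * (1 - α) * X) (β * (1 - β) * Y) (s - α * β * n) m p q a b g h s
      hm hp hq ha hb hα hβ hD hg hh (by ring) (by linarith) (by linarith) hs.2
    rw [ratioQuad_eq hα0 hβ0 hD0] at h1
    convert h1 using 1
    rw [← Real.exp_add, ← Real.exp_add]
    congr 1
    rw [hμ, ratioMain]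
    field_simp
    ring
  rw [← Finset.mul_sum] at step1
  have step2 := hN₂ n hn2 (quadCoeff α β / 2) μ (by linarith) (by linarith)
    (overlapWindow (65 / 100) n a b (a - g)) (by
      intro s hs
      rw [mem_overlapWindow, hab] at hs
      have h1 := abs_le.mp hs.2
      rw [abs_le, hμ]
      constructor <;> linarith) (by rw [hμ]; linarith) (by
      intro s hs
      have h1 := abs_le.mp hs
      rw [mem_overlapWindow, hab]
      refine ⟨?_, by rw [abs_le]; constructor <;> linarith⟩
      have : s + g ≤ a := by
        have : (s : ℝ) + g ≤ a := by rw [hg, ha]; linarith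
        exact_mod_cast this
      omega)
  have h3 := step1.trans (step2.const_mul (c := Real.exp (1 / 2 * Real.log ((1 - α) * (1 - β) /
          (2 * Real.pi * n * (α * β * (1 - α - β) ^ 2)))) *
        Real.exp (ratioMain α β X Y / (2 * n))) (by positivity))
  rw [add_halves, mul_right_comm, ratioConst_eq hα0 hβ0 hD0 hn0] at h3
  exact h3

/-! ### The limiting quadratic form in the two overlaps -/

/-- The eigenvalue of the limiting quadratic form in the direction `X = -Y`. -/
noncomputable def formA (d : ℕ) (α β : ℝ) : ℝ := 1 + d * (α * β / (1 - α - β))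

/-- The eigenvalue of the limiting quadratic form in the direction `X = Y`. -/
noncomputable def formB (d : ℕ) (α β : ℝ) : ℝ := 1 - d * (α * β / (1 - α - β + 2 * α * β))

/-- The regression coefficient of `Y` on `X`. -/
noncomputable def formSlope (d : ℕ) (α β : ℝ) : ℝ :=
  (formA d α β - formB d α β) / (formA d α β + formB d α β)

/-- The coefficient of `(Y - formSlope * X) ^ 2` in the limiting quadratic form. -/
noncomputable def formS (d : ℕ) (α β : ℝ) : ℝ := (formA d α β + formB d α β) / 2

/-- The coefficient of `X ^ 2` left in the limiting quadratic form. -/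
noncomputable def formT (d : ℕ) (α β : ℝ) : ℝ :=
  2 * formA d α β * formB d α β / (formA d α β + formB d α β)

theorem form_eq {d : ℕ} {α β : ℝ} (hAB : formA d α β + formB d α β ≠ 0) (X Y : ℝ) :
    -X ^ 2 - Y ^ 2 + d * ratioMain α β X Y =
      -(formS d α β * (Y - formSlope d α β * X) ^ 2 + formT d α β * X ^ 2) := by
  have h1 : -X ^ 2 - Y ^ 2 + d * ratioMain α β X Y =
      -(formA d α β / 2 * (X - Y) ^ 2 + formB d α β / 2 * (X + Y) ^ 2) := by
    unfold formA formB ratioMain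
    ring
  rw [h1, formS, formSlope, formT]
  generalize formA d α β = A at *
  generalize formB d α β = B at *
  field_simp
  ring

section

variable {d : ℕ} {α β κ : ℝ}

theorem formA_bounds (hκ : 0 < κ) (hα : κ ≤ α) (hβ : κ ≤ β) (hD : κ ≤ 1 - α - β) :
    1 ≤ formA d α β ∧ formA d α β ≤ 1 + d / κ := by
  have hα0 : 0 < α := by linarith
  have hβ0 : 0 < β := by linarith
  have hD0 : 0 < 1 - α - β := by linarith
  have hk : α * β ≤ 1 := mul_le_one₀ (by linarith) hβ0.le (by linarith)
  unfold formA
  constructor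
  · have : 0 ≤ d * (α * β / (1 - α - β)) := by positivity
    linarith
  · have : α * β / (1 - α - β) ≤ 1 / κ := by gcongr
    have := mul_le_mul_of_nonneg_left this (Nat.cast_nonneg (α := ℝ) d)
    rw [mul_one_div] at this
    linarith

theorem formB_bounds (hκ : 0 < κ) (hα : κ ≤ α) (hβ : κ ≤ β) (hD : κ ≤ 1 - α - β)
    (hd : κ ≤ 1 - α - β - ((d : ℝ) - 2) * α * β) :
    κ / 3 ≤ formB d α β ∧ formB d α β ≤ 1 := by
  have hα0 : 0 < α := by linarith
  have hβ0 : 0 < β := by linarith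
  have hD0 : 0 < 1 - α - β := by linarith
  have hk : α * β ≤ 1 := mul_le_one₀ (by linarith) hβ0.le (by linarith)
  have hE : 0 < 1 - α - β + 2 * α * β := by positivity
  constructor
  · have h1 : formB d α β =
        (1 - α - β - ((d : ℝ) - 2) * α * β) / (1 - α - β + 2 * α * β) := by
      unfold formB; field_simp; ring
    rw [h1]
    exact div_le_div₀ (by linarith) hd hE (by linarith)
  · have : 0 ≤ d * (α * β / (1 - α - β + 2 * α * β)) := by positivity
    unfold formB
    linarith

theorem abs_formSlope_le (hA : 1 ≤ formA d α β) (hB : 0 < formB d α β) (hB1 : formB d α β ≤ 1) :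
    |formSlope d α β| ≤ 1 := by
  unfold formSlope
  rw [abs_of_nonneg (div_nonneg (by linarith) (by linarith)), div_le_one (by linarith)]
  linarith

/-- The product of `formS` and `formT` is the determinant of the form in X and Y, which is also the
product of its eigenvalues `formA` and `formB`. -/
theorem ratioConst_pow_div (hα : 0 < α) (hβ : 0 < β) (hD : 0 < 1 - α - β)
    (hd : 0 < 1 - α - β - ((d : ℝ) - 2) * α * β) (hd1 : 1 ≤ d) :
    ratioConst α β ^ d / √(formS d α β * formT d α β) = tauConst d α β := by
  have hE : 0 < 1 - α - β + 2 * α * β := by positivity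
  have hF : 0 < 1 - α - β + d * α * β := by positivity
  have hA : formA d α β = (1 - α - β + d * α * β) / (1 - α - β) := by
    unfold formA; field_simp
  have hB : formB d α β =
      (1 - α - β - ((d : ℝ) - 2) * α * β) / (1 - α - β + 2 * α * β) := by
    unfold formB; field_simp; ring
  have hA0 : 0 < formA d α β := by rw [hA]; positivity
  have hB0 : 0 < formB d α β := by rw [hB]; positivity
  have hST : formS d α β * formT d α β = formA d α β * formB d α β := by
    unfold formS formT; field_simp
  set Q := (1 - α - β + 2 * α * β) * (1 - α - β) with hQ
  have hQ0 : 0 < Q := by positivity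
  set V := (1 - α - β + d * α * β) * (1 - α - β - ((d : ℝ) - 2) * α * β) with hV
  have hV0 : 0 < V := by positivity
  have hAB : formA d α β * formB d α β = V / Q := by
    rw [hA, hB, hV, hQ]; field_simp
  have hP : (1 - α) * (1 - β) = 1 - α - β + α * β := by ring
  rw [hST, hAB, ratioConst, tauConst, ← hQ, ← hV, hP, mul_comm (1 - α - β) (1 - α - β + 2 * α * β),
    ← hQ, div_pow, Real.sqrt_div hV0.le, ← Real.sqrt_eq_rpow, Real.sqrt_eq_rpow Q,
    ← Real.rpow_natCast (Q ^ (1 / 2 : ℝ)) d, ← Real.rpow_mul hQ0.le]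
  have h1 : Q ^ (1 / 2 * (d : ℝ)) = Q ^ (((d : ℝ) - 1) / 2) * Q ^ (1 / 2 : ℝ) := by
    rw [← Real.rpow_add hQ0]; congr 1; ring
  rw [h1]
  have h2 : 0 < Q ^ (1 / 2 : ℝ) := by positivity
  have h3 : 0 < Q ^ (((d : ℝ) - 1) / 2) := by positivity
  have h4 : 0 < √V := Real.sqrt_pos.mpr hV0
  field_simp

end

theorem exp_half_log_mul_sqrt {w n T : ℝ} (hw : 0 < w) (hn : 0 < n) (hT : 0 < T) :
    Real.exp (-(1 / 2) * Real.log (2 * Real.pi * n * w ^ 2)) *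
      √(Real.pi * n / (T / (2 * w ^ 2))) = 1 / √T := by
  have hpos : 0 < 2 * Real.pi * n * w ^ 2 := by positivity
  rw [show -(1 / 2) * Real.log (2 * Real.pi * n * w ^ 2) =
    -(Real.log (2 * Real.pi * n * w ^ 2) / 2) by ring, ← Real.log_sqrt hpos.le, Real.exp_neg,
    Real.exp_log (Real.sqrt_pos.mpr hpos), ← Real.sqrt_inv, ← Real.sqrt_mul (by positivity),
    one_div, ← Real.sqrt_inv]
  congr 1
  field_simp

/-! ### Summing out the typical overlaps -/

/-- The typical part of `overlapRatio`. -/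
noncomputable def centralRatio (n m a b p q g h : ℕ) : ℝ :=
  ∑ s ∈ overlapWindow (65 / 100) n a b (a - g),
    overlapTerm (n + m) (a + p) (b + q) (g + p) (h + q) s

/-- The typical part of `overlapSum`. -/
noncomputable def centralSum (d n m a b p q : ℕ) : ℝ :=
  ∑ g ∈ overlapWindow (63 / 100) n a a a, ∑ h ∈ overlapWindow (64 / 100) n b b b,
    overlapWeight n a g * overlapWeight n b h *
      (centralRatio n m a b p q g h ^ (d - 1) * centralRatio n 0 a b 0 0 g h)

theorem centralTerm_near {d : ℕ} (hd : 1 ≤ d) {κ ε : ℝ} (hκ : 0 < κ) (hε : 0 < ε) :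
    ∃ N : ℕ, ∀ n : ℕ, N ≤ n → ∀ (α β X Y : ℝ) (m p q a b g h : ℕ),
      (m : ℝ) ≤ (n : ℝ) ^ (1 / 4 : ℝ) → p ≤ m → q ≤ m →
      (a : ℝ) = α * n → (b : ℝ) = β * n → κ ≤ α → κ ≤ β → κ ≤ 1 - α - β →
      (g : ℝ) = α ^ 2 * n + α * (1 - α) * X → (h : ℝ) = β ^ 2 * n + β * (1 - β) * Y →
      |α * (1 - α) * X| ≤ (n : ℝ) ^ (63 / 100 : ℝ) →
      |β * (1 - β) * Y| ≤ (n : ℝ) ^ (64 / 100 : ℝ) →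
      ExpNear ε (overlapWeight n a g * overlapWeight n b h *
          (centralRatio n m a b p q g h ^ (d - 1) * centralRatio n 0 a b 0 0 g h))
        (Real.exp (-(1 / 2) * Real.log (2 * Real.pi * n * (α * (1 - α)) ^ 2)) *
          Real.exp (-(1 / 2) * Real.log (2 * Real.pi * n * (β * (1 - β)) ^ 2)) *
          ratioConst α β ^ d *
          Real.exp ((-X ^ 2 - Y ^ 2 + d * ratioMain α β X Y) / (2 * n))) := by
  -- The product has two weights and d ratios.
  set ε' := ε / (2 + d) with hε'
  have hε'0 : 0 < ε' := by positivity
  obtain ⟨N₁, hN₁⟩ := overlapWeight_near hκ hε'0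
  obtain ⟨N₂, hN₂⟩ := overlapRatio_central hκ hε'0
  obtain ⟨N₃, hN₃⟩ := exists_windows one_pos
  refine ⟨max N₁ (max N₂ N₃), fun n hn α β X Y m p q a b g h hm hp hq ha hb hα hβ hD hg hh hX hY
    => ?_⟩
  simp only [max_le_iff] at hn
  obtain ⟨hn1, hn2, hn3⟩ := hn
  obtain ⟨hn, L1, L2, L3, L4⟩ := hN₃ n hn3
  have hnr : (1 : ℝ) ≤ n := by exact_mod_cast hn
  have hn0 : (0 : ℝ) < n := by linarith
  have hα0 : 0 < α := by linarith
  have hβ0 : 0 < β := by linarith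
  have hα1 : 0 < 1 - α := by linarith
  have hβ1 : 0 < 1 - β := by linarith
  have hD0 : 0 < 1 - α - β := by linarith
  have p63 : 0 ≤ (n : ℝ) ^ (63 / 100 : ℝ) := by positivity
  have p64 : 0 ≤ (n : ℝ) ^ (64 / 100 : ℝ) := by positivity
  have hwa := hN₁ n hn1 α _ a g ha hα (by linarith) hg (by linarith)
  have hwb := hN₁ n hn1 β _ b h hb hβ (by linarith) hh (by linarith)
  have hr := hN₂ n hn2 α β X Y m p q a b g h hm hp hq ha hb hα hβ hD hg hh hX hY
  have hr0 := hN₂ n hn2 α β X Y 0 0 0 a b g h (by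
    rw [Nat.cast_zero]; positivity) le_rfl le_rfl ha hb hα hβ hD hg hh
    hX hY
  have hE : 0 < 1 - α - β + 2 * α * β := by positivity
  have hrc : 0 ≤ ratioConst α β := by unfold ratioConst; positivity
  have hrp : 0 ≤ ratioConst α β * Real.exp (ratioMain α β X Y / (2 * n)) := by positivity
  have key := (hwa.mul hwb (by positivity) (by positivity)).mul
    ((hr.pow hrp (d - 1)).mul hr0 (by positivity) hrp) (by positivity) (by positivity)
  have hcast : (((d - 1 : ℕ) : ℝ)) = d - 1 := by push_cast [hd]; ring
  have heps : ε' + ε' + (((d - 1 : ℕ) : ℝ) * ε' + ε') = ε := by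
    rw [hcast, hε']; field_simp; ring
  rw [heps] at key
  refine Eq.subst (motive := fun y => ExpNear ε _ y) ?_ key
  rw [← pow_succ, Nat.sub_add_cancel hd, mul_pow (ratioConst α β), ← Real.exp_nat_mul, Real.exp_sub, Real.exp_sub,
    show (-X ^ 2 - Y ^ 2 + d * ratioMain α β X Y) / (2 * n) =
      d * (ratioMain α β X Y / (2 * n)) - (α * (1 - α) * X) ^ 2 / (2 * n * (α * (1 - α)) ^ 2)
        - (β * (1 - β) * Y) ^ 2 / (2 * n * (β * (1 - β)) ^ 2) by field_simp; ring,
    Real.exp_sub, Real.exp_sub]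
  ring

set_option maxHeartbeats 1000000 in
-- Two successive Gaussian sums: over h with g fixed, centred at the regression of h on g, and then
-- over g. Their normalisers absorb the prefactors of the weights and leave the inverse square root
-- of the determinant.
theorem centralSum_near {d : ℕ} (hd : 1 ≤ d) {κ ε : ℝ} (hκ : 0 < κ) (hε : 0 < ε) :
    ∃ N : ℕ, ∀ n : ℕ, N ≤ n → ∀ (α β : ℝ) (m p q a b : ℕ),
      (m : ℝ) ≤ (n : ℝ) ^ (1 / 4 : ℝ) → p ≤ m → q ≤ m →
      (a : ℝ) = α * n → (b : ℝ) = β * n → κ ≤ α → κ ≤ β → κ ≤ 1 - α - β →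
      κ ≤ 1 - α - β - ((d : ℝ) - 2) * α * β →
      ExpNear ε (centralSum d n m a b p q) (tauConst d α β) := by
  obtain ⟨N₁, hN₁⟩ := centralTerm_near hd hκ (half_pos hε)
  -- The constants bracket the Gaussian coefficients `formS`/(2w²) here and `formT`/(2w²) below,
  -- where κ² ≤ w ≤ 1.
  obtain ⟨N₂, hN₂⟩ := gaussian_sum_near (c₀ := 1 / 4) (c₁ := (2 + d / κ) / (4 * κ ^ 4))
    (by norm_num) (half_pos (half_pos hε))
  obtain ⟨N₄, hN₄⟩ := gaussian_sum_near (c₀ := κ / 3 / 4) (c₁ := 1 / κ ^ 4)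
    (by positivity) (half_pos (half_pos hε))
  obtain ⟨N₃, hN₃⟩ := exists_windows (κ := min (κ ^ 2) 1) (by positivity)
  refine ⟨max (max N₁ N₄) (max N₂ N₃), fun n hn α β m p q a b hm hp hq ha hb hα hβ hD hd'
    => ?_⟩
  simp only [max_le_iff] at hn
  obtain ⟨⟨hn1, hn4⟩, hn2, hn3⟩ := hn
  obtain ⟨hn, L1, L2, L3, L4⟩ := hN₃ n hn3
  have hnr : (1 : ℝ) ≤ n := by exact_mod_cast hn
  have hn0 : (0 : ℝ) < n := by linarith
  have hα0 : 0 < α := by linarith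
  have hβ0 : 0 < β := by linarith
  have hα1 : 0 < 1 - α := by linarith
  have hβ1 : 0 < 1 - β := by linarith
  have hD0 : 0 < 1 - α - β := by linarith
  have p60 : 0 ≤ (n : ℝ) ^ (60 / 100 : ℝ) := by positivity
  have p63 : 0 ≤ (n : ℝ) ^ (63 / 100 : ℝ) := by positivity
  have p64 : 0 ≤ (n : ℝ) ^ (64 / 100 : ℝ) := by positivity
  have p65 : 0 ≤ (n : ℝ) ^ (65 / 100 : ℝ) := by positivity
  have hmin1 : min (κ ^ 2) 1 ≤ κ ^ 2 := min_le_left _ _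
  have hmin2 : min (κ ^ 2) 1 ≤ 1 := min_le_right _ _
  have i63 := L2.trans (mul_le_of_le_one_left p64 hmin2)
  have i64 := L3.trans (mul_le_of_le_one_left p65 hmin2)
  have j63 := L2.trans (mul_le_mul_of_nonneg_right hmin1 p64)
  have j65 := L4.trans (mul_le_mul_of_nonneg_right hmin1 hn0.le)
  have mulk : ∀ {p q : ℝ}, κ ≤ p → κ ≤ q → κ ^ 2 ≤ p * q := fun {p q} hp hq => by
    rw [sq]; exact mul_le_mul hp hq hκ.le (hκ.le.trans hp)
  have hwa : κ ^ 2 ≤ α * (1 - α) := mulk hα (by linarith)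
  have hwb : κ ^ 2 ≤ β * (1 - β) := mulk hβ (by linarith)
  have hwa1 : α * (1 - α) ≤ 1 := mul_le_one₀ (by linarith) hα1.le (by linarith)
  have hwb1 : β * (1 - β) ≤ 1 := mul_le_one₀ (by linarith) hβ1.le (by linarith)
  have hwa0 : 0 < α * (1 - α) := by positivity
  have hwb0 : 0 < β * (1 - β) := by positivity
  obtain ⟨hA1, hA2⟩ := formA_bounds (d := d) hκ hα hβ hD
  obtain ⟨hB1, hB2⟩ := formB_bounds (d := d) hκ hα hβ hD hd'
  have hB0 : 0 < formB d α β := lt_of_lt_of_le (by positivity) hB1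
  have hσ := abs_formSlope_le hA1 hB0 hB2
  have hABpos : 0 < formA d α β + formB d α β := by linarith
  have hS1 : 1 / 2 ≤ formS d α β := by unfold formS; linarith
  have hS2 : formS d α β ≤ (2 + d / κ) / 2 := by unfold formS; linarith
  have hT1 : κ / 3 / 2 ≤ formT d α β := by
    unfold formT
    rw [le_div_iff₀ hABpos]
    have h1 := mul_le_mul_of_nonneg_left hB1 (show 0 ≤ formA d α β by linarith)
    have h2 := mul_le_mul_of_nonneg_left (hB2.trans hA1) hκ.le
    have h3 : 0 ≤ formA d α β * formB d α β := mul_nonneg (by linarith) hB0.le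
    linarith
  have hT2 : formT d α β ≤ 2 := by
    unfold formT
    rw [div_le_iff₀ hABpos]
    have h1 := mul_le_of_le_one_right (show 0 ≤ formA d α β by linarith) hB2
    linarith
  have hcoef : ∀ {w v lo hi : ℝ}, κ ^ 2 ≤ w → w ≤ 1 → 0 ≤ lo → lo ≤ v → v ≤ hi →
      lo / 2 ≤ v / (2 * w ^ 2) ∧ v / (2 * w ^ 2) ≤ hi / (2 * κ ^ 4) := by
    intro w v lo hi h1 h2 h0 h3 h4
    have hw : 0 < w := lt_of_lt_of_le (by positivity) h1
    have hw2 : w ^ 2 ≤ 1 := pow_le_one₀ hw.le h2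
    have hw3 : κ ^ 4 ≤ w ^ 2 := by
      calc κ ^ 4 = (κ ^ 2) ^ 2 := by ring
        _ ≤ w ^ 2 := pow_le_pow_left₀ (by positivity) h1 2
    exact ⟨div_le_div₀ (by linarith) h3 (by positivity) (by linarith),
      div_le_div₀ (by linarith) h4 (by positivity) (by linarith)⟩
  obtain ⟨hcy1, hcy2⟩ := hcoef hwb hwb1 (by norm_num) hS1 hS2
  obtain ⟨hcx1, hcx2⟩ := hcoef hwa hwa1 (by positivity) hT1 hT2
  have haa : (a : ℝ) * a / n = α ^ 2 * n := by rw [ha]; field_simp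
  have hbb : (b : ℝ) * b / n = β ^ 2 * n := by rw [hb]; field_simp
  set K := Real.exp (-(1 / 2) * Real.log (2 * Real.pi * n * (α * (1 - α)) ^ 2)) *
          Real.exp (-(1 / 2) * Real.log (2 * Real.pi * n * (β * (1 - β)) ^ 2)) *
          ratioConst α β ^ d with hK
  have hE : 0 < 1 - α - β + 2 * α * β := by positivity
  have hrc : 0 ≤ ratioConst α β := by unfold ratioConst; positivity
  have hK0 : 0 ≤ K := by positivity
  have inner : ∀ g ∈ overlapWindow (63 / 100) n a a a,
      ExpNear (ε / 2 + ε / 2 / 2) (∑ h ∈ overlapWindow (64 / 100) n b b b,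
        overlapWeight n a g * overlapWeight n b h *
          (centralRatio n m a b p q g h ^ (d - 1) * centralRatio n 0 a b 0 0 g h))
        (K * √(Real.pi * n / (formS d α β / (2 * (β * (1 - β)) ^ 2))) *
          Real.exp (-(formT d α β / (2 * (α * (1 - α)) ^ 2) * ((g : ℝ) - α ^ 2 * n) ^ 2 / n))) := by
    intro g hg
    rw [mem_overlapWindow, haa] at hg
    set X := ((g : ℝ) - α ^ 2 * n) / (α * (1 - α)) with hX
    have hgX : α * (1 - α) * X = g - α ^ 2 * n := by rw [hX]; field_simp
    have hXb := abs_div_le_of_window hκ hwa rfl (hgX ▸ hg.2)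
    have hXle : |X| ≤ (n : ℝ) ^ (64 / 100 : ℝ) / 2 := by
      have : κ ^ 2 * |X| ≤ κ ^ 2 * ((n : ℝ) ^ (64 / 100 : ℝ) / 2) := by linarith
      exact le_of_mul_le_mul_left this (by positivity)
    -- The displacement of the mean of h caused by g. The slope is at most 1 in absolute value, so ν
    -- is at most half the window of h.
    set ν := β * (1 - β) * (formSlope d α β * X) with hν
    have hνle : |ν| ≤ (n : ℝ) ^ (64 / 100 : ℝ) / 2 := by
      rw [hν, abs_mul, abs_mul (formSlope d α β), abs_of_pos hwb0]
      calc β * (1 - β) * (|formSlope d α β| * |X|) ≤ 1 * (1 * |X|) := by gcongr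
        _ ≤ _ := by linarith
    have hν' := abs_le.mp hνle
    have step1 : ExpNear (ε / 2) (∑ h ∈ overlapWindow (64 / 100) n b b b,
        overlapWeight n a g * overlapWeight n b h *
          (centralRatio n m a b p q g h ^ (d - 1) * centralRatio n 0 a b 0 0 g h))
        (∑ h ∈ overlapWindow (64 / 100) n b b b,
          K * Real.exp (-(formT d α β / (2 * (α * (1 - α)) ^ 2) *
              ((g : ℝ) - α ^ 2 * n) ^ 2 / n)) *
            Real.exp (-(formS d α β / (2 * (β * (1 - β)) ^ 2) *
              ((h : ℝ) - (β ^ 2 * n + ν)) ^ 2 / n))) := by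
      refine ExpNear.sum fun h hh => ?_
      rw [mem_overlapWindow, hbb] at hh
      set Y := ((h : ℝ) - β ^ 2 * n) / (β * (1 - β)) with hY
      have hhY : β * (1 - β) * Y = h - β ^ 2 * n := by rw [hY]; field_simp
      have h1 := hN₁ n hn1 α β X Y m p q a b g h hm hp hq ha hb hα hβ hD (by linarith)
        (by linarith) (hgX ▸ hg.2) (hhY ▸ hh.2)
      rw [form_eq hABpos.ne'] at h1
      convert h1 using 1
      rw [mul_assoc, ← Real.exp_add]
      congr 2
      rw [show (h : ℝ) - (β ^ 2 * n + ν) = β * (1 - β) * (Y - formSlope d α β * X) by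
        rw [hν]; linarith, ← hgX]
      field_simp
      ring
    rw [← Finset.mul_sum] at step1
    have step2 := hN₂ n hn2 (formS d α β / (2 * (β * (1 - β)) ^ 2)) (β ^ 2 * n + ν)
      (by linarith) (hcy2.trans (le_of_eq (by field_simp; ring)))
      (overlapWindow (64 / 100) n b b b)
      (by
        intro h hh
        rw [mem_overlapWindow, hbb] at hh
        have h1 := abs_le.mp hh.2
        rw [abs_le]
        constructor <;> linarith)
      (by
        have := mul_le_mul_of_nonneg_right (mulk hβ hβ) hn0.le
        rw [← sq] at this
        linarith)
      (by
        intro h hh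
        have h1 := abs_le.mp hh
        rw [mem_overlapWindow, hbb]
        refine ⟨?_, by rw [abs_le]; constructor <;> linarith⟩
        have h2 := mul_le_mul_of_nonneg_right hwb hn0.le
        have : (h : ℝ) ≤ b := by rw [hb]; linarith
        exact_mod_cast this)
    have h3 := step1.trans (step2.const_mul (by positivity))
    rwa [mul_right_comm] at h3
  have outer := (ExpNear.sum inner)
  rw [← Finset.mul_sum] at outer
  have step3 := hN₄ n hn4 (formT d α β / (2 * (α * (1 - α)) ^ 2)) (α ^ 2 * n)
    (by linarith) (hcx2.trans (le_of_eq (by field_simp)))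
    (overlapWindow (63 / 100) n a a a)
    (by
      intro g hg
      rw [mem_overlapWindow, haa] at hg
      exact hg.2.trans (by linarith))
    (by
      have := mul_le_mul_of_nonneg_right (mulk hα hα) hn0.le
      rw [← sq] at this
      linarith)
    (by
      intro g hg
      have h1 := abs_le.mp hg
      rw [mem_overlapWindow, haa]
      refine ⟨?_, hg.trans (by linarith)⟩
      have h2 := mul_le_mul_of_nonneg_right hwa hn0.le
      have : (g : ℝ) ≤ a := by rw [ha]; linarith
      exact_mod_cast this)
  have h4 := outer.trans (step3.const_mul (by positivity))
  have hT0 : 0 < formT d α β := lt_of_lt_of_le (by positivity) hT1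
  have hS0 : 0 < formS d α β := by linarith
  have hfin : K * √(Real.pi * n / (formS d α β / (2 * (β * (1 - β)) ^ 2))) *
      √(Real.pi * n / (formT d α β / (2 * (α * (1 - α)) ^ 2))) = tauConst d α β := by
    have e1 := exp_half_log_mul_sqrt hwa0 hn0 hT0
    have e2 := exp_half_log_mul_sqrt hwb0 hn0 hS0
    rw [← ratioConst_pow_div hα0 hβ0 hD0 (by linarith) hd, Real.sqrt_mul hS0.le, hK]
    calc _ = (Real.exp (-(1 / 2) * Real.log (2 * Real.pi * n * (α * (1 - α)) ^ 2)) *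
          √(Real.pi * n / (formT d α β / (2 * (α * (1 - α)) ^ 2)))) *
          (Real.exp (-(1 / 2) * Real.log (2 * Real.pi * n * (β * (1 - β)) ^ 2)) *
          √(Real.pi * n / (formS d α β / (2 * (β * (1 - β)) ^ 2)))) * ratioConst α β ^ d := by ring
      _ = _ := by rw [e1, e2]; field_simp
  rw [hfin, show ε / 2 + ε / 2 / 2 + ε / 2 / 2 = ε by ring] at h4
  exact h4

/-! ## The atypical part of the sum over the overlaps -/

/-- The entropy controls the d-th power of each term, whereas the ratio is the d-th power of their
sum. The power mean inequality passes between them at the cost of a polynomial factor. -/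
theorem mul_sum_pow_le {ι : Type*} (s : Finset ι) {t : ι → ℝ} {W B C : ℝ} {d : ℕ} (hd : 1 ≤ d)
    (hW : 0 ≤ W) (ht : ∀ i ∈ s, 0 ≤ t i) (hB : 0 ≤ B) (h : ∀ i ∈ s, W * t i ^ d ≤ B)
    (hC : (s.card : ℝ) ≤ C) : W * (∑ i ∈ s, t i) ^ d ≤ C ^ d * B := by
  obtain ⟨k, rfl⟩ : ∃ k, d = k + 1 := ⟨d - 1, by omega⟩
  rcases s.eq_empty_or_nonempty with rfl | hs
  · have hC0 : 0 ≤ C := by simpa using hC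
    simp only [Finset.sum_empty, ne_eq, Nat.add_eq_zero_iff, one_ne_zero, and_false,
      not_false_eq_true, zero_pow, mul_zero]
    positivity
  have hc : (0 : ℝ) < s.card := by exact_mod_cast hs.card_pos
  have h1 : (∑ i ∈ s, t i) ^ (k + 1) ≤ (s.card : ℝ) ^ k * ∑ i ∈ s, t i ^ (k + 1) := by
    have := pow_sum_div_card_le_sum_pow (s := s) (f := t) ht k
    rwa [div_le_iff₀' (by positivity)] at this
  calc W * (∑ i ∈ s, t i) ^ (k + 1) ≤ W * ((s.card : ℝ) ^ k * ∑ i ∈ s, t i ^ (k + 1)) :=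
        mul_le_mul_of_nonneg_left h1 hW
    _ = (s.card : ℝ) ^ k * ∑ i ∈ s, W * t i ^ (k + 1) := by rw [← Finset.mul_sum]; ring
    _ ≤ (s.card : ℝ) ^ k * (s.card * B) := by
        refine mul_le_mul_of_nonneg_left ?_ (by positivity)
        simpa using Finset.sum_le_card_nsmul s _ B h
    _ = (s.card : ℝ) ^ (k + 1) * B := by ring
    _ ≤ C ^ (k + 1) * B := by gcongr

theorem pow_mul_sub_le {R S r s M T : ℝ} (hr : 0 ≤ r) (hrR : r ≤ R) (hs : 0 ≤ s) (hsS : s ≤ S)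
    (hR : R ≤ M) (hS : S ≤ M) (hRT : R - r ≤ T) (hST : S - s ≤ T) (k : ℕ) :
    R ^ k * S - r ^ k * s ≤ (k + 1) * (M ^ k * T) := by
  have hT : 0 ≤ T := by linarith
  have hM : 0 ≤ M := by linarith
  induction k with
  | zero => simpa using hST
  | succ k ih =>
    have h1 : r ^ k * s ≤ M ^ k * M :=
      mul_le_mul (pow_le_pow_left₀ hr (hrR.trans hR) k) (hsS.trans hS) hs (by positivity)
    calc R ^ (k + 1) * S - r ^ (k + 1) * s
        = R * (R ^ k * S - r ^ k * s) + (R - r) * (r ^ k * s) := by ring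
      _ ≤ R * ((k + 1) * (M ^ k * T)) + (R - r) * (r ^ k * s) := by
          have := mul_le_mul_of_nonneg_left ih (hr.trans hrR)
          linarith
      _ ≤ M * ((k + 1) * (M ^ k * T)) + T * (M ^ k * M) := by
          refine add_le_add (mul_le_mul_of_nonneg_right hR (by positivity)) ?_
          exact mul_le_mul hRT h1 (by positivity) hT
      _ = ((k + 1 : ℕ) + 1 : ℝ) * (M ^ (k + 1) * T) := by push_cast; ring

/-- A weighted Young inequality, obtained by comparing T with ηM: in either case one of the two
terms on the right suffices. -/
theorem pow_mul_le_of_young {M T η : ℝ} (hM : 0 ≤ M) (hT : 0 ≤ T) (hη : 0 < η) (k : ℕ) :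
    M ^ k * T ≤ η * M ^ (k + 1) + T ^ (k + 1) / η ^ k := by
  rcases le_total T (η * M) with h | h
  · have h1 : M ^ k * T ≤ M ^ k * (η * M) := by gcongr
    have h2 : 0 ≤ T ^ (k + 1) / η ^ k := by positivity
    calc M ^ k * T ≤ M ^ k * (η * M) := h1
      _ = η * M ^ (k + 1) := by ring
      _ ≤ _ := by linarith
  · have h1 : M ≤ T / η := by rw [le_div_iff₀ hη]; linarith
    have h2 : 0 ≤ η * M ^ (k + 1) := by positivity
    calc M ^ k * T ≤ (T / η) ^ k * T := by gcongr
      _ = T ^ (k + 1) / η ^ k := by rw [div_pow]; ring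
      _ ≤ _ := by linarith

/-- Bounds are available only for d-th powers of ratios of one size, while `overlapSum` mixes
R^(d-1) S. Telescoping in terms of the larger of R, S and the larger of the two differences,
followed by Young's inequality, reduces the mixture to such powers. -/
theorem mul_pow_sub_le {d : ℕ} (hd : 1 ≤ d) {W η Q R S r s : ℝ} (hW : 0 ≤ W) (hη : 0 < η)
    (hr : 0 ≤ r) (hrR : r ≤ R) (hs : 0 ≤ s) (hsS : s ≤ S)
    (hR : W * R ^ d ≤ Q) (hS : W * S ^ d ≤ Q) (hRr : W * (R - r) ^ d ≤ η ^ d * Q)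
    (hSs : W * (S - s) ^ d ≤ η ^ d * Q) :
    W * (R ^ (d - 1) * S) - W * (r ^ (d - 1) * s) ≤ 2 * d * η * Q := by
  obtain ⟨k, rfl⟩ : ∃ k, d = k + 1 := ⟨d - 1, by omega⟩
  rw [Nat.add_sub_cancel]
  have hM0 : 0 ≤ max R S := (hr.trans hrR).trans (le_max_left _ _)
  have hT0 : 0 ≤ max (R - r) (S - s) := (sub_nonneg.mpr hrR).trans (le_max_left _ _)
  have hM : W * max R S ^ (k + 1) ≤ Q := by rcases max_choice R S with h | h <;> rwa [h]
  have hT : W * max (R - r) (S - s) ^ (k + 1) ≤ η ^ (k + 1) * Q := by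
    rcases max_choice (R - r) (S - s) with h | h <;> rwa [h]
  have h1 := pow_mul_sub_le hr hrR hs hsS (le_max_left R S) (le_max_right R S)
    (le_max_left (R - r) (S - s)) (le_max_right (R - r) (S - s)) k
  have h2 := pow_mul_le_of_young hM0 hT0 hη k
  have h3 : W * (max R S ^ k * max (R - r) (S - s)) ≤ 2 * η * Q := by
    calc W * (max R S ^ k * max (R - r) (S - s))
        ≤ W * (η * max R S ^ (k + 1) + max (R - r) (S - s) ^ (k + 1) / η ^ k) := by gcongr
      _ = η * (W * max R S ^ (k + 1)) + (W * max (R - r) (S - s) ^ (k + 1)) / η ^ k := by ring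
      _ ≤ η * Q + η ^ (k + 1) * Q / η ^ k := by gcongr
      _ = 2 * η * Q := by field_simp; ring
  calc W * (R ^ k * S) - W * (r ^ k * s) = W * (R ^ k * S - r ^ k * s) := by ring
    _ ≤ W * ((k + 1) * (max R S ^ k * max (R - r) (S - s))) := by gcongr
    _ = (k + 1) * (W * (max R S ^ k * max (R - r) (S - s))) := by ring
    _ ≤ (k + 1) * (2 * η * Q) := by gcongr
    _ = _ := by push_cast; ring

theorem rpow_le_sq_div {n : ℕ} (hn : 1 ≤ n) {e x : ℝ} (he : 63 / 100 ≤ e)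
    (hx : (n : ℝ) ^ e < |x|) : (n : ℝ) ^ (26 / 100 : ℝ) ≤ x ^ 2 / n := by
  have hnr : (1 : ℝ) ≤ n := by exact_mod_cast hn
  have hn0 : (0 : ℝ) < n := by linarith
  have h1 : (n : ℝ) ^ (63 / 100 : ℝ) ≤ |x| :=
    (Real.rpow_le_rpow_of_exponent_le hnr he).trans hx.le
  have h2 : ((n : ℝ) ^ (63 / 100 : ℝ)) ^ 2 = (n : ℝ) ^ (26 / 100 : ℝ) * n := by
    rw [← Real.rpow_natCast, ← Real.rpow_mul hn0.le]
    nth_rewrite 3 [← Real.rpow_one (n : ℝ)]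
    rw [← Real.rpow_add hn0]
    norm_num
  rw [le_div_iff₀ hn0, ← h2, ← sq_abs x]
  exact pow_le_pow_left₀ (by positivity) h1 2

/-- Stretched exponential decay beats the prefactors. -/
theorem exists_stretched_exp_le {d : ℕ} {K c ε : ℝ} (hc : 0 < c) (hε : 0 < ε) :
    ∃ N : ℕ, ∀ n : ℕ, N ≤ n → ((n : ℝ) + 1) ^ 2 * (2 * d * Real.exp (-(c * (n : ℝ) ^ (26 / 100 : ℝ))) *
      (((n : ℝ) + 1) ^ d * Real.exp (K * (n : ℝ) ^ (51 / 200 : ℝ)))) ≤ ε := by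
  obtain ⟨N₁, h₁⟩ := exists_rpow_le_mul (κ := c / 2 / (203 * (d + 2) + |K|)) (s := 51 / 200)
    (t := 26 / 100) (by positivity) (by norm_num)
  obtain ⟨N₂, h₂⟩ := exists_nat_rpow_neg_le (c := 26 / 100) (by norm_num)
    (ε := ε / (2 * (d + 1)) * (c / 2)) (by positivity)
  refine ⟨max N₁ (max N₂ 1), fun n hn => ?_⟩
  simp only [max_le_iff] at hn
  obtain ⟨n1, n2, n3⟩ := hn
  have hnr : (1 : ℝ) ≤ n := by exact_mod_cast n3
  have hn0 : (0 : ℝ) < n := by linarith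
  have a1 := h₁ n n1
  have a2 := h₂ n n2
  have a3 := one_add_log_le n3 (Nat.zero_le n)
  rw [Nat.add_zero] at a3
  have a4 : (n : ℝ) ^ (1 / 200 : ℝ) ≤ (n : ℝ) ^ (51 / 200 : ℝ) :=
    Real.rpow_le_rpow_of_exponent_le hnr (by norm_num)
  rw [div_mul_eq_mul_div, le_div_iff₀ (by positivity)] at a1
  rw [Real.rpow_neg hn0.le] at a2
  have a5 : 0 < (n : ℝ) ^ (26 / 100 : ℝ) := by positivity
  have a6 : 0 < (n : ℝ) ^ (51 / 200 : ℝ) := by positivity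
  generalize (n : ℝ) ^ (26 / 100 : ℝ) = U at *
  generalize (n : ℝ) ^ (51 / 200 : ℝ) = L at *
  have hlog : Real.exp (Real.log (n + 1)) = (n : ℝ) + 1 := Real.exp_log (by linarith)
  have e1 : ((n : ℝ) + 1) ^ 2 * (2 * d * Real.exp (-(c * U)) *
      (((n : ℝ) + 1) ^ d * Real.exp (K * L))) =
      2 * d * Real.exp ((d + 2) * Real.log (n + 1) + K * L - c * U) := by
    rw [show ((d : ℝ) + 2) * Real.log (n + 1) + K * L - c * U =
      ((d + 2 : ℕ) : ℝ) * Real.log (n + 1) + K * L + -(c * U) by push_cast; ring,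
      Real.exp_add, Real.exp_add, Real.exp_nat_mul, hlog]
    ring
  have hexp : (d + 2) * Real.log (n + 1) + K * L - c * U ≤ -(c / 2 * U) := by
    have b1 : ((d : ℝ) + 2) * Real.log (n + 1) ≤ (d + 2) * (203 * L) := by
      gcongr; linarith
    have b2 : K * L ≤ |K| * L := by gcongr; exact le_abs_self K
    nlinarith
  have h5 : Real.exp (-(c / 2 * U)) ≤ U⁻¹ / (c / 2) := by
    rw [Real.exp_neg, show U⁻¹ / (c / 2) = (c / 2 * U)⁻¹ by field_simp]
    refine inv_anti₀ (by positivity) ?_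
    linarith [Real.add_one_le_exp (c / 2 * U)]
  rw [e1]
  calc 2 * d * Real.exp ((d + 2) * Real.log (n + 1) + K * L - c * U)
      ≤ 2 * (d + 1) * (U⁻¹ / (c / 2)) := by
        have := (Real.exp_le_exp.mpr hexp).trans h5
        gcongr
        linarith
    _ ≤ 2 * (d + 1) * (ε / (2 * (d + 1)) * (c / 2) / (c / 2)) := by gcongr
    _ = ε := by field_simp

theorem overlapWindow_subset (e : ℝ) (n a b M : ℕ) : overlapWindow e n a b M ⊆ Finset.range (M + 1) :=
  Finset.filter_subset _ _

theorem centralRatio_nonneg (n m a b p q g h : ℕ) : 0 ≤ centralRatio n m a b p q g h :=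
  Finset.sum_nonneg fun _ _ => overlapTerm_nonneg _ _ _ _ _ _

theorem overlapRatio_add_eq (n m a b p q g h : ℕ) :
    overlapRatio (n + m) (a + p) (b + q) (g + p) (h + q) =
      ∑ s ∈ Finset.range (a - g + 1), overlapTerm (n + m) (a + p) (b + q) (g + p) (h + q) s := by
  rw [overlapRatio, Nat.add_sub_add_right]

theorem centralRatio_le (n m a b p q g h : ℕ) : centralRatio n m a b p q g h ≤
    overlapRatio (n + m) (a + p) (b + q) (g + p) (h + q) := by
  rw [overlapRatio_add_eq]
  exact Finset.sum_le_sum_of_subset_of_nonneg (overlapWindow_subset _ _ _ _ _)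
    fun _ _ _ => overlapTerm_nonneg _ _ _ _ _ _

theorem overlapRatio_sub_centralRatio (n m a b p q g h : ℕ) :
    overlapRatio (n + m) (a + p) (b + q) (g + p) (h + q) - centralRatio n m a b p q g h =
      ∑ s ∈ Finset.range (a - g + 1) \ overlapWindow (65 / 100) n a b (a - g),
        overlapTerm (n + m) (a + p) (b + q) (g + p) (h + q) s := by
  rw [overlapRatio_add_eq, centralRatio, ← Finset.sum_sdiff (overlapWindow_subset _ _ _ _ _)]
  ring

/-- An overlap or an s outside its window costs a factor exp(-(c/4) n^(26/100)), since (n^0.63)²/n =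
n^0.26. This beats exp(K n^(51/200)) and the polynomial numbers of terms. -/
theorem overlapSum_sub_centralSum {d : ℕ} (hd : 1 ≤ d) {c χ P Q ε : ℝ} (hc : 0 < c) (hχ : 0 < χ)
    (hε : 0 < ε)
    (H : ∀ α β : ℝ, |α - P| ≤ χ → |β - Q| ≤ χ → ∀ γ δ s : ℝ, EntRegion α β γ δ s →
      totalEnt d α β γ δ s ≤ -c * critDist α β γ δ s) :
    ∃ N : ℕ, ∀ n : ℕ, N ≤ n → ∀ m p q a b : ℕ,
      (m : ℝ) ≤ (n : ℝ) ^ (1 / 4 : ℝ) → p ≤ m → q ≤ m → |(a : ℝ) / n - P| ≤ χ / 2 →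
      |(b : ℝ) / n - Q| ≤ χ / 2 → a + b ≤ n → a + p + (b + q) ≤ n + m →
      centralSum d n m a b p q ≤ overlapSum d n m a b p q ∧
        overlapSum d n m a b p q ≤ centralSum d n m a b p q + ε := by
  obtain ⟨K, N₁, hK, hT⟩ := tail_bound hd hc hχ H
  have hd0 : (0 : ℝ) < d := by exact_mod_cast hd
  obtain ⟨N₂, hN₂⟩ := exists_stretched_exp_le (d := d) (K := K) (c := c / 4 / d) (by positivity) hε
  refine ⟨max N₁ (max N₂ 1), fun n hn m p q a b hm hp hq ha hb hab hN => ?_⟩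
  simp only [max_le_iff] at hn
  obtain ⟨n1, n2, n3⟩ := hn
  have hnr : (1 : ℝ) ≤ n := by exact_mod_cast n3
  have hn0 : (0 : ℝ) < n := by linarith
  have hsmall := hN₂ n n2
  -- The d-th root of the gain: `mul_pow_sub_le` takes the gain in the form η^d and returns a loss
  -- linear in η.
  set η := Real.exp (-(c / 4 / d * (n : ℝ) ^ (26 / 100 : ℝ))) with hη
  have hη0 : 0 < η := Real.exp_pos _
  have hη1 : η ≤ 1 := by
    rw [hη, Real.exp_le_one_iff]
    have : 0 ≤ c / 4 / d * (n : ℝ) ^ (26 / 100 : ℝ) := by positivity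
    linarith
  set B := Real.exp (K * (n : ℝ) ^ (51 / 200 : ℝ)) with hB
  have hB0 : 0 < B := Real.exp_pos _
  have hηd : η ^ d * B =
      Real.exp (K * (n : ℝ) ^ (51 / 200 : ℝ) - c / 4 * (n : ℝ) ^ (26 / 100 : ℝ)) := by
    rw [hη, hB, ← Real.exp_nat_mul, ← Real.exp_add]
    congr 1
    field_simp
    ring
  have hdist : ∀ g h s : ℕ, 0 ≤ overlapDist n a b g h s := fun g h s => by
    unfold overlapDist; positivity
  -- uniform bounds for the terms, for the two sizes of the graph
  have bound : ∀ m' p' q' : ℕ, (m' : ℝ) ≤ (n : ℝ) ^ (1 / 4 : ℝ) → p' ≤ m' → q' ≤ m' →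
      a + p' + (b + q') ≤ n + m' → ∀ g h s : ℕ, g ≤ a → h ≤ b → s ≤ a - g →
      overlapWeight n a g * overlapWeight n b h *
          overlapTerm (n + m') (a + p') (b + q') (g + p') (h + q') s ^ d ≤ B ∧
      ((n : ℝ) ^ (26 / 100 : ℝ) ≤ overlapDist n a b g h s / n →
        overlapWeight n a g * overlapWeight n b h *
          overlapTerm (n + m') (a + p') (b + q') (g + p') (h + q') s ^ d ≤ η ^ d * B) := by
    intro m' p' q' hm' hp' hq' hN' g h s hg hh hs
    have h1 := hT n n1 m' p' q' a b g h s hm' hp' hq' ha hb hab hN' hg hh hs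
    constructor
    · refine h1.trans (Real.exp_le_exp.mpr ?_)
      have : 0 ≤ c / 4 * overlapDist n a b g h s / n := by
        have := hdist g h s
        positivity
      linarith
    · intro hlarge
      rw [hηd]
      refine h1.trans (Real.exp_le_exp.mpr ?_)
      rw [mul_div_assoc]
      have := mul_le_mul_of_nonneg_left hlarge (show 0 ≤ c / 4 by positivity)
      linarith
  have cardle : ∀ g, (((Finset.range (a - g + 1)).card : ℕ) : ℝ) ≤ (n : ℝ) + 1 := by
    intro g
    rw [Finset.card_range]
    have : a - g + 1 ≤ n + 1 := by omega
    exact_mod_cast this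
  have rbound : ∀ m' p' q' : ℕ, (m' : ℝ) ≤ (n : ℝ) ^ (1 / 4 : ℝ) → p' ≤ m' → q' ≤ m' →
      a + p' + (b + q') ≤ n + m' → ∀ g h : ℕ, g ≤ a → h ≤ b →
      overlapWeight n a g * overlapWeight n b h *
          overlapRatio (n + m') (a + p') (b + q') (g + p') (h + q') ^ d ≤ ((n : ℝ) + 1) ^ d * B ∧
      overlapWeight n a g * overlapWeight n b h *
          (overlapRatio (n + m') (a + p') (b + q') (g + p') (h + q') -
            centralRatio n m' a b p' q' g h) ^ d ≤ η ^ d * (((n : ℝ) + 1) ^ d * B) ∧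
      ((g ∉ overlapWindow (63 / 100) n a a a ∨ h ∉ overlapWindow (64 / 100) n b b b) →
        overlapWeight n a g * overlapWeight n b h *
          overlapRatio (n + m') (a + p') (b + q') (g + p') (h + q') ^ d ≤
            η ^ d * (((n : ℝ) + 1) ^ d * B)) := by
    intro m' p' q' hm' hp' hq' hN' g h hg hh
    have hW : 0 ≤ overlapWeight n a g * overlapWeight n b h :=
      mul_nonneg (overlapWeight_nonneg _ _ _) (overlapWeight_nonneg _ _ _)
    have hb' := bound m' p' q' hm' hp' hq' hN' g h
    refine ⟨?_, ?_, fun hout => ?_⟩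
    · rw [overlapRatio_add_eq]
      exact mul_sum_pow_le _ hd hW (fun s _ => overlapTerm_nonneg _ _ _ _ _ _) hB0.le
        (fun s hs => (hb' s hg hh (by rw [Finset.mem_range] at hs; omega)).1) (cardle g)
    · rw [overlapRatio_sub_centralRatio, mul_left_comm]
      refine mul_sum_pow_le _ hd hW (fun s _ => overlapTerm_nonneg _ _ _ _ _ _) (by positivity)
        (fun s hs => ?_)
        ((Nat.cast_le.mpr (Finset.card_le_card Finset.sdiff_subset)).trans (cardle g))
      rw [Finset.mem_sdiff, mem_overlapWindow, Finset.mem_range, not_and, not_le] at hs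
      have hs1 : s ≤ a - g := by omega
      refine (hb' s hg hh hs1).2 ((rpow_le_sq_div n3 (by norm_num) (hs.2 hs1)).trans ?_)
      unfold overlapDist
      gcongr
      linarith [sq_nonneg ((g : ℝ) - a * a / n), sq_nonneg ((h : ℝ) - b * b / n)]
    · rw [overlapRatio_add_eq, mul_left_comm]
      refine mul_sum_pow_le _ hd hW (fun s _ => overlapTerm_nonneg _ _ _ _ _ _) (by positivity)
        (fun s hs => ?_) (cardle g)
      have hs1 : s ≤ a - g := by rw [Finset.mem_range] at hs; omega
      refine (hb' s hg hh hs1).2 ?_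
      rcases hout with hout | hout
      · rw [mem_overlapWindow, not_and, not_le] at hout
        refine (rpow_le_sq_div n3 (by norm_num) (hout hg)).trans ?_
        unfold overlapDist
        gcongr
        linarith [sq_nonneg ((s : ℝ) - a * b / n), sq_nonneg ((h : ℝ) - b * b / n)]
      · rw [mem_overlapWindow, not_and, not_le] at hout
        refine (rpow_le_sq_div n3 (by norm_num) (hout hh)).trans ?_
        unfold overlapDist
        gcongr
        linarith [sq_nonneg ((s : ℝ) - a * b / n), sq_nonneg ((g : ℝ) - a * a / n)]
  set Φ : ℕ → ℕ → ℝ := fun g h => overlapWeight n a g * overlapWeight n b h *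
      (overlapRatio (n + m) (a + p) (b + q) (g + p) (h + q) ^ (d - 1) * overlapRatio n a b g h)
    with hΦ
  set Ψ : ℕ → ℕ → ℝ := fun g h => overlapWeight n a g * overlapWeight n b h *
      (centralRatio n m a b p q g h ^ (d - 1) * centralRatio n 0 a b 0 0 g h) with hΨ
  have hR0 : ∀ N a b g h, 0 ≤ overlapRatio N a b g h := fun N a b g h =>
    Finset.sum_nonneg fun _ _ => overlapTerm_nonneg _ _ _ _ _ _
  have hΦ0 : ∀ g h, 0 ≤ Φ g h := fun g h => by
    have := hR0 (n + m) (a + p) (b + q) (g + p) (h + q)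
    have := hR0 n a b g h
    have := overlapWeight_nonneg n a g
    have := overlapWeight_nonneg n b h
    positivity
  have hΨ0 : ∀ g h, 0 ≤ Ψ g h := fun g h => by
    have := centralRatio_nonneg n m a b p q g h
    have := centralRatio_nonneg n 0 a b 0 0 g h
    have := overlapWeight_nonneg n a g
    have := overlapWeight_nonneg n b h
    positivity
  have hΨΦ : ∀ g h, Ψ g h ≤ Φ g h := fun g h => by
    have h1 := centralRatio_le n m a b p q g h
    have h2 := centralRatio_le n 0 a b 0 0 g h
    have := hR0 (n + m) (a + p) (b + q) (g + p) (h + q)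
    have := centralRatio_nonneg n m a b p q g h
    have := centralRatio_nonneg n 0 a b 0 0 g h
    have := overlapWeight_nonneg n a g
    have := overlapWeight_nonneg n b h
    simp only [hΦ, hΨ]
    gcongr
    exact h2
  set E := 2 * d * η * (((n : ℝ) + 1) ^ d * B) with hE
  have hm0 : ((0 : ℕ) : ℝ) ≤ (n : ℝ) ^ (1 / 4 : ℝ) := by rw [Nat.cast_zero]; positivity
  have hdiff : ∀ g h : ℕ, g ≤ a → h ≤ b → Φ g h - (if g ∈ overlapWindow (63 / 100) n a a a then
      (if h ∈ overlapWindow (64 / 100) n b b b then Ψ g h else 0) else 0) ≤ E := by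
    intro g h hg hh
    have hW : 0 ≤ overlapWeight n a g * overlapWeight n b h :=
      mul_nonneg (overlapWeight_nonneg _ _ _) (overlapWeight_nonneg _ _ _)
    obtain ⟨r1, r2, r3⟩ := rbound m p q hm hp hq hN g h hg hh
    obtain ⟨s1, s2, s3⟩ := rbound 0 0 0 hm0 le_rfl le_rfl (by omega) g h hg hh
    have hout : (g ∉ overlapWindow (63 / 100) n a a a ∨ h ∉ overlapWindow (64 / 100) n b b b) →
        Φ g h ≤ E := by
      intro hout
      -- Outside the windows of g and h nothing is central, so the comparison is made with zero in
      -- place of both central ratios.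
      have h1 := mul_pow_sub_le hd hW hη0 le_rfl (hR0 _ _ _ _ _) le_rfl (hR0 _ _ _ _ _) r1 s1
        (by rw [sub_zero]; exact r3 hout) (by rw [sub_zero]; exact s3 hout)
      rw [mul_zero, mul_zero, sub_zero] at h1
      exact h1
    by_cases hgw : g ∈ overlapWindow (63 / 100) n a a a
    · by_cases hhw : h ∈ overlapWindow (64 / 100) n b b b
      · rw [if_pos hgw, if_pos hhw]
        exact mul_pow_sub_le hd hW hη0 (centralRatio_nonneg _ _ _ _ _ _ _ _)
          (centralRatio_le _ _ _ _ _ _ _ _) (centralRatio_nonneg _ _ _ _ _ _ _ _)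
          (centralRatio_le _ _ _ _ _ _ _ _) r1 s1 r2 s2
      · rw [if_pos hgw, if_neg hhw, sub_zero]
        exact hout (Or.inr hhw)
    · rw [if_neg hgw, sub_zero]
      exact hout (Or.inl hgw)
  have hcentral : centralSum d n m a b p q = ∑ g ∈ Finset.range (a + 1), ∑ h ∈ Finset.range (b + 1),
      (if g ∈ overlapWindow (63 / 100) n a a a then
        (if h ∈ overlapWindow (64 / 100) n b b b then Ψ g h else 0) else 0) := by
    rw [centralSum, ← Finset.sum_subset (overlapWindow_subset (63 / 100) n a a a)
      (fun g _ hg => by simp only [if_neg hg, Finset.sum_const_zero])]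
    refine Finset.sum_congr rfl fun g hg => ?_
    rw [← Finset.sum_subset (overlapWindow_subset (64 / 100) n b b b)
      (fun h _ hh => by simp only [if_neg hh, ite_self])]
    exact Finset.sum_congr rfl fun h hh => by rw [if_pos hg, if_pos hh]
  have hover : overlapSum d n m a b p q =
      ∑ g ∈ Finset.range (a + 1), ∑ h ∈ Finset.range (b + 1), Φ g h := rfl
  rw [hcentral, hover]
  constructor
  · refine Finset.sum_le_sum fun g _ => Finset.sum_le_sum fun h _ => ?_
    split_ifs
    · exact hΨΦ g h
    · exact hΦ0 g h
    · exact hΦ0 g h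
  · rw [← sub_le_iff_le_add', ← Finset.sum_sub_distrib]
    refine le_trans ?_ hsmall
    have hE0 : 0 ≤ E := by positivity
    calc _ ≤ ∑ g ∈ Finset.range (a + 1), ((n : ℝ) + 1) * E := by
          refine Finset.sum_le_sum fun g hg => ?_
          rw [← Finset.sum_sub_distrib]
          calc _ ≤ ∑ h ∈ Finset.range (b + 1), E := by
                refine Finset.sum_le_sum fun h hh => ?_
                rw [Finset.mem_range] at hg hh
                exact hdiff g h (by omega) (by omega)
            _ = ((b : ℝ) + 1) * E := by simp
            _ ≤ _ := by gcongr; omega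
      _ = ((a : ℝ) + 1) * (((n : ℝ) + 1) * E) := by simp
      _ ≤ ((n : ℝ) + 1) * (((n : ℝ) + 1) * E) := by gcongr; omega
      _ = _ := by rw [hE]; ring

/-! ## The asymptotics of the moments -/

theorem ExpNear.symm {ε x y : ℝ} (h : ExpNear ε x y) : ExpNear ε y x := by
  constructor
  · rw [Real.exp_neg, inv_mul_le_iff₀ (Real.exp_pos _)]; exact h.2
  · have := h.1
    rwa [Real.exp_neg, inv_mul_le_iff₀ (Real.exp_pos _)] at this

/-- Uniform two-sided bounds, needed to turn the additive tail error into a relative one and the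
final relative error back into an additive one. -/
theorem tauConst_bounds {d : ℕ} {α β κ : ℝ} (hd : 1 ≤ d) (hκ : 0 < κ) (hα : κ ≤ α) (hβ : κ ≤ β)
    (hD : κ ≤ 1 - α - β) (hd' : κ ≤ 1 - α - β - ((d : ℝ) - 2) * α * β) :
    (κ ^ 2 / 2) ^ d / (2 + d / κ) ≤ tauConst d α β ∧
      tauConst d α β ≤ (1 / κ) ^ d / √(κ / 3) := by
  have hα0 : 0 < α := by linarith
  have hβ0 : 0 < β := by linarith
  have hD0 : 0 < 1 - α - β := by linarith
  have hα1 : 0 < 1 - α := by linarith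
  have hβ1 : 0 < 1 - β := by linarith
  have hk : α * β ≤ 1 := mul_le_one₀ (by linarith) hβ0.le (by linarith)
  have hk0 : 0 < α * β := by positivity
  obtain ⟨hA1, hA2⟩ := formA_bounds (d := d) hκ hα hβ hD
  obtain ⟨hB1, hB2⟩ := formB_bounds (d := d) hκ hα hβ hD hd'
  have hB0 : 0 < formB d α β := lt_of_lt_of_le (by positivity) hB1
  have hST : formS d α β * formT d α β = formA d α β * formB d α β := by
    have : 0 < formA d α β + formB d α β := by linarith
    unfold formS formT; field_simp
  have hP1 : κ ^ 2 ≤ (1 - α) * (1 - β) := by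
    rw [sq]; exact mul_le_mul (by linarith) (by linarith) hκ.le hα1.le
  have hP2 : (1 - α) * (1 - β) ≤ 1 := mul_le_one₀ (by linarith) hβ1.le (by linarith)
  have hQ1 : κ ≤ √((1 - α - β) * (1 - α - β + 2 * α * β)) := by
    apply Real.le_sqrt_of_sq_le
    rw [sq]; exact mul_le_mul hD (by nlinarith) hκ.le hD0.le
  have hQ2 : √((1 - α - β) * (1 - α - β + 2 * α * β)) ≤ 2 := by
    rw [Real.sqrt_le_left (by norm_num)]
    nlinarith
  have hr1 : κ ^ 2 / 2 ≤ ratioConst α β :=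
    div_le_div₀ (by positivity) hP1 (by linarith) hQ2
  have hr2 : ratioConst α β ≤ 1 / κ := div_le_div₀ (by norm_num) hP2 hκ hQ1
  have hAB1 : κ / 3 ≤ formA d α β * formB d α β := by nlinarith
  have hAB2 : √(formA d α β * formB d α β) ≤ 2 + d / κ := by
    have h0 : 0 ≤ d / κ := by positivity
    rw [Real.sqrt_le_left (by positivity)]
    nlinarith
  rw [← ratioConst_pow_div hα0 hβ0 hD0 (by linarith) hd, hST]
  constructor
  · refine div_le_div₀ (pow_nonneg (le_trans (by positivity) hr1) d)
      (pow_le_pow_left₀ (by positivity) hr1 d) ?_ hAB2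
    exact Real.sqrt_pos.mpr (lt_of_lt_of_le (by positivity) hAB1)
  · exact div_le_div₀ (by positivity)
      (pow_le_pow_left₀ (le_trans (by positivity) hr1) hr2 d)
      (Real.sqrt_pos.mpr (by positivity)) (Real.sqrt_le_sqrt hAB1)

/-- For large `n` the boundary is too small to obstruct the packing of the two occupied sides. -/
theorem exists_add_le {κ : ℝ} (hκ : 0 < κ) :
    ∃ N : ℕ, ∀ n : ℕ, N ≤ n → ∀ (α β : ℝ) (m p q a b : ℕ), (m : ℝ) ≤ (n : ℝ) ^ (1 / 4 : ℝ) →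
      p ≤ m → q ≤ m → (a : ℝ) = α * n → (b : ℝ) = β * n → κ ≤ 1 - α - β →
      a + p + (b + q) ≤ n + m := by
  obtain ⟨N, hN⟩ := exists_rpow_le_mul (κ := κ) (s := 1 / 4) (t := 1) hκ (by norm_num)
  refine ⟨N, fun n hn α β m p q a b hm hp hq ha hb hD => ?_⟩
  have h1 := hN n hn
  rw [Real.rpow_one] at h1
  have h2 := mul_le_mul_of_nonneg_right hD (Nat.cast_nonneg (α := ℝ) n)
  have hp' : (p : ℝ) ≤ m := by exact_mod_cast hp
  have hq' : (q : ℝ) ≤ m := by exact_mod_cast hq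
  have h3 : (a : ℝ) + p + (b + q) ≤ n + m := by linarith
  exact_mod_cast h3

/-- The limit does not depend on m, p or q. With m = 0 it covers the model without boundary as well.
-/
theorem overlapSum_near {d : ℕ} (hd : 1 ≤ d) {c χ κ P Q ε : ℝ} (hc : 0 < c) (hχ : 0 < χ)
    (hκ : 0 < κ) (hε : 0 < ε)
    (H : ∀ α β : ℝ, |α - P| ≤ χ → |β - Q| ≤ χ → κ ≤ α ∧ κ ≤ β ∧ κ ≤ 1 - α - β ∧
      κ ≤ 1 - α - β - ((d : ℝ) - 2) * α * β ∧ ∀ γ δ s : ℝ, EntRegion α β γ δ s →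
      totalEnt d α β γ δ s ≤ -c * critDist α β γ δ s) :
    ∃ N : ℕ, ∀ n : ℕ, N ≤ n → ∀ (α β : ℝ) (m p q a b : ℕ),
      |α - P| ≤ χ / 2 → |β - Q| ≤ χ / 2 → (m : ℝ) ≤ (n : ℝ) ^ (1 / 4 : ℝ) → p ≤ m → q ≤ m →
      (a : ℝ) = α * n → (b : ℝ) = β * n →
      ExpNear ε (overlapSum d n m a b p q) (tauConst d α β) := by
  have hlow : 0 < (κ ^ 2 / 2) ^ d / (2 + d / κ) := by positivity
  set τ₀ := (κ ^ 2 / 2) ^ d / (2 + d / κ)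
  obtain ⟨N₁, h₁⟩ := centralSum_near hd hκ (half_pos hε)
  obtain ⟨N₂, h₂⟩ := overlapSum_sub_centralSum hd hc hχ (ε := ε / 2 * τ₀) (by positivity)
    (fun α β hα hβ => (H α β hα hβ).2.2.2.2)
  obtain ⟨N₃, h₃⟩ := exists_add_le hκ
  refine ⟨max (max N₁ N₂) (max N₃ 1), fun n hn α β m p q a b hα hβ hm hp hq ha hb => ?_⟩
  simp only [max_le_iff] at hn
  obtain ⟨⟨n1, n2⟩, n3, n4⟩ := hn
  have hn0 : (0 : ℝ) < n := by exact_mod_cast n4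
  obtain ⟨k1, k2, k3, k4, -⟩ := H α β (hα.trans (by linarith)) (hβ.trans (by linarith))
  have hN := h₃ n n3 α β m p q a b hm hp hq ha hb k3
  have hab : a + b ≤ n := by
    have : (a : ℝ) + b ≤ n := by rw [ha, hb]; nlinarith
    exact_mod_cast this
  have hτ := (tauConst_bounds hd hκ k1 k2 k3 k4).1
  obtain ⟨c1, c2⟩ := h₁ n n1 α β m p q a b hm hp hq ha hb k1 k2 k3 k4
  obtain ⟨o1, o2⟩ := h₂ n n2 m p q a b hm hp hq (by rwa [ha, mul_div_cancel_right₀ _ hn0.ne'])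
    (by rwa [hb, mul_div_cancel_right₀ _ hn0.ne']) hab hN
  have hτ0 : 0 < tauConst d α β := lt_of_lt_of_le hlow hτ
  constructor
  · refine le_trans ?_ (c1.trans o1)
    gcongr
    linarith
  -- The additive tail error is at most ε/2 times the limit, and exp(ε/2) + ε/2 ≤ exp ε.
  · have e1 : Real.exp ε = Real.exp (ε / 2) * Real.exp (ε / 2) := by
      rw [← Real.exp_add, add_halves]
    have e2 := Real.add_one_le_exp (ε / 2)
    have e3 : Real.exp (ε / 2) + ε / 2 ≤ Real.exp ε := by rw [e1]; nlinarith
    have e4 := mul_le_mul_of_nonneg_right e3 hτ0.le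
    have e5 := mul_le_mul_of_nonneg_left hτ (half_pos hε).le
    linarith

/-! ### Boundary size, first moments and the conclusion -/

theorem boundarySize_le {d : ℕ} (hd : 3 ≤ d) {θ ψ : ℝ} (hθ0 : 0 < θ) (hθ : θ < 1 / 8)
    (hψ0 : 0 < ψ) (hψ : ψ < 1 / 8) {n : ℕ} (hn : 1 ≤ n) :
    (boundarySize d θ ψ n : ℝ) ≤ (n : ℝ) ^ (1 / 4 : ℝ) := by
  have hd' : (3 : ℝ) ≤ d := by exact_mod_cast hd
  have hn0 : (0 : ℝ) < n := by exact_mod_cast hn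
  set l := Real.logb ((d : ℝ) - 1) n with hl
  have hl0 : 0 ≤ l := Real.logb_nonneg (by linarith) (by exact_mod_cast hn)
  have h1 := Nat.floor_le (show 0 ≤ θ * l by positivity)
  have h2 := Nat.floor_le (show 0 ≤ ψ / 2 * l by positivity)
  rw [boundarySize, Nat.cast_pow, Nat.cast_sub (by omega), Nat.cast_one, ← hl,
    ← Real.rpow_natCast]
  calc _ ≤ ((d : ℝ) - 1) ^ (l * (1 / 4)) := by
        -- The exponent is at most (θ + ψ) log_{d-1} n, and θ + ψ < 1/4.
        apply Real.rpow_le_rpow_of_exponent_le (by linarith)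
        push_cast
        nlinarith
    _ = (n : ℝ) ^ (1 / 4 : ℝ) := by
        rw [Real.rpow_mul (by linarith), hl,
          Real.rpow_logb (by linarith) (by linarith) hn0]

/-- The predicted ratio is the square of the factor by which the boundary changes the first moment.
-/
theorem secondMomentRatio_eq_sq (d m : ℕ) (lam α β : ℝ) (ηp ηm : Finset (Fin m)) :
    secondMomentRatio d m lam α β ηp ηm = (lam ^ (ηp.card + ηm.card) *
      (((1 - α) * (1 - β) / (1 - α - β)) ^ m * ((1 - α - β) / (1 - β)) ^ ηm.card *
        ((1 - α - β) / (1 - α)) ^ ηp.card) ^ (d - 1)) ^ 2 := by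
  unfold secondMomentRatio cStar
  generalize (1 - α) * (1 - β) / (1 - α - β) = u
  generalize (1 - α - β) / (1 - β) = v
  generalize (1 - α - β) / (1 - α) = w
  rw [mul_comm (d - 1) m, mul_comm 2 ηm.card, mul_comm 2 ηp.card, pow_add]
  simp only [mul_pow, ← pow_mul]
  rw [mul_right_comm ηm.card (d - 1) 2, mul_right_comm ηp.card (d - 1) 2,
    mul_comm (d - 1) (ηm.card * 2), mul_comm (d - 1) (ηp.card * 2)]
  ring

/-- Only d-1 matchings see the boundary, each through `avoidRate_near`; the last one contributes the
same factor to both models. -/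
theorem gadgetMoment1_near {d : ℕ} (hd : 1 ≤ d) {κ ε lam : ℝ} (hκ : 0 < κ) (hε : 0 < ε)
    (hlam : 0 < lam) :
    ∃ N : ℕ, ∀ n : ℕ, N ≤ n → ∀ (α β : ℝ) (m a b : ℕ) (ηp ηm : Finset (Fin m)),
      (m : ℝ) ≤ (n : ℝ) ^ (1 / 4 : ℝ) → (a : ℝ) = α * n → (b : ℝ) = β * n →
      κ ≤ α → κ ≤ β → κ ≤ 1 - α - β →
      ExpNear ε (gadgetMoment1 d n m lam α β ηp ηm) (mwwFirst d n lam a b *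
        (lam ^ (ηp.card + ηm.card) *
          (((1 - α) * (1 - β) / (1 - α - β)) ^ m * ((1 - α - β) / (1 - β)) ^ ηm.card *
            ((1 - α - β) / (1 - α)) ^ ηp.card) ^ (d - 1))) := by
  obtain ⟨N₁, h₁⟩ := avoidRate_near hκ (ε := ε / d) (by positivity)
  obtain ⟨N₂, h₂⟩ := exists_add_le hκ
  refine ⟨max N₁ N₂, fun n hn α β m a b ηp ηm hm ha hb hα hβ hD => ?_⟩
  simp only [max_le_iff] at hn
  have hp : ηp.card ≤ m := by simpa using ηp.card_le_univ
  have hq : ηm.card ≤ m := by simpa using ηm.card_le_univ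
  have hN := h₂ n hn.2 α β m _ _ a b hm hp hq ha hb hD
  have h := h₁ n hn.1 α β m _ _ a b hm hp hq ha hb hα hβ hD hN
  have hα1 : 0 < 1 - α := by linarith
  have hβ1 : 0 < 1 - β := by linarith
  have hD0 : 0 < 1 - α - β := by linarith
  have hav := avoidRate_nonneg n a b
  rw [gadgetMoment1_eq lam α β ha.symm hb.symm, mwwFirst]
  have h3 := ((h.pow (by positivity) (d - 1)).const_mul
    (c := lam ^ (a + ηp.card + (b + ηm.card)) * ((n.choose a * n.choose b : ℝ) * avoidRate n a b))
    (by positivity)).mono (ε' := ε) (by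
      have hd0 : (0 : ℝ) < d := by exact_mod_cast hd
      have : ((d - 1 : ℕ) : ℝ) ≤ d := by exact_mod_cast Nat.sub_le d 1
      calc ((d - 1 : ℕ) : ℝ) * (ε / d) ≤ d * (ε / d) := by gcongr
        _ = ε := by field_simp) (by positivity)
  convert h3 using 1
  · ring
  · obtain ⟨k, rfl⟩ : ∃ k, d = k + 1 := ⟨d - 1, by omega⟩
    rw [Nat.add_sub_cancel, mul_pow _ (avoidRate n a b), pow_succ (avoidRate n a b)]
    ring

theorem criticalFugacity_pos {d : ℕ} (hd : 3 ≤ d) : 0 < criticalFugacity d := by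
  have hd' : (3 : ℝ) ≤ d := by exact_mod_cast hd
  have h1 : (0 : ℝ) < d - 1 := by linarith
  have h2 : (0 : ℝ) < d - 2 := by linarith
  unfold criticalFugacity
  positivity

theorem mainTheorem8 (d : ℕ) (hd : 3 ≤ d) (lam : ℝ) (hlam : criticalFugacity d < lam)
    (hcond : TechnicalCondition d lam) :
    ∃ χ : ℝ, 0 < χ ∧
      ∀ θ ψ : ℝ, 0 < θ → θ < 1 / 8 → 0 < ψ → ψ < 1 / 8 →
      ∀ ε : ℝ, 0 < ε → ∃ N : ℕ, ∀ n : ℕ, N ≤ n →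
      ∀ α β : ℝ, |α - pMinus d lam| < χ → |β - pPlus d lam| < χ →
        (∃ a : ℕ, α * n = a) → (∃ b : ℕ, β * n = b) →
      ∀ ηp ηm : Finset (Fin (boundarySize d θ ψ n)),
        |gadgetMoment2 d n (boundarySize d θ ψ n) lam α β ηp ηm / mwwMoment2 d n lam α β
            / secondMomentRatio d (boundarySize d θ ψ n) lam α β ηp ηm - 1| < ε ∧
        |gadgetMoment2 d n (boundarySize d θ ψ n) lam α β ηp ηm
            / gadgetMoment1 d n (boundarySize d θ ψ n) lam α β ηp ηm ^ 2
            - tauConst d α β| < ε := by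
  have hd1 : 1 ≤ d := by omega
  have hlam0 : 0 < lam := (criticalFugacity_pos hd).trans hlam
  obtain ⟨χ, κ, c, hχ, hκ, hc, H⟩ := hcond.exists_quadratic_bound (by omega)
  refine ⟨χ / 2, half_pos hχ, fun θ ψ hθ0 hθ hψ0 hψ ε hε => ?_⟩
  have hτhi : 0 < (1 / κ) ^ d / √(κ / 3) := by
    have : 0 < √(κ / 3) := Real.sqrt_pos.mpr (by positivity)
    positivity
  set τ₁ := (1 / κ) ^ d / √(κ / 3)
  -- The first relative error is exp(±4ε₁), which must have exponent at most 1; the second bound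
  -- allows for multiplication by the upper bound τ₁ of the limit.
  set ε₁ := min (1 / 4) (ε / (16 * (1 + τ₁))) with hε₁
  have hε₁0 : 0 < ε₁ := by positivity
  have hε₁1 : ε₁ ≤ 1 / 4 := min_le_left _ _
  have hε₁2 : ε₁ * (16 * (1 + τ₁)) ≤ ε := by
    rw [← le_div_iff₀ (by positivity)]; exact min_le_right _ _
  obtain ⟨N₁, h₁⟩ := overlapSum_near hd1 hc hχ hκ hε₁0 H
  obtain ⟨N₂, h₂⟩ := gadgetMoment1_near hd1 hκ hε₁0 hlam0
  obtain ⟨N₃, h₃⟩ := exists_add_le hκ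
  refine ⟨max (max N₁ N₂) (max N₃ 1), fun n hn α β hα hβ ⟨a, ha⟩ ⟨b, hb⟩ ηp ηm => ?_⟩
  simp only [max_le_iff] at hn
  obtain ⟨⟨n1, n2⟩, n3, n4⟩ := hn
  have hm := boundarySize_le hd hθ0 hθ hψ0 hψ n4
  generalize boundarySize d θ ψ n = m at *
  obtain ⟨k1, k2, k3, k4, -⟩ := H α β (hα.le.trans (by linarith)) (hβ.le.trans (by linarith))
  have hp : ηp.card ≤ m := by simpa using ηp.card_le_univ
  have hq : ηm.card ≤ m := by simpa using ηm.card_le_univ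
  have hN := h₃ n n3 α β m _ _ a b hm hp hq ha.symm hb.symm k3
  have hm0 : ((0 : ℕ) : ℝ) ≤ (n : ℝ) ^ (1 / 4 : ℝ) := by rw [Nat.cast_zero]; positivity
  have hab : a + b ≤ n := by simpa using h₃ n n3 α β 0 0 0 a b hm0 le_rfl le_rfl ha.symm hb.symm k3
  obtain ⟨τlo, τhi⟩ := tauConst_bounds hd1 hκ k1 k2 k3 k4
  have hτ0 : 0 < tauConst d α β := lt_of_lt_of_le (by positivity) τlo
  have hα0 : 0 < α := by linarith
  have hβ0 : 0 < β := by linarith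
  have hα1 : 0 < 1 - α := by linarith
  have hβ1 : 0 < 1 - β := by linarith
  have hD0 : 0 < 1 - α - β := by linarith
  have hS := h₁ n n1 α β m _ _ a b hα.le hβ.le hm hp hq ha.symm hb.symm
  have hS0 := h₁ n n1 α β 0 0 0 a b hα.le hβ.le hm0 le_rfl le_rfl ha.symm hb.symm
  have hG := h₂ n n2 α β m a b ηp ηm hm ha.symm hb.symm k1 k2 k3
  rw [secondMomentRatio_eq_sq, gadgetMoment2_eq lam α β ha hb ηp ηm hab hN,
    mwwMoment2_eq hd1 lam α β ha hb hab]
  have hratio : 0 < lam ^ (ηp.card + ηm.card) *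
      (((1 - α) * (1 - β) / (1 - α - β)) ^ m * ((1 - α - β) / (1 - β)) ^ ηm.card *
        ((1 - α - β) / (1 - α)) ^ ηp.card) ^ (d - 1) := by positivity
  set ρ := lam ^ (ηp.card + ηm.card) *
      (((1 - α) * (1 - β) / (1 - α - β)) ^ m * ((1 - α - β) / (1 - β)) ^ ηm.card *
        ((1 - α - β) / (1 - α)) ^ ηp.card) ^ (d - 1)
  have hF : 0 < mwwFirst d n lam a b := by
    have h1 := avoidRate_pos hab
    have h2 : (0 : ℝ) < n.choose a := by exact_mod_cast Nat.choose_pos (by omega)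
    have h3 : (0 : ℝ) < n.choose b := by exact_mod_cast Nat.choose_pos (by omega)
    unfold mwwFirst
    positivity
  have hG0 : 0 < gadgetMoment1 d n m lam α β ηp ηm :=
    lt_of_lt_of_le (by positivity) hG.1
  have hS00 : 0 < overlapSum d n 0 a b 0 0 := lt_of_lt_of_le (by positivity) hS0.1
  constructor
  -- Both values of `overlapSum` are close to the same constant, hence to each other. This costs
  -- 2ε₁, and squaring the first-moment comparison costs another 2ε₁.
  · have key := (hG.pow (by positivity) 2).mul (hS.trans hS0.symm) (by positivity) hS00.le
    have h5 := key.abs_div_sub_one_le (by positivity) (by positivity) (by push_cast; linarith)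
    rw [div_div, show mwwFirst d n lam a b ^ 2 * overlapSum d n 0 a b 0 0 * ρ ^ 2 =
      (mwwFirst d n lam a b * ρ) ^ 2 * overlapSum d n 0 a b 0 0 by ring]
    refine lt_of_le_of_lt h5 ?_
    push_cast
    nlinarith
  · rw [mul_div_cancel_left₀ _ (by positivity)]
    have h5 := hS.abs_div_sub_one_le hτ0 hε₁0.le (by linarith)
    have h6 : overlapSum d n m a b ηp.card ηm.card - tauConst d α β =
        (overlapSum d n m a b ηp.card ηm.card / tauConst d α β - 1) * tauConst d α β := by
      field_simp
    rw [h6, abs_mul, abs_of_pos hτ0]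
    calc _ ≤ 2 * ε₁ * τ₁ := mul_le_mul h5 τhi hτ0.le (by positivity)
      _ < ε := by nlinarith
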